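/- Let $n\in\mathbb N$, $n\ge 1$, $c>0$, $\Gamma=\Gamma^\top\in\mathbb R^{n\times n}$ positive definite, and $\phi(x)=\frac1{2c}x^\top\Gamma x$. Let $\mathfrak H=L^2(\mathbb R^n;e^{\phi})$ and let $\mathfrak V$ be the space of all $z\in\mathfrak H$ with $e^{\phi}z\in W^{1,2}(\mathbb R^n;e^{-\phi})$, with norm $\|z\|_{\mathfrak V}^2=\|z\|_{\mathfrak H}^2+\mathfrak a(z,z)$, where $\mathfrak a(z_1,z_2)=\int_{\mathbb R^n}e^{-\phi}\,\nabla(e^\phi z_1)\cdot\nabla(e^\phi z_2)\,dx$. Let $\mathfrak A$ be the operator in $\mathfrak H$ associated with $\mathfrak a$: $y=\mathfrak Av$ iff $v\in\mathfrak V$ and $\mathfrak a(v,w)=\langle y,w\rangle_{\mathfrak H}$ for all $w\in\mathfrak V$. Let $(T(t))_{t\ge0}$ be the $C_0$-semigroup on $\mathfrak H$ generated by $-c\mathfrak A$, let $\mathfrak H_{-1}$ be the completion of $\mathfrak H$ with respect to $x\mapsto\|(I+c\mathfrak A)^{-1}x\|_{\mathfrak H}$, and $T_{-1}(t)$ the continuous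 extension of $T(t)$ to $\mathfrak H_{-1}$. Let $\mathfrak H_{-\frac12}\hookrightarrow\mathfrak H_{-1}$ be the dual of $\mathfrak V$ with respect to the pivot space $\mathfrak H$, and let $\mathfrak B_1:\mathfrak H^n\to\mathfrak H_{-\frac12}$, $\mathfrak B_1w=-\operatorname{div}w$, that is $\langle\mathfrak B_1w,z\rangle=\int_{\mathbb R^n}w\cdot\nabla(e^\phi z)\,dx$ for $z\in\mathfrak V$. Let $p_0\in\mathfrak H$, let $y_{\rm ref}\in W^{1,\infty}(\mathbb R_{\ge0};\mathbb R^n)$ (continuous representative), and put $u(t)=\dot y_{\rm ref}(t)+\Gamma y_{\rm ref}(t)$. A function $p:\mathbb R_{\ge0}\to\mathfrak H$ is called a mild solution on $[0,t_1]$ if $p|_{[0,t_1]}\in C([0,t_1];\mathfrak H)$ and $$p(t)=T(t)p_0+\int_0^tT_{-1}(t-s)\,\mathfrak B_1\big(p(s)u(s)\big)\,ds,\qquad t\in[0,t_1],$$ and a mild solution on $\mathbb R_{\ge0}$ if this holds for all $t_1>0$. Put $P_0=\int_{\mathbb R^n}p_0(x)\,dx$, $y(t)=\int_{\mathbb R^n}x\,p(t,x)\,dx$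 and $\mathrm{Cov}(t)=\int_{\mathbb R^n}(x-y(t))(x-y(t))^\top p(t,x)\,dx$. Then there exists a unique mild solution $p$ on $\mathbb R_{\ge0}$, and it has the following properties. 1. $p\in L^q(0,t_1;\mathfrak V)\cap W^{1,q}(0,t_1;\mathfrak H_{-\frac12})$ for all $t_1>0$ and $1\le q<2$, and $p\in L^\infty(0,\infty;\mathfrak H)$. 2. For all $t\ge0$, $y(t)=P_0y_{\rm ref}(t)+e^{-\Gamma t}\big(y(0)-P_0y_{\rm ref}(0)\big)$. 3. For almost all $t>0$ one has $p(t)\in\mathfrak V$ and, for all $v\in\mathfrak V$, $\langle\dot p(t),v\rangle=-c\,\mathfrak a(p(t),v)+\langle\mathfrak B_1(p(t)u(t)),v\rangle$, with the duality pairing of $\mathfrak H_{-\frac12}$ and $\mathfrak V$. 4. If $p_0\in\mathfrak V$, then $p\in L^q(0,t_1;\mathfrak V)\cap W^{1,q}(0,t_1;\mathfrak H_{-\frac12})$ for all $t_1>0$ and $1\le q<\infty$. 5. $\int_{\mathbb R^n}p(t,x)\,dx=P_0$ for all $t\ge0$. 6. If $p_0\ge0$ almost everywhere, then, for all $t\ge0$,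 $p(t,x)\ge0$ for almost all $x$. 7. If $P_0=1$, then for every orthogonal $V\in\mathbb R^{n\times n}$ and $\Lambda=\operatorname{diag}(\lambda_1,\dots,\lambda_n)$ with $\Gamma V=cV\Lambda$, with $R=\operatorname{diag}(\sqrt{\lambda_1/2},\dots,\sqrt{\lambda_n/2})$, there is $K\in\mathbb R^{n\times n}$ such that $\mathrm{Cov}(t)=\frac14VR^{-1}\big(e^{-c\Lambda t}Ke^{-c\Lambda t}+2I\big)R^{-1}V^\top$ for all $t\ge0$. Moreover $\lim_{t\to\infty}\mathrm{Cov}(t)=c\,\Gamma^{-1}$. -/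

import Mathlib

open MeasureTheory Set Filter Topology
open scoped ENNReal ContDiff RealInnerProductSpace

noncomputable section

namespace FokkerPlanck

/-! ### Weak derivatives of functions of one real variable with values in a Banach space -/

section Time

variable {X : Type*} [NormedAddCommGroup X] [NormedSpace ℝ X]

/-- `f'` is the weak derivative of `f` on the open set `J ⊆ ℝ`: both are locally (Bochner)
integrable on `J` and `∫ θ' f = - ∫ θ f'` for every smooth `θ` with compact support in `J`. -/
def HasWeakDerivOn (f f' : ℝ → X) (J : Set ℝ) : Prop :=
  LocallyIntegrableOn f J ∧ LocallyIntegrableOn f' J ∧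
    ∀ θ : ℝ → ℝ, ContDiff ℝ ∞ θ → HasCompactSupport θ → tsupport θ ⊆ J →
      ∫ t in J, deriv θ t • f t = -∫ t in J, θ t • f' t

/-- `f ∈ W^{1,q}(J; X)`, with weak derivative `f'`. -/
def MemW1With (q : ℝ≥0∞) (f f' : ℝ → X) (J : Set ℝ) : Prop :=
  MemLp f q (volume.restrict J) ∧ MemLp f' q (volume.restrict J) ∧ HasWeakDerivOn f f' J

/-- `f ∈ W^{1,q}(J; X)`. -/
def MemW1 (q : ℝ≥0∞) (f : ℝ → X) (J : Set ℝ) : Prop :=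
  ∃ f' : ℝ → X, MemW1With q f f' J

end Time

/-! ### Unbounded operators: semigroups, resolvents, the extrapolation space `X₋₁` -/

section Semigroup

variable {X : Type*} [NormedAddCommGroup X] [NormedSpace ℝ X]

/-- `(T t)_{t ≥ 0}` is a `C₀`-semigroup on `X` whose generator is exactly the (unbounded)
operator `A`. Values of `T` at negative times carry no information. -/
structure IsSemigroupGeneratedBy (A : X →ₗ.[ℝ] X) (T : ℝ → X →L[ℝ] X) : Prop where
  zero : T 0 = ContinuousLinearMap.id ℝ X
  add : ∀ s t : ℝ, 0 ≤ s → 0 ≤ t → T (s + t) = (T s).comp (T t)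
  continuousOn : ∀ x : X, ContinuousOn (fun t => T t x) (Ici 0)
  generator : ∀ x y : X, (x, y) ∈ A.graph ↔
    Tendsto (fun h : ℝ => h⁻¹ • (T h x - x)) (𝓝[>] 0) (𝓝 y)

open scoped Classical in
/-- The `C₀`-semigroup generated by `A` (zero if `A` is not a generator). -/
def semigroup (A : X →ₗ.[ℝ] X) : ℝ → X →L[ℝ] X :=
  if h : ∃ T, IsSemigroupGeneratedBy A T then h.choose else 0

/-- `R = (β I - A)⁻¹` as a bounded operator on `X`. -/
def IsResolventAt (A : X →ₗ.[ℝ] X) (β : ℝ) (R : X →L[ℝ] X) : Prop :=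
  (∀ x : X, (R x, β • R x - x) ∈ A.graph) ∧ ∀ x y : X, (x, y) ∈ A.graph → R (β • x - y) = x

open scoped Classical in
/-- The resolvent `(β I - A)⁻¹` (zero if `β` is not in the resolvent set of `A`). -/
def resolventAt (A : X →ₗ.[ℝ] X) (β : ℝ) : X →L[ℝ] X :=
  if h : ∃ R, IsResolventAt A β R then h.choose else 0

/-- The vector space `X`, to be equipped with the norm `x ↦ ‖(β I - A)⁻¹ x‖`. -/
def PreExtrapolation (_A : X →ₗ.[ℝ] X) (_β : ℝ) : Type _ := X

instance (A : X →ₗ.[ℝ] X) (β : ℝ) : AddCommGroup (PreExtrapolation A β) :=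
  inferInstanceAs (AddCommGroup X)

instance (A : X →ₗ.[ℝ] X) (β : ℝ) : Module ℝ (PreExtrapolation A β) :=
  inferInstanceAs (Module ℝ X)

/-- The resolvent, as a linear map on `PreExtrapolation A β`. -/
def PreExtrapolation.toX (A : X →ₗ.[ℝ] X) (β : ℝ) : PreExtrapolation A β →ₗ[ℝ] X :=
  (resolventAt A β : X →ₗ[ℝ] X)

instance (A : X →ₗ.[ℝ] X) (β : ℝ) : SeminormedAddCommGroup (PreExtrapolation A β) :=
  SeminormedAddCommGroup.induced _ _ (PreExtrapolation.toX A β)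

instance (A : X →ₗ.[ℝ] X) (β : ℝ) : NormedSpace ℝ (PreExtrapolation A β) :=
  NormedSpace.induced ℝ _ _ (PreExtrapolation.toX A β)

/-- The extrapolation space `X₋₁` of `A`: the completion of `X` for the norm
`x ↦ ‖(β I - A)⁻¹ x‖`. -/
abbrev Extrapolation (A : X →ₗ.[ℝ] X) (β : ℝ) : Type _ :=
  UniformSpace.Completion (PreExtrapolation A β)

/-- The canonical map `X → X₋₁`. -/
def toExtrapolation (A : X →ₗ.[ℝ] X) (β : ℝ) (x : X) : Extrapolation A β :=
  ((show PreExtrapolation A β from x : PreExtrapolation A β) : Extrapolation A β)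

/-- `T₋₁(t)`: the continuous extension to `X₋₁` of the semigroup operator `T(t)` generated
by `A`. -/
def semigroupExt (A : X →ₗ.[ℝ] X) (β : ℝ) (t : ℝ) : Extrapolation A β → Extrapolation A β :=
  UniformSpace.Completion.map
    (fun x : PreExtrapolation A β => (show PreExtrapolation A β from semigroup A t (show X from x)))

end Semigroup

/-! ### The weighted spaces `𝔥`, `𝔙`, `𝔥_{-1/2}` -/

variable {n : ℕ}

/-- `Γ x` for `x ∈ ℝⁿ` (with the Euclidean norm). -/
def act (Γ : Matrix (Fin n) (Fin n) ℝ) (x : EuclideanSpace ℝ (Fin n)) :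
    EuclideanSpace ℝ (Fin n) :=
  Matrix.toEuclideanLin Γ x

/-- `φ(x) = (1 / (2c)) xᵀ Γ x`. -/
def phi (Γ : Matrix (Fin n) (Fin n) ℝ) (c : ℝ) (x : EuclideanSpace ℝ (Fin n)) : ℝ :=
  1 / (2 * c) * ⟪x, act Γ x⟫

/-- The measure `e^φ dx` on `ℝⁿ`. -/
def weight (Γ : Matrix (Fin n) (Fin n) ℝ) (c : ℝ) : Measure (EuclideanSpace ℝ (Fin n)) :=
  volume.withDensity fun x => ENNReal.ofReal (Real.exp (phi Γ c x))

/-- The state space `𝔥 = L²(ℝⁿ; e^φ)`. -/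
abbrev FrakH (Γ : Matrix (Fin n) (Fin n) ℝ) (c : ℝ) : Type :=
  Lp ℝ 2 (weight Γ c)

/-- The space `𝔥ⁿ`, realised as the `ℝⁿ`-valued `L²`-functions. -/
abbrev FrakHn (Γ : Matrix (Fin n) (Fin n) ℝ) (c : ℝ) : Type :=
  Lp (EuclideanSpace ℝ (Fin n)) 2 (weight Γ c)

/-- `G` is the weak gradient of `f` on `ℝⁿ`: both are locally integrable and
`∫ f ∂ᵢθ = - ∫ Gᵢ θ` for all test functions `θ ∈ C_c^∞(ℝⁿ)` and all `i`. -/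
def HasWeakGradient (f : EuclideanSpace ℝ (Fin n) → ℝ)
    (G : EuclideanSpace ℝ (Fin n) → EuclideanSpace ℝ (Fin n)) : Prop :=
  LocallyIntegrable f ∧ LocallyIntegrable G ∧
    ∀ θ : EuclideanSpace ℝ (Fin n) → ℝ, ContDiff ℝ ∞ θ → HasCompactSupport θ → ∀ i : Fin n,
      ∫ x, f x * fderiv ℝ θ x (EuclideanSpace.single i 1) = -∫ x, G x i * θ x

theorem HasWeakGradient.congr {f₁ f₂ : EuclideanSpace ℝ (Fin n) → ℝ}
    {G₁ G₂ : EuclideanSpace ℝ (Fin n) → EuclideanSpace ℝ (Fin n)}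
    (h : HasWeakGradient f₁ G₁) (hf : f₁ =ᵐ[volume] f₂) (hG : G₁ =ᵐ[volume] G₂) :
    HasWeakGradient f₂ G₂ := by
  obtain ⟨h1, h2, h3⟩ := h
  refine ⟨h1.congr hf, h2.congr hG, fun θ hθ hc i => ?_⟩
  have e1 : ∫ x, f₂ x * fderiv ℝ θ x (EuclideanSpace.single i 1)
      = ∫ x, f₁ x * fderiv ℝ θ x (EuclideanSpace.single i 1) :=
    integral_congr_ae (by filter_upwards [hf] with x hx; rw [hx])
  have e2 : ∫ x, G₂ x i * θ x = ∫ x, G₁ x i * θ x :=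
    integral_congr_ae (by filter_upwards [hG] with x hx; rw [hx])
  rw [e1, e2]
  exact h3 θ hθ hc i

theorem HasWeakGradient.zero :
    HasWeakGradient (fun _ : EuclideanSpace ℝ (Fin n) => (0 : ℝ)) (fun _ => 0) :=
  ⟨locallyIntegrable_zero, locallyIntegrable_zero, by simp⟩

theorem HasWeakGradient.smul {f : EuclideanSpace ℝ (Fin n) → ℝ}
    {G : EuclideanSpace ℝ (Fin n) → EuclideanSpace ℝ (Fin n)}
    (h : HasWeakGradient f G) (a : ℝ) :
    HasWeakGradient (fun x => a * f x) (fun x => a • G x) := by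
  obtain ⟨h1, h2, h3⟩ := h
  refine ⟨h1.smul a, h2.smul a, fun θ hθ hc i => ?_⟩
  have := h3 θ hθ hc i
  simp only [PiLp.smul_apply, smul_eq_mul, mul_assoc, integral_const_mul, this]
  ring

theorem HasWeakGradient.add {f₁ f₂ : EuclideanSpace ℝ (Fin n) → ℝ}
    {G₁ G₂ : EuclideanSpace ℝ (Fin n) → EuclideanSpace ℝ (Fin n)}
    (h : HasWeakGradient f₁ G₁) (h' : HasWeakGradient f₂ G₂) :
    HasWeakGradient (fun x => f₁ x + f₂ x) (fun x => G₁ x + G₂ x) := by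
  obtain ⟨h1, h2, h3⟩ := h
  obtain ⟨k1, k2, k3⟩ := h'
  refine ⟨h1.add k1, h2.add k2, fun θ hθ hc i => ?_⟩
  have cθ : Continuous θ := hθ.continuous
  have cdθ : Continuous (fun x => fderiv ℝ θ x (EuclideanSpace.single i 1)) :=
    (hθ.continuous_fderiv (by simp)).clm_apply continuous_const
  have sdθ : HasCompactSupport (fun x => fderiv ℝ θ x (EuclideanSpace.single i 1)) :=
    hc.fderiv_apply ℝ _
  have A : ∀ {f : EuclideanSpace ℝ (Fin n) → ℝ}, LocallyIntegrable f →
      Integrable (fun x => f x * fderiv ℝ θ x (EuclideanSpace.single i 1)) := fun hf => by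
    simpa [mul_comm] using hf.integrable_smul_left_of_hasCompactSupport cdθ sdθ
  have B : ∀ {G : EuclideanSpace ℝ (Fin n) → EuclideanSpace ℝ (Fin n)}, LocallyIntegrable G →
      Integrable (fun x => G x i * θ x) := fun hG => by
    have := hG.integrable_smul_left_of_hasCompactSupport cθ hc
    have h2 := (EuclideanSpace.proj (𝕜 := ℝ) i : EuclideanSpace ℝ (Fin n) →L[ℝ] ℝ).integrable_comp
      this
    simpa [mul_comm] using h2
  simp only [PiLp.add_apply, add_mul]
  rw [integral_add (A h1) (A k1), integral_add (B h2) (B k2), h3 θ hθ hc i, k3 θ hθ hc i]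
  ring

theorem ae_weight_iff {Γ : Matrix (Fin n) (Fin n) ℝ} {c : ℝ}
    {P : EuclideanSpace ℝ (Fin n) → Prop} (h : ∀ᵐ x ∂(weight Γ c), P x) : ∀ᵐ x, P x := by
  have hm : Measurable fun x => ENNReal.ofReal (Real.exp (phi Γ c x)) := by
    have : Continuous (phi Γ c) := by
      unfold phi act
      exact continuous_const.mul (continuous_id.inner
        (LinearMap.continuous_of_finiteDimensional (Matrix.toEuclideanLin Γ)))
    exact (ENNReal.continuous_ofReal.comp (Real.continuous_exp.comp this)).measurable
  rw [weight, ae_withDensity_iff hm] at h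
  filter_upwards [h] with x hx
  exact hx (by simpa using Real.exp_pos _)

/-- The form domain `𝔙 = {z ∈ 𝔥 : e^φ z ∈ W^{1,2}(ℝⁿ; e^{-φ})}`. An element is stored together
with its (unique) weighted gradient, as the pair `(z, e^{-φ} ∇(e^φ z)) ∈ 𝔥 × 𝔥ⁿ`. The norm
inherited from `𝔥 × 𝔥ⁿ` is
`‖z‖²_𝔙 = ‖z‖²_𝔥 + ‖e^{-φ} ∇(e^φ z)‖²_{𝔥ⁿ} = ‖e^φ z‖²_H + ‖∇(e^φ z)‖²_{Hⁿ}`,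
where `H = L²(ℝⁿ; e^{-φ})`. -/
def FrakV (Γ : Matrix (Fin n) (Fin n) ℝ) (c : ℝ) :
    Submodule ℝ (WithLp 2 (FrakH Γ c × FrakHn Γ c)) where
  carrier := {z | HasWeakGradient (fun x => Real.exp (phi Γ c x) * z.fst x)
    (fun x => Real.exp (phi Γ c x) • z.snd x)}
  add_mem' := by
    intro a b ha hb
    refine (ha.add hb).congr ?_ ?_
    · filter_upwards [ae_weight_iff (Lp.coeFn_add a.fst b.fst)] with x hx
      rw [WithLp.add_fst, hx, Pi.add_apply, mul_add]
    · filter_upwards [ae_weight_iff (Lp.coeFn_add a.snd b.snd)] with x hx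
      rw [WithLp.add_snd, hx, Pi.add_apply, smul_add]
  zero_mem' := by
    refine HasWeakGradient.zero.congr ?_ ?_
    · filter_upwards [ae_weight_iff (Lp.coeFn_zero ℝ 2 (weight Γ c))] with x hx
      rw [WithLp.zero_fst, hx, Pi.zero_apply, mul_zero]
    · filter_upwards [ae_weight_iff
        (Lp.coeFn_zero (EuclideanSpace ℝ (Fin n)) 2 (weight Γ c))] with x hx
      rw [WithLp.zero_snd, hx, Pi.zero_apply, smul_zero]
  smul_mem' := by
    intro r a ha
    refine (HasWeakGradient.smul ha r).congr ?_ ?_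
    · filter_upwards [ae_weight_iff (Lp.coeFn_smul r a.fst)] with x hx
      simp [hx]; ring
    · filter_upwards [ae_weight_iff (Lp.coeFn_smul r a.snd)] with x hx
      simp [hx, smul_comm r]

/-- The inclusion `𝔙 → 𝔥`. -/
def valV {Γ : Matrix (Fin n) (Fin n) ℝ} {c : ℝ} (z : FrakV Γ c) : FrakH Γ c :=
  (z : WithLp 2 (FrakH Γ c × FrakHn Γ c)).fst

/-- The weighted gradient `e^{-φ} ∇(e^φ z) ∈ 𝔥ⁿ` of `z ∈ 𝔙`. -/
def gradV {Γ : Matrix (Fin n) (Fin n) ℝ} {c : ℝ} (z : FrakV Γ c) : FrakHn Γ c :=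
  (z : WithLp 2 (FrakH Γ c × FrakHn Γ c)).snd

/-- The form `𝔞(z₁, z₂) = ⟨∇(e^φ z₁), ∇(e^φ z₂)⟩_{Hⁿ}
  = ⟨e^{-φ} ∇(e^φ z₁), e^{-φ} ∇(e^φ z₂)⟩_{𝔥ⁿ}`. -/
def form {Γ : Matrix (Fin n) (Fin n) ℝ} {c : ℝ} (z₁ z₂ : FrakV Γ c) : ℝ :=
  ⟪gradV z₁, gradV z₂⟫

/-- The graph of the operator `𝔄` associated with `𝔞`: `y = 𝔄 v` iff `v ∈ 𝔙` and
`𝔞(v, w) = ⟨y, w⟩_𝔥` for all `w ∈ 𝔙`. -/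
def opGraph (Γ : Matrix (Fin n) (Fin n) ℝ) (c : ℝ) : Submodule ℝ (FrakH Γ c × FrakH Γ c) where
  carrier := {vy | ∃ v : FrakV Γ c, valV v = vy.1 ∧ ∀ w : FrakV Γ c, form v w = ⟪vy.2, valV w⟫}
  add_mem' := by
    rintro _ _ ⟨v, hv, h⟩ ⟨v', hv', h'⟩
    refine ⟨v + v', ?_, fun w => ?_⟩
    · simp [← hv, ← hv', valV]
    · have := congrArg₂ (· + ·) (h w) (h' w)
      simpa [form, gradV, inner_add_left] using this
  zero_mem' := ⟨0, by simp [valV], fun w => by simp [form, gradV]⟩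
  smul_mem' := by
    rintro r _ ⟨v, hv, h⟩
    refine ⟨r • v, ?_, fun w => ?_⟩
    · simp [← hv, valV]
    · have := congrArg (r * ·) (h w)
      simpa [form, gradV, inner_smul_left] using this

/-- The operator `𝔄 : 𝒟(𝔄) ⊂ 𝔙 → 𝔥` associated with the form `𝔞`. -/
def frakA (Γ : Matrix (Fin n) (Fin n) ℝ) (c : ℝ) : FrakH Γ c →ₗ.[ℝ] FrakH Γ c :=
  (opGraph Γ c).toLinearPMap

/-- The Fokker-Planck operator `-c𝔄`. -/
def fpOp (Γ : Matrix (Fin n) (Fin n) ℝ) (c : ℝ) : FrakH Γ c →ₗ.[ℝ] FrakH Γ c :=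
  (-c) • frakA Γ c

/-- The space `𝔥₋₁` of the Fokker-Planck operator. As `-c𝔄 ≤ 0`, we take `β = 1` in its resolvent
set; other choices of `β` give the same space with an equivalent norm. -/
abbrev FrakHm1 (Γ : Matrix (Fin n) (Fin n) ℝ) (c : ℝ) : Type :=
  Extrapolation (fpOp Γ c) 1

/-- The space `𝔥_{-1/2}`: the dual of `𝔥_{1/2} = 𝔙` with respect to the pivot space `𝔥`. (The
norms of `𝔥_{1/2}` and `𝔙` are `‖z‖²_𝔥 + c 𝔞(z,z)` and `‖z‖²_𝔥 + 𝔞(z,z)`; they are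
equivalent.) -/
abbrev FrakHmHalf (Γ : Matrix (Fin n) (Fin n) ℝ) (c : ℝ) : Type :=
  StrongDual ℝ (FrakV Γ c)

/-- The embedding `𝔥 → 𝔥_{-1/2}`, `v ↦ ⟨v, ·⟩_𝔥`. -/
def toHmHalf {Γ : Matrix (Fin n) (Fin n) ℝ} {c : ℝ} (v : FrakH Γ c) : FrakHmHalf Γ c :=
  (innerSL ℝ v).comp ((WithLp.fstL 2 ℝ (FrakH Γ c) (FrakHn Γ c)).comp (FrakV Γ c).subtypeL)

/-- The control operator `𝔅₁ w = - div w` from `𝔥ⁿ` to `𝔥_{-1/2}`: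
`⟨𝔅₁ w, z⟩ = ∫ w · ∇(e^φ z) dx = ⟨w, e^{-φ} ∇(e^φ z)⟩_{𝔥ⁿ}` for `z ∈ 𝔙`. For `z = e^{-φ} θ` with a
test function `θ` this is the distributional divergence. -/
def B1Half {Γ : Matrix (Fin n) (Fin n) ℝ} {c : ℝ} (w : FrakHn Γ c) : FrakHmHalf Γ c :=
  (innerSL ℝ w).comp ((WithLp.sndL 2 ℝ (FrakH Γ c) (FrakHn Γ c)).comp (FrakV Γ c).subtypeL)

open scoped Classical in
/-- The canonical embedding `𝔥_{-1/2} → 𝔥₋₁`: the continuous linear map which is the identity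
on `𝔥`. -/
def halfToM1 (Γ : Matrix (Fin n) (Fin n) ℝ) (c : ℝ) : FrakHmHalf Γ c →L[ℝ] FrakHm1 Γ c :=
  if h : ∃ j : FrakHmHalf Γ c →L[ℝ] FrakHm1 Γ c,
      ∀ v : FrakH Γ c, j (toHmHalf v) = toExtrapolation (fpOp Γ c) 1 v
  then h.choose else 0

/-- The control operator `𝔅₁ : 𝔥ⁿ → 𝔥₋₁`, `w ↦ - div w`. -/
def B1 {Γ : Matrix (Fin n) (Fin n) ℝ} {c : ℝ} (w : FrakHn Γ c) : FrakHm1 Γ c :=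
  halfToM1 Γ c (B1Half w)

/-- `v · a ∈ 𝔥ⁿ`, that is `x ↦ v(x) a`, for `v ∈ 𝔥` and `a ∈ ℝⁿ`. -/
def mulVec {Γ : Matrix (Fin n) (Fin n) ℝ} {c : ℝ} (v : FrakH Γ c)
    (a : EuclideanSpace ℝ (Fin n)) : FrakHn Γ c :=
  (ContinuousLinearMap.toSpanSingleton ℝ a).compLp v

/-! ### Mild solutions -/

/-- `p ∈ C([0,t₁]; 𝔥)` is a mild solution on `[0,t₁]` of
`ṗ = -c𝔄 p + 𝔅₁(p · g(u)) + d`, `p(0) = p₀`, that is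
`p(t) = T(t) p₀ + ∫₀ᵗ T₋₁(t-s) (𝔅₁(p(s) · g(u(s))) + d(s)) ds` (an identity in `𝔥₋₁`, with a
Bochner integral). -/
def IsMildSolutionOn (Γ : Matrix (Fin n) (Fin n) ℝ) (c : ℝ)
    (g : EuclideanSpace ℝ (Fin n) → EuclideanSpace ℝ (Fin n)) (u : ℝ → EuclideanSpace ℝ (Fin n))
    (d : ℝ → FrakH Γ c) (p₀ : FrakH Γ c) (p : ℝ → FrakH Γ c) (t₁ : ℝ) : Prop :=
  ContinuousOn p (Icc 0 t₁) ∧ ∀ t ∈ Icc 0 t₁,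
    IntervalIntegrable (fun s => semigroupExt (fpOp Γ c) 1 (t - s)
      (B1 (mulVec (p s) (g (u s))) + toExtrapolation (fpOp Γ c) 1 (d s))) volume 0 t ∧
    toExtrapolation (fpOp Γ c) 1 (p t) =
      toExtrapolation (fpOp Γ c) 1 (semigroup (fpOp Γ c) t p₀) +
        ∫ s in (0 : ℝ)..t, semigroupExt (fpOp Γ c) 1 (t - s)
          (B1 (mulVec (p s) (g (u s))) + toExtrapolation (fpOp Γ c) 1 (d s))

/-- `p` is a mild solution on `ℝ_{≥0}`. -/
def IsMildSolution (Γ : Matrix (Fin n) (Fin n) ℝ) (c : ℝ)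
    (g : EuclideanSpace ℝ (Fin n) → EuclideanSpace ℝ (Fin n)) (u : ℝ → EuclideanSpace ℝ (Fin n))
    (d : ℝ → FrakH Γ c) (p₀ : FrakH Γ c) (p : ℝ → FrakH Γ c) : Prop :=
  ∀ t₁ : ℝ, 0 < t₁ → IsMildSolutionOn Γ c g u d p₀ p t₁

/-- `p ∈ L^q(0,t₁; 𝔙)` for a function `p` with values in `𝔥`. -/
def MemLqV {Γ : Matrix (Fin n) (Fin n) ℝ} {c : ℝ} (q : ℝ≥0∞) (p : ℝ → FrakH Γ c) (t₁ : ℝ) :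
    Prop :=
  ∃ P : ℝ → FrakV Γ c, MemLp P q (volume.restrict (Ioo 0 t₁)) ∧
    ∀ᵐ t ∂(volume.restrict (Ioo 0 t₁)), valV (P t) = p t

/-- `p ∈ L^q(0,t₁; 𝔙) ∩ W^{1,q}(0,t₁; 𝔥_{-1/2})`. -/
def MemRegularity {Γ : Matrix (Fin n) (Fin n) ℝ} {c : ℝ} (q : ℝ≥0∞) (p : ℝ → FrakH Γ c)
    (t₁ : ℝ) : Prop :=
  MemLqV q p t₁ ∧ MemW1 q (fun t => toHmHalf (p t)) (Ioo 0 t₁)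

/-- The equation in the weak sense on `(0,t₁)`: for almost all `t`, one has `p(t) ∈ 𝔙` and
`⟨ṗ(t), v⟩ = -c 𝔞(p(t), v) + ⟨𝔅₁(p(t) · g(u(t))) + d(t), v⟩` for all `v ∈ 𝔙`, where `ṗ` is the weak
derivative of `p` in `𝔥_{-1/2}` and the brackets are the duality between `𝔥_{-1/2}` and `𝔙`. -/
def SatisfiesWeakEquation {Γ : Matrix (Fin n) (Fin n) ℝ} {c : ℝ}
    (g : EuclideanSpace ℝ (Fin n) → EuclideanSpace ℝ (Fin n)) (u : ℝ → EuclideanSpace ℝ (Fin n))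
    (d : ℝ → FrakH Γ c) (p : ℝ → FrakH Γ c) (t₁ : ℝ) : Prop :=
  ∃ p' : ℝ → FrakHmHalf Γ c, HasWeakDerivOn (fun t => toHmHalf (p t)) p' (Ioo 0 t₁) ∧
    ∀ᵐ t ∂(volume.restrict (Ioo 0 t₁)), ∃ P : FrakV Γ c, valV P = p t ∧
      ∀ v : FrakV Γ c,
        p' t v = -c * form P v + (B1Half (mulVec (p t) (g (u t))) + toHmHalf (d t)) v

/-! ### Mass, mean and covariance -/

/-- `∫ p(x) dx`. -/
def mass {Γ : Matrix (Fin n) (Fin n) ℝ} {c : ℝ} (p : FrakH Γ c) : ℝ := ∫ x, p x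

/-- The mean value, with components `∫ xᵢ p(x) dx`. -/
def mean {Γ : Matrix (Fin n) (Fin n) ℝ} {c : ℝ} (p : FrakH Γ c) : EuclideanSpace ℝ (Fin n) :=
  WithLp.toLp 2 fun i => ∫ x, x i * p x

/-- The covariance matrix `∫ (x - y)(x - y)ᵀ p(x) dx`, with `y` the mean value. -/
def cov {Γ : Matrix (Fin n) (Fin n) ℝ} {c : ℝ} (p : FrakH Γ c) : Matrix (Fin n) (Fin n) ℝ :=
  Matrix.of fun i j => ∫ x, (x i - mean p i) * (x j - mean p j) * p x

end FokkerPlanck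

end

open FokkerPlanck

open MeasureTheory Set Filter Topology
open scoped ENNReal ContDiff RealInnerProductSpace

noncomputable section

namespace FokkerPlanck

/-! ### The translated Ornstein-Uhlenbeck flow on multi-index sequences -/

section

variable {n : ℕ}

/-! ### Multi-indices -/

/-! In scaled eigencoordinates of `Γ`, the products of Hermite polynomials times `e^{-φ}` form, once
normalised, an orthonormal basis of `𝔥`. In this basis `-c𝔄` is diagonal with entries `-wsum κ α`,
where the `κ i` are the eigenvalues of `Γ`, and `𝔅₁(v · a)` is a combination of creation operators:
its coordinate `α` involves only the coordinates `α - e_i` of `v`. The equation becomes a triangular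
system of scalar linear equations, so uniqueness is an induction on `|α|` (`isMildSolution_unique`).

Existence is by a formula. A spatially constant control only displaces the uncontrolled
Ornstein-Uhlenbeck evolution: the solution is that evolution translated by `m(t)`, where `m_i' + κ_i
m_i = √λ_i ⟨b_i, u⟩` and `m(0) = 0`. For the given feedforward control, `m_i = √λ_i ⟨b_i, y_ref(t) -
e^{-Γt} y_ref(0)⟩`, which is the source of the formula for the mean. In Hermite coordinates a
translation is a multi-index binomial transform; this gives `flow`, and `hasDerivAt_flow` shows that
it solves the system.

The difficulty is that translations are not bounded on `𝔥`. They become bounded after some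
Ornstein-Uhlenbeck time: `sum_sq_flow_le` controls the translated flow by the exponential of a sum
of terms of order `m_i² / t` for small `t`. Since `y_ref` and its derivative are bounded, `|m(t)| ≤
M min(t,1)` (`exists_isPath`), so the bound is uniform in time. Together with the commutation rule
`annih_flow`, and with half of the time spent on pure decay, it bounds the squared `𝔙`-norm by a
multiple of `1 + 1/t`. Hence integrability in time for every `q < 2`; from an initial value in `𝔙`
the `𝔙`-norm stays bounded.

Mass, mean and covariance are Hermite coordinates of degree zero, one and two, on which `flow` is
explicit. For positivity, `IsFlow.inner_ev` computes the Laplace transform of `p(t)`. It is that of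
the image of the product of `p₀ dx` and a Gaussian under an affine map, and Laplace transforms
determine finite measures (`measure_ext_of_laplace`). The same uniqueness also proves that the
Hermite system is complete. -/

theorem sum_ite_zero_else {ι : Type*} (s : Finset ι) (p : ι → Prop) [DecidablePred p]
    (f : ι → ℝ) : ∑ a ∈ s, (if p a then 0 else f a) = ∑ a ∈ s with ¬ p a, f a := by
  simp [Finset.sum_filter, ite_not]

/-- The multi-index `α - e_i` (truncated at zero). -/
def lower (α : Fin n → ℕ) (i : Fin n) : Fin n → ℕ := Function.update α i (α i - 1)

/-- The multi-index `α + e_i`. -/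
def raise (α : Fin n → ℕ) (i : Fin n) : Fin n → ℕ := Function.update α i (α i + 1)

@[simp] theorem lower_same (α : Fin n → ℕ) (i : Fin n) : lower α i i = α i - 1 := by simp [lower]

@[simp] theorem raise_same (α : Fin n → ℕ) (i : Fin n) : raise α i i = α i + 1 := by simp [raise]

theorem lower_of_ne (α : Fin n → ℕ) {i j : Fin n} (h : j ≠ i) : lower α i j = α j := by
  simp [lower, h]

theorem raise_of_ne (α : Fin n → ℕ) {i j : Fin n} (h : j ≠ i) : raise α i j = α j := by
  simp [raise, h]

@[simp] theorem lower_raise (α : Fin n → ℕ) (i : Fin n) : lower (raise α i) i = α := by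
  simp [lower, raise]

theorem raise_lower {α : Fin n → ℕ} {i : Fin n} (h : α i ≠ 0) : raise (lower α i) i = α := by
  have : α i - 1 + 1 = α i := Nat.sub_add_cancel (Nat.one_le_iff_ne_zero.2 h)
  simp [lower, raise, this]

theorem lower_le (α : Fin n → ℕ) (i : Fin n) : lower α i ≤ α := by
  intro j
  by_cases h : j = i
  · subst h; simp
  · simp [lower_of_ne α h]

theorem le_raise (α : Fin n → ℕ) (i : Fin n) : α ≤ raise α i := by
  intro j
  by_cases h : j = i
  · subst h; simp
  · simp [raise_of_ne α h]

theorem raise_injective (i : Fin n) : Function.Injective fun α : Fin n → ℕ => raise α i :=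
  fun α β h => by simpa using congrArg (fun γ => lower γ i) h

/-- `∑ i, κ i * α i`. -/
def wsum (κ : Fin n → ℝ) (α : Fin n → ℕ) : ℝ := ∑ i, κ i * α i

theorem wsum_nonneg {κ : Fin n → ℝ} (hκ : ∀ i, 0 ≤ κ i) (α : Fin n → ℕ) : 0 ≤ wsum κ α :=
  Finset.sum_nonneg fun i _ => mul_nonneg (hκ i) (Nat.cast_nonneg _)

theorem wsum_raise (κ : Fin n → ℝ) (α : Fin n → ℕ) (i : Fin n) :
    wsum κ (raise α i) = wsum κ α + κ i := by
  unfold wsum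
  rw [← Finset.add_sum_erase _ _ (Finset.mem_univ i),
    ← Finset.add_sum_erase Finset.univ (fun i => κ i * (α i : ℝ)) (Finset.mem_univ i),
    Finset.sum_congr rfl (g := fun i => κ i * (α i : ℝ))
      (fun j hj => by rw [raise_of_ne α (Finset.ne_of_mem_erase hj)])]
  simp; ring

/-- The square root of the multi-index factorial. -/
def sqf (α : Fin n → ℕ) : ℝ := ∏ i, Real.sqrt ((α i).factorial : ℝ)

theorem sqf_pos (α : Fin n → ℕ) : 0 < sqf α :=
  Finset.prod_pos fun i _ => Real.sqrt_pos.2 (by exact_mod_cast (α i).factorial_pos)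

theorem sqf_raise (α : Fin n → ℕ) (i : Fin n) :
    sqf (raise α i) = Real.sqrt (α i + 1) * sqf α := by
  unfold sqf
  rw [← Finset.mul_prod_erase _ _ (Finset.mem_univ i),
    ← Finset.mul_prod_erase Finset.univ (fun i => Real.sqrt ((α i).factorial : ℝ))
      (Finset.mem_univ i),
    Finset.prod_congr rfl (g := fun i => Real.sqrt ((α i).factorial : ℝ))
      (fun j hj => by rw [raise_of_ne α (Finset.ne_of_mem_erase hj)])]
  rw [raise_same, Nat.factorial_succ, Nat.cast_mul, Real.sqrt_mul (Nat.cast_nonneg _)]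
  push_cast; ring

theorem sqf_lower {α : Fin n → ℕ} {i : Fin n} (h : α i ≠ 0) :
    sqf α = Real.sqrt (α i) * sqf (lower α i) := by
  conv_lhs => rw [← raise_lower h, sqf_raise]
  have : ((lower α i i : ℕ) : ℝ) + 1 = α i := by
    rw [lower_same, ← Nat.cast_succ, Nat.succ_eq_add_one,
      Nat.sub_add_cancel (Nat.one_le_iff_ne_zero.2 h)]
  rw [this]

@[simp] theorem sqf_zero : sqf (0 : Fin n → ℕ) = 1 := by simp [sqf]

/-! ### The translated Ornstein-Uhlenbeck flow in Hermite coordinates -/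

/-- The multi-index binomial kernel `∏ i, (α_i choose β_i) m_i^(α_i - β_i)`. -/
def shiftKer (m : Fin n → ℝ) (α β : Fin n → ℕ) : ℝ :=
  ∏ i, ((α i).choose (β i) : ℝ) * m i ^ (α i - β i)

theorem shiftKer_eq_zero {m : Fin n → ℝ} {α β : Fin n → ℕ} (h : ¬ β ≤ α) :
    shiftKer m α β = 0 := by
  simp only [Pi.le_def, not_forall, not_le] at h
  obtain ⟨i, hi⟩ := h
  exact Finset.prod_eq_zero (Finset.mem_univ i) (by simp [Nat.choose_eq_zero_of_lt hi])

theorem shiftKer_zero_left (α β : Fin n → ℕ) :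
    shiftKer (0 : Fin n → ℝ) α β = if α = β then 1 else 0 := by
  split_ifs with h
  · subst h; simp [shiftKer]
  · obtain ⟨i, hi⟩ := Function.ne_iff.1 h
    refine Finset.prod_eq_zero (Finset.mem_univ i) ?_
    rcases lt_or_gt_of_ne hi with h1 | h1
    · simp [Nat.choose_eq_zero_of_lt h1]
    · simp [zero_pow (Nat.sub_ne_zero_of_lt h1)]

/-- Hermite moments after translation by `m`. -/
def shiftSeq (m : Fin n → ℝ) (M : (Fin n → ℕ) → ℝ) (α : Fin n → ℕ) : ℝ :=
  ∑ β ∈ Finset.Iic α, shiftKer m α β * M β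

theorem shiftSeq_eq_sum {m : Fin n → ℝ} {M : (Fin n → ℕ) → ℝ} {α : Fin n → ℕ}
    {s : Finset (Fin n → ℕ)} (h : Finset.Iic α ⊆ s) :
    shiftSeq m M α = ∑ β ∈ s, shiftKer m α β * M β := by
  refine Finset.sum_subset h fun β _ hβ => ?_
  rw [shiftKer_eq_zero (by simpa using hβ), zero_mul]

/-- Pascal's rule for the coefficients of `(X + x)^(a+1)`. Truncated exponents do no harm: the
binomial coefficient vanishes whenever the subtraction is truncated. -/
theorem choose_pow_succ (x : ℝ) (a b : ℕ) :
    ((a + 1).choose b : ℝ) * x ^ (a + 1 - b) =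
      (if b = 0 then 0 else (a.choose (b - 1) : ℝ) * x ^ (a - (b - 1))) +
        x * ((a.choose b : ℝ) * x ^ (a - b)) := by
  rcases b with _ | b
  · simp [pow_succ]; ring
  · simp only [Nat.add_sub_add_right, Nat.succ_ne_zero, if_false, Nat.add_sub_cancel]
    rw [Nat.choose_succ_succ]
    push_cast
    rcases lt_or_ge a (b + 1) with h | h
    · simp [Nat.choose_eq_zero_of_lt h]
    · have : a - b = a - (b + 1) + 1 := by omega
      rw [this, pow_succ]; ring

theorem shiftKer_raise (m : Fin n → ℝ) (α β : Fin n → ℕ) (i : Fin n) :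
    shiftKer m (raise α i) β =
      (if β i = 0 then 0 else shiftKer m α (lower β i)) + m i * shiftKer m α β := by
  have key : ∀ γ : Fin n → ℕ, (∀ j, j ≠ i → γ j = β j) → shiftKer m α γ =
      (((α i).choose (γ i) : ℝ) * m i ^ (α i - γ i)) *
        ∏ j ∈ Finset.univ.erase i, ((α j).choose (β j) : ℝ) * m j ^ (α j - β j) := by
    intro γ hγ
    rw [shiftKer, ← Finset.mul_prod_erase _ _ (Finset.mem_univ i)]
    congr 1
    exact Finset.prod_congr rfl fun j hj => by rw [hγ j (Finset.ne_of_mem_erase hj)]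
  rw [key (lower β i) (fun j hj => lower_of_ne β hj), key β (fun j _ => rfl), shiftKer,
    ← Finset.mul_prod_erase _ _ (Finset.mem_univ i), raise_same, choose_pow_succ, lower_same,
    Finset.prod_congr rfl (g := fun j => ((α j).choose (β j) : ℝ) * m j ^ (α j - β j))
      (fun j hj => by rw [raise_of_ne α (Finset.ne_of_mem_erase hj)])]
  split_ifs <;> ring

/-- A translation replaces the `i`-th variable by itself plus `m i`. On the kernel this is Pascal's
rule, whose first half is reindexed along `β ↦ β - e_i`, a bijection on the indices with `β i ≠ 0`.
-/
theorem shiftSeq_raise (m : Fin n → ℝ) (M : (Fin n → ℕ) → ℝ) (α : Fin n → ℕ) (i : Fin n) :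
    shiftSeq m M (raise α i) = shiftSeq m (fun β => M (raise β i)) α + m i * shiftSeq m M α := by
  rw [shiftSeq_eq_sum (m := m) (M := M) (α := α) (Finset.Iic_subset_Iic.2 (le_raise α i)), shiftSeq,
    Finset.mul_sum]
  simp only [shiftKer_raise, add_mul, Finset.sum_add_distrib, mul_assoc]
  congr 1
  simp only [ite_mul, zero_mul]
  rw [sum_ite_zero_else, shiftSeq]
  refine Finset.sum_nbij' (fun β => lower β i) (fun β => raise β i) ?_ ?_ ?_ ?_ ?_
  · intro β hβ
    simp only [Finset.mem_filter, Finset.mem_Iic] at hβ ⊢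
    intro j
    by_cases h : j = i
    · subst h
      have := hβ.1 j
      simp only [raise_same, lower_same] at this ⊢
      omega
    · simpa [lower_of_ne β h, raise_of_ne α h] using hβ.1 j
  · intro β hβ
    simp only [Finset.mem_filter, Finset.mem_Iic] at hβ ⊢
    refine ⟨fun j => ?_, by simp⟩
    by_cases h : j = i
    · subst h; simpa using hβ j
    · simpa [raise_of_ne _ h] using hβ j
  · intro β hβ
    simp only [Finset.mem_filter] at hβ
    exact raise_lower hβ.2
  · intro β _; simp
  · intro β hβ
    simp only [Finset.mem_filter] at hβ
    rw [raise_lower hβ.2]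

/-- Everything rests on `(a - b) C(a,b) = a C(a-1,b)`. It also turns the decay rate `k b` of the
exponential into `k a` plus a multiple of `C(a-1,b)`, so that `x` enters the lower-order term only
through `x' + k x`, the drive of the scalar equation for the mean. -/
theorem hasDerivAt_choose_pow {x : ℝ → ℝ} {x' s : ℝ} (hx : HasDerivAt x x' s) (k : ℝ) (a b : ℕ) :
    HasDerivAt (fun s => (a.choose b : ℝ) * x s ^ (a - b) * Real.exp (-s * (k * b)))
      (-(k * a) * ((a.choose b : ℝ) * x s ^ (a - b) * Real.exp (-s * (k * b))) +
        a * (x' + k * x s) *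
          (((a - 1).choose b : ℝ) * x s ^ (a - 1 - b) * Real.exp (-s * (k * b)))) s := by
  have h1 := ((hx.pow (a - b)).const_mul (a.choose b : ℝ)).mul
    (((hasDerivAt_id s).neg.mul_const (k * b)).exp)
  refine h1.congr_deriv ?_
  simp only [id, Pi.pow_apply, Pi.neg_apply]
  rcases a with _ | a
  · rcases b with _ | b <;> simp
  rcases lt_trichotomy b (a + 1) with h | h | h
  · have hb : b ≤ a := Nat.lt_succ_iff.1 h
    have e1 : a + 1 - b = a - b + 1 := by omega
    have e2 : ((a + 1).choose b : ℝ) * (a - b + 1 : ℕ) = (a + 1) * a.choose b := by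
      have := Nat.choose_mul_succ_eq a b
      rw [Nat.succ_sub hb] at this
      rw [mul_comm ((a : ℝ) + 1)]
      exact_mod_cast this.symm
    have e3 : ((a - b + 1 : ℕ) : ℝ) = a + 1 - b := by
      rw [Nat.cast_succ, Nat.cast_sub hb]; ring
    rw [e1]
    simp only [Nat.add_sub_cancel]
    rw [pow_succ]
    have e4 : (b : ℝ) * ((a + 1).choose b : ℝ) =
        (a + 1) * ((a + 1).choose b : ℝ) - (a + 1) * a.choose b := by
      rw [← e2, e3]; ring
    push_cast at e2 ⊢
    linear_combination (x' * x s ^ (a - b) * Real.exp (-s * (k * b))) * e2 -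
      (k * x s ^ (a - b) * x s * Real.exp (-s * (k * b))) * e4
  · subst h
    simp
    ring
  · have h2 : a < b := by omega
    simp [Nat.choose_eq_zero_of_lt h, Nat.choose_eq_zero_of_lt h2]

/-- Decay of the Hermite moments along the Ornstein-Uhlenbeck flow. -/
def decaySeq (κ : Fin n → ℝ) (t : ℝ) (M : (Fin n → ℕ) → ℝ) (β : Fin n → ℕ) : ℝ :=
  Real.exp (-t * wsum κ β) * M β

theorem shiftKer_mul_exp (m : Fin n → ℝ) (κ : Fin n → ℝ) (t : ℝ) (α β : Fin n → ℕ) :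
    shiftKer m α β * Real.exp (-t * wsum κ β) =
      ∏ i, ((α i).choose (β i) : ℝ) * m i ^ (α i - β i) * Real.exp (-t * (κ i * β i)) := by
  rw [shiftKer, wsum, Finset.mul_sum, Real.exp_sum, ← Finset.prod_mul_distrib]

/-- By the product rule over the coordinates: the rates of the single factors add up to `wsum κ α`,
and each drive term lowers exactly one index. -/
theorem hasDerivAt_shiftSeq {m : ℝ → Fin n → ℝ} {m' : Fin n → ℝ} {s : ℝ}
    (hm : ∀ i, HasDerivAt (fun s => m s i) (m' i) s) (κ : Fin n → ℝ) (M : (Fin n → ℕ) → ℝ)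
    (α : Fin n → ℕ) :
    HasDerivAt (fun s => shiftSeq (m s) (decaySeq κ s M) α)
      (-wsum κ α * shiftSeq (m s) (decaySeq κ s M) α +
        ∑ i, α i * (m' i + κ i * m s i) * shiftSeq (m s) (decaySeq κ s M) (lower α i)) s := by
  have hterm : ∀ β, HasDerivAt (fun s => shiftKer (m s) α β * Real.exp (-s * wsum κ β))
      (-wsum κ α * (shiftKer (m s) α β * Real.exp (-s * wsum κ β)) +
        ∑ i, α i * (m' i + κ i * m s i) *
          (shiftKer (m s) (lower α i) β * Real.exp (-s * wsum κ β))) s := by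
    intro β
    simp only [shiftKer_mul_exp]
    have := HasDerivAt.fun_finsetProd (u := Finset.univ)
      (fun i _ => hasDerivAt_choose_pow (hm i) (κ i) (α i) (β i))
    refine this.congr_deriv ?_
    simp only [smul_eq_mul, mul_add, Finset.sum_add_distrib]
    congr 1
    · rw [wsum, neg_mul, Finset.sum_mul, ← Finset.sum_neg_distrib]
      refine Finset.sum_congr rfl fun i _ => ?_
      rw [← Finset.mul_prod_erase _ _ (Finset.mem_univ i)]
      ring
    · refine Finset.sum_congr rfl fun i _ => ?_
      rw [← Finset.mul_prod_erase Finset.univ (fun j => (((lower α i j).choose (β j) : ℝ) *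
        m s j ^ (lower α i j - β j) * Real.exp (-s * (κ j * β j)))) (Finset.mem_univ i), lower_same,
        Finset.prod_congr rfl (g := fun j => ((α j).choose (β j) : ℝ) * m s j ^ (α j - β j) *
          Real.exp (-s * (κ j * β j)))
          (s₁ := Finset.univ.erase i)
          (f := fun j => (((lower α i j).choose (β j) : ℝ) *
        m s j ^ (lower α i j - β j) * Real.exp (-s * (κ j * β j))))
          (fun j hj => by rw [lower_of_ne α (Finset.ne_of_mem_erase hj)])]
      ring
  have hsum := HasDerivAt.fun_sum (u := Finset.Iic α) (fun β _ => (hterm β).mul_const (M β))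
  have e : ∀ s γ, γ ≤ α → shiftSeq (m s) (decaySeq κ s M) γ =
      ∑ β ∈ Finset.Iic α, shiftKer (m s) γ β * Real.exp (-s * wsum κ β) * M β := by
    intro s γ hγ
    rw [shiftSeq_eq_sum (Finset.Iic_subset_Iic.2 hγ)]
    exact Finset.sum_congr rfl fun β _ => by rw [decaySeq]; ring
  rw [e s α le_rfl]
  simp only [fun s => e s α le_rfl, fun i => e s (lower α i) (lower_le α i)]
  refine hsum.congr_deriv ?_
  simp only [add_mul, Finset.sum_add_distrib, Finset.sum_mul, Finset.mul_sum]
  congr 1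
  · exact Finset.sum_congr rfl fun β _ => by ring
  · rw [Finset.sum_comm]
    exact Finset.sum_congr rfl fun i _ => Finset.sum_congr rfl fun β _ => by ring

/-- The coordinates at time `t`, after a translation by `m`, of the solution with initial
coordinates `q`. -/
def flow (κ : Fin n → ℝ) (m : Fin n → ℝ) (t : ℝ) (q : (Fin n → ℕ) → ℝ) (α : Fin n → ℕ) : ℝ :=
  shiftSeq m (decaySeq κ t fun β => sqf β * q β) α / sqf α

/-- The annihilation operator in Hermite coordinates. -/
def annih (i : Fin n) (q : (Fin n → ℕ) → ℝ) (α : Fin n → ℕ) : ℝ :=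
  Real.sqrt (α i + 1) * q (raise α i)

theorem flow_eq_sum (κ : Fin n → ℝ) (m : Fin n → ℝ) (t : ℝ) (q : (Fin n → ℕ) → ℝ)
    (α : Fin n → ℕ) :
    flow κ m t q α = ∑ β ∈ Finset.Iic α,
      shiftKer m α β * Real.exp (-t * wsum κ β) * sqf β / sqf α * q β := by
  rw [flow, shiftSeq, Finset.sum_div]
  exact Finset.sum_congr rfl fun β _ => by rw [decaySeq]; ring

/-- Division by `sqf α` replaces the factor `α i` by `√(α i)`, the coefficient of a creation
operator. When `m' i + κ i * m i` is the `i`-th component of the control, this is the Fokker-Planck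
equation in coordinates. -/
theorem hasDerivAt_flow {m : ℝ → Fin n → ℝ} {m' : Fin n → ℝ} {s : ℝ}
    (hm : ∀ i, HasDerivAt (fun s => m s i) (m' i) s) (κ : Fin n → ℝ) (q : (Fin n → ℕ) → ℝ)
    (α : Fin n → ℕ) :
    HasDerivAt (fun s => flow κ (m s) s q α)
      (-wsum κ α * flow κ (m s) s q α +
        ∑ i, Real.sqrt (α i) * (m' i + κ i * m s i) * flow κ (m s) s q (lower α i)) s := by
  refine ((hasDerivAt_shiftSeq hm κ (fun β => sqf β * q β) α).div_const (sqf α)).congr_deriv ?_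
  rw [add_div, Finset.sum_div, mul_div_assoc]
  congr 1
  refine Finset.sum_congr rfl fun i _ => ?_
  by_cases h : α i = 0
  · simp [h]
  · rw [flow, sqf_lower h]
    have h1 := (sqf_pos (lower α i)).ne'
    have h2 : Real.sqrt (α i : ℝ) ≠ 0 :=
      (Real.sqrt_pos.2 (by exact_mod_cast Nat.pos_of_ne_zero h)).ne'
    have h3 : (α i : ℝ) = Real.sqrt (α i) * Real.sqrt (α i) :=
      (Real.mul_self_sqrt (Nat.cast_nonneg _)).symm
    field_simp
    rw [Real.sq_sqrt (Nat.cast_nonneg _)]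
    ring

/-- On the unnormalised coordinates `sqf β * q β` annihilation is a plain index shift, so this is
`shiftSeq_raise`. The factor `e^{-tκ_i}` is the rate lost when one index is raised. -/
theorem annih_flow (κ : Fin n → ℝ) (m : Fin n → ℝ) (t : ℝ) (q : (Fin n → ℕ) → ℝ)
    (α : Fin n → ℕ) (i : Fin n) :
    annih i (flow κ m t q) α =
      Real.exp (-t * κ i) * flow κ m t (annih i q) α + m i * flow κ m t q α := by
  have h0 : Real.sqrt ((α i : ℝ) + 1) ≠ 0 := (Real.sqrt_pos.2 (by positivity)).ne'
  have h1 := (sqf_pos α).ne'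
  have : (fun β => decaySeq κ t (fun β => sqf β * q β) (raise β i)) =
      fun β => Real.exp (-t * κ i) * decaySeq κ t (fun β => sqf β * annih i q β) β := by
    funext β
    rw [decaySeq, decaySeq, wsum_raise, sqf_raise, annih, mul_add, Real.exp_add]
    ring
  rw [annih, flow, shiftSeq_raise, sqf_raise, this, flow, flow]
  have e : shiftSeq m (fun β => Real.exp (-t * κ i) *
      decaySeq κ t (fun β => sqf β * annih i q β) β) α =
      Real.exp (-t * κ i) * shiftSeq m (decaySeq κ t (fun β => sqf β * annih i q β)) α := by
    rw [shiftSeq, shiftSeq, Finset.mul_sum]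
    exact Finset.sum_congr rfl fun β _ => by ring
  rw [e]
  field_simp

/-- The decay precedes the translation, so part of the time can be split off as pure decay. This
serves both the long-time bound and the smoothing estimate. -/
theorem flow_add (κ : Fin n → ℝ) (m : Fin n → ℝ) (s t : ℝ) (q : (Fin n → ℕ) → ℝ) :
    flow κ m (s + t) q = flow κ m s (decaySeq κ t q) := by
  funext α
  simp only [flow_eq_sum, decaySeq]
  refine Finset.sum_congr rfl fun β _ => ?_
  rw [show -(s + t) * wsum κ β = -s * wsum κ β + -t * wsum κ β by ring, Real.exp_add]
  ring

theorem flow_zero (κ : Fin n → ℝ) (q : (Fin n → ℕ) → ℝ) : flow κ 0 0 q = q := by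
  funext α
  rw [flow_eq_sum, Finset.sum_eq_single α]
  · simp [shiftKer_zero_left, (sqf_pos α).ne']
  · intro β _ h
    simp [shiftKer_zero_left, Ne.symm h]
  · simp

/-- An energy estimate. The endpoint depends on `m` and `t` only, so the translation may be reached
along any path; along the straight one the drive has size `|m i| / t`, and the dissipation absorbs
it at the price of a Grönwall factor. The box `Iic A` is closed under lowering, so the estimate
closes on finite sums and no convergence question arises. -/
theorem sum_sq_flow_le {κ : Fin n → ℝ} (hκ : ∀ i, 0 < κ i) (m : Fin n → ℝ) {t : ℝ} (ht : 0 < t)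
    (q : (Fin n → ℕ) → ℝ) (A : Fin n → ℕ) :
    ∑ α ∈ Finset.Iic A, flow κ m t q α ^ 2 ≤
      Real.exp (∑ i, (|m i| * (1 + κ i * t)) ^ 2 / (2 * κ i * t)) *
        ∑ α ∈ Finset.Iic A, q α ^ 2 := by
  set K : ℝ := ∑ i, (|m i| / t * (1 + κ i * t)) ^ 2 / (2 * κ i) with hK
  have hKt : ∑ i, (|m i| * (1 + κ i * t)) ^ 2 / (2 * κ i * t) = K * t := by
    rw [hK, Finset.sum_mul]
    refine Finset.sum_congr rfl fun i _ => ?_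
    have := (hκ i).ne'
    field_simp
  set mm : ℝ → Fin n → ℝ := fun s i => s * (m i / t) with hmm
  set X : ℝ → (Fin n → ℕ) → ℝ := fun s => flow κ (mm s) s q with hX
  set ũ : ℝ → Fin n → ℝ := fun s i => m i / t + κ i * mm s i with hũ
  set S : ℝ → ℝ := fun s => ∑ α ∈ Finset.Iic A, X s α ^ 2 with hS
  set S' : ℝ → ℝ := fun s => ∑ α ∈ Finset.Iic A, 2 * X s α * (-wsum κ α * X s α +
    ∑ i, Real.sqrt (α i) * ũ s i * X s (lower α i)) with hS'
  have hd : ∀ s, HasDerivAt S (S' s) s := by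
    intro s
    refine HasDerivAt.fun_sum fun α _ => ?_
    have h := hasDerivAt_flow (m := mm) (m' := fun i => m i / t) (s := s)
      (fun i => by simpa [hmm] using (hasDerivAt_id s).mul_const (m i / t)) κ q α
    refine (h.pow 2).congr_deriv ?_
    simp [hX, hũ]
  have hbound : ∀ s ∈ Icc (0 : ℝ) t, S' s ≤ K * S s := by
    intro s hs
    have hterm : ∀ α, 2 * X s α * (-wsum κ α * X s α +
        ∑ i, Real.sqrt (α i) * ũ s i * X s (lower α i)) ≤
        ∑ i, if α i = 0 then 0 else ũ s i ^ 2 / (2 * κ i) * X s (lower α i) ^ 2 := by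
      intro α
      have : 2 * X s α * (-wsum κ α * X s α + ∑ i, Real.sqrt (α i) * ũ s i * X s (lower α i)) =
          ∑ i, (-(2 * κ i * α i) * X s α ^ 2 +
            2 * X s α * (Real.sqrt (α i) * ũ s i * X s (lower α i))) := by
        rw [Finset.sum_add_distrib, ← Finset.mul_sum, ← Finset.sum_mul, Finset.sum_neg_distrib,
          wsum]
        simp only [mul_assoc, ← Finset.mul_sum]
        ring
      rw [this]
      refine Finset.sum_le_sum fun i _ => ?_
      split_ifs with h
      · simp [h]
      · have hk := hκ i
        have h3 := Real.mul_self_sqrt (Nat.cast_nonneg (α := ℝ) (α i))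
        set r := Real.sqrt (α i : ℝ)
        rw [← h3]
        -- Young's inequality as a completed square: the dissipation `2 κ_i α_i X_α²` takes up the
        -- factor `√α_i` of the drive, so what is left has a coefficient independent of `α`.
        have : ũ s i ^ 2 / (2 * κ i) * X s (lower α i) ^ 2 -
          (-(2 * κ i * (r * r)) * X s α ^ 2 + 2 * X s α * (r * ũ s i * X s (lower α i))) =
          (ũ s i * X s (lower α i) - 2 * κ i * (r * X s α)) ^ 2 / (2 * κ i) := by
          field_simp; ring
        have h5 : 0 ≤ (ũ s i * X s (lower α i) - 2 * κ i * (r * X s α)) ^ 2 / (2 * κ i) := by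
          positivity
        linarith
    refine (Finset.sum_le_sum fun α _ => hterm α).trans ?_
    rw [Finset.sum_comm, hK, Finset.sum_mul]
    refine Finset.sum_le_sum fun i _ => ?_
    have hk := hκ i
    have hcoef : ũ s i ^ 2 / (2 * κ i) ≤ (|m i| / t * (1 + κ i * t)) ^ 2 / (2 * κ i) := by
      refine div_le_div_of_nonneg_right ?_ (by positivity)
      have : ũ s i = m i / t * (1 + κ i * s) := by simp only [hũ, hmm]; ring
      rw [this, mul_pow, mul_pow, div_pow, div_pow, sq_abs]
      have : 0 ≤ κ i * s := mul_nonneg hk.le hs.1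
      have : κ i * s ≤ κ i * t := mul_le_mul_of_nonneg_left hs.2 hk.le
      gcongr
    -- Lowering is injective on the indices with `α i ≠ 0` and maps the box into itself.
    have hsub : ∑ α ∈ Finset.Iic A, (if α i = 0 then 0 else X s (lower α i) ^ 2) ≤ S s := by
      simp only [hS]
      rw [sum_ite_zero_else]
      rw [← Finset.sum_image (s := Finset.filter (fun α => ¬ α i = 0) (Finset.Iic A))
        (g := fun α => lower α i) (f := fun β => X s β ^ 2)]
      · refine Finset.sum_le_sum_of_subset_of_nonneg ?_ fun _ _ _ => sq_nonneg _
        intro β hβ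
        obtain ⟨α, hα, rfl⟩ := Finset.mem_image.1 hβ
        simp only [Finset.mem_filter, Finset.mem_Iic] at hα ⊢
        exact (lower_le α i).trans hα.1
      · intro α hα β hβ h
        simp only [Finset.coe_filter, mem_ofPred_eq] at hα hβ
        have := congrArg (fun γ => raise γ i) h
        simpa [raise_lower hα.2, raise_lower hβ.2] using this
    calc ∑ α ∈ Finset.Iic A, (if α i = 0 then 0 else ũ s i ^ 2 / (2 * κ i) * X s (lower α i) ^ 2)
        = ũ s i ^ 2 / (2 * κ i) *
          ∑ α ∈ Finset.Iic A, (if α i = 0 then 0 else X s (lower α i) ^ 2) := by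
          rw [Finset.mul_sum]
          exact Finset.sum_congr rfl fun α _ => by split_ifs <;> simp
      _ ≤ _ := mul_le_mul hcoef hsub (Finset.sum_nonneg fun α _ => by split_ifs <;> positivity)
          (by positivity)
  have hanti : AntitoneOn (fun s => Real.exp (-(K * s)) * S s) (Icc 0 t) := by
    have hd2 : ∀ s, HasDerivAt (fun s => Real.exp (-(K * s)) * S s)
        (Real.exp (-(K * s)) * (S' s - K * S s)) s := by
      intro s
      have h1 : HasDerivAt (fun s => Real.exp (-(K * s))) (Real.exp (-(K * s)) * -K) s := by
        simpa using ((hasDerivAt_id s).const_mul K).neg.exp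
      exact (h1.mul (hd s)).congr_deriv (by ring)
    refine antitoneOn_of_deriv_nonpos (convex_Icc 0 t)
      (fun s _ => (hd2 s).continuousAt.continuousWithinAt)
      (fun s _ => (hd2 s).differentiableAt.differentiableWithinAt) ?_
    intro s hs
    rw [interior_Icc] at hs
    rw [(hd2 s).deriv]
    have := hbound s (Ioo_subset_Icc_self hs)
    exact mul_nonpos_of_nonneg_of_nonpos (Real.exp_pos _).le (by linarith)
  have h0t := hanti (left_mem_Icc.2 ht.le) (right_mem_Icc.2 ht.le) ht.le
  have hmt : mm t = m := by
    funext i; simp only [hmm]; field_simp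
  have hm0 : mm 0 = 0 := by funext i; simp [hmm]
  have hSt : S t = ∑ α ∈ Finset.Iic A, flow κ m t q α ^ 2 := by simp only [hS, hX, hmt]
  have hS0 : S 0 = ∑ α ∈ Finset.Iic A, q α ^ 2 := by simp only [hS, hX, hm0, flow_zero]
  rw [hKt, ← hSt, ← hS0]
  simp only [mul_zero, neg_zero, Real.exp_zero, one_mul] at h0t
  calc S t = Real.exp (K * t) * (Real.exp (-(K * t)) * S t) := by
        rw [← mul_assoc, ← Real.exp_add]; simp
    _ ≤ _ := mul_le_mul_of_nonneg_left h0t (Real.exp_pos _).le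

end

/-! ### Hilbert bases, diagonal generators and their extrapolation spaces -/

section

/-! ### Coordinates and diagonal operators in a Hilbert space -/

section Coordinates

variable {ι X : Type*} [NormedAddCommGroup X] [InnerProductSpace ℝ X] (b : HilbertBasis ι ℝ X)

theorem hilbert_ext {x y : X} (h : ∀ α, ⟪b α, x⟫ = ⟪b α, y⟫) : x = y :=
  b.repr.injective (lp.ext (funext fun α => by simpa [b.repr_apply_apply] using h α))

theorem hasSum_sq_coord (x : X) : HasSum (fun α => ⟪b α, x⟫ ^ 2) (‖x‖ ^ 2) := by
  have := b.hasSum_inner_mul_inner x x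
  rw [real_inner_self_eq_norm_sq] at this
  refine this.congr_fun fun α => ?_
  rw [real_inner_comm x (b α), sq]

theorem sum_sq_coord_le (x : X) (s : Finset ι) : ∑ α ∈ s, ⟪b α, x⟫ ^ 2 ≤ ‖x‖ ^ 2 :=
  sum_le_hasSum s (fun _ _ => sq_nonneg _) (hasSum_sq_coord b x)

theorem norm_le_of_coord_le {x y : X} {C : ℝ} (hC : 0 ≤ C)
    (h : ∀ α, |⟪b α, x⟫| ≤ C * |⟪b α, y⟫|) : ‖x‖ ≤ C * ‖y‖ := by
  refine le_of_sq_le_sq ?_ (by positivity)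
  rw [mul_pow]
  refine hasSum_le (fun α => ?_) (hasSum_sq_coord b x) ((hasSum_sq_coord b y).mul_left (C ^ 2))
  rw [← mul_pow, ← sq_abs, ← sq_abs (C * _), abs_mul, abs_of_nonneg hC]
  exact pow_le_pow_left₀ (abs_nonneg _) (h α) 2

theorem exists_of_summable_sq {q : ι → ℝ} (hq : Summable fun α => q α ^ 2) :
    ∃ x : X, ∀ α, ⟪b α, x⟫ = q α := by
  have : Memℓp q 2 := by
    refine memℓp_gen ?_
    simpa using hq
  refine ⟨b.repr.symm ⟨q, this⟩, fun α => ?_⟩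
  rw [← b.repr_apply_apply, LinearIsometryEquiv.apply_symm_apply]

theorem inner_basis [DecidableEq ι] (α β : ι) : ⟪b α, b β⟫ = if α = β then 1 else 0 :=
  orthonormal_iff_ite.1 b.orthonormal α β

theorem exists_diagonal {d : ι → ℝ} {C : ℝ} (hd : ∀ α, |d α| ≤ C) :
    ∃ D : X →L[ℝ] X, ∀ α x, ⟪b α, D x⟫ = d α * ⟪b α, x⟫ := by
  have hex : ∀ x : X, ∃ y : X, ∀ α, ⟪b α, y⟫ = d α * ⟪b α, x⟫ := fun x => by
    refine exists_of_summable_sq b ?_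
    refine Summable.of_nonneg_of_le (fun _ => sq_nonneg _) (fun α => ?_)
      ((hasSum_sq_coord b x).summable.mul_left (C ^ 2))
    rw [mul_pow]
    refine mul_le_mul_of_nonneg_right ?_ (sq_nonneg _)
    rw [← sq_abs]
    exact pow_le_pow_left₀ (abs_nonneg _) (hd α) 2
  choose D hD using hex
  refine ⟨LinearMap.mkContinuous ⟨⟨D, fun x y => ?_⟩, fun r x => ?_⟩ |C| fun x => ?_,
    fun α x => hD x α⟩
  · exact hilbert_ext b fun α => by simp only [inner_add_right, hD, mul_add]
  · exact hilbert_ext b fun α => by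
      simp only [inner_smul_right, hD, RingHom.id_apply]; ring
  · refine norm_le_of_coord_le b (abs_nonneg _) fun α => ?_
    change |⟪b α, D x⟫| ≤ _
    rw [hD, abs_mul]
    exact mul_le_mul_of_nonneg_right ((hd α).trans (le_abs_self C)) (abs_nonneg _)

theorem clm_ext_basis {Y : Type*} [NormedAddCommGroup Y] [NormedSpace ℝ Y]
    {D D' : X →L[ℝ] Y} (h : ∀ α, D (b α) = D' (b α)) : D = D' := by
  refine ContinuousLinearMap.ext_on (s := Set.range b) ?_ ?_
  · have := b.dense_span
    rw [← Submodule.dense_iff_topologicalClosure_eq_top] at this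
    exact this
  · rintro _ ⟨α, rfl⟩
    exact h α

/-- Dominated convergence for the Parseval series of `w k`, with dominating series `C² ⟪b α, y⟫²`.
-/
theorem tendsto_zero_of_coord {K : Type*} {l : Filter K} {d : K → ι → ℝ} {C : ℝ}
    (hd : ∀ᶠ k in l, ∀ α, |d k α| ≤ C) (h0 : ∀ α, Tendsto (fun k => d k α) l (𝓝 0)) (y : X)
    {w : K → X} (hw : ∀ᶠ k in l, ∀ α, ⟪b α, w k⟫ = d k α * ⟪b α, y⟫) : Tendsto w l (𝓝 0) := by
  have h1 : Tendsto (fun k => ∑' α, (d k α * ⟪b α, y⟫) ^ 2) l (𝓝 (∑' α : ι, (0 : ℝ))) := by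
    refine tendsto_tsum_of_dominated_convergence (bound := fun α => C ^ 2 * ⟪b α, y⟫ ^ 2)
      ((hasSum_sq_coord b y).summable.mul_left _) (fun α => ?_) ?_
    · simpa using ((h0 α).mul_const ⟪b α, y⟫).pow 2
    · filter_upwards [hd] with k hk α
      rw [Real.norm_of_nonneg (sq_nonneg _), mul_pow]
      refine mul_le_mul_of_nonneg_right ?_ (sq_nonneg _)
      rw [← sq_abs]
      exact pow_le_pow_left₀ (abs_nonneg _) (hk α) 2
  rw [tsum_zero] at h1
  have h2 : Tendsto (fun k => ‖w k‖ ^ 2) l (𝓝 0) := by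
    refine h1.congr' ?_
    filter_upwards [hw] with k hk
    rw [← (hasSum_sq_coord b (w k)).tsum_eq]
    exact tsum_congr fun α => by rw [hk α]
  have h3 := h2.sqrt
  simp only [Real.sqrt_sq (norm_nonneg _), Real.sqrt_zero] at h3
  exact tendsto_zero_iff_norm_tendsto_zero.2 h3

/-- The function is the pointwise limit of its finite partial sums; countability of `ι` makes the
filter of finite sets countably generated. -/
theorem aestronglyMeasurable_of_coord [Countable ι] {Ω : Type*} [MeasurableSpace Ω]
    {μ : Measure Ω} {f : Ω → X} (h : ∀ α, AEStronglyMeasurable (fun v => ⟪b α, f v⟫) μ) :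
    AEStronglyMeasurable f μ := by
  refine aestronglyMeasurable_of_tendsto_ae (atTop : Filter (Finset ι))
    (f := fun s v => ∑ α ∈ s, ⟪b α, f v⟫ • b α) (fun s => ?_) (ae_of_all _ fun v => ?_)
  · exact Finset.aestronglyMeasurable_fun_sum s fun α _ => (h α).smul_const _
  · have := b.hasSum_repr (f v)
    simp only [b.repr_apply_apply] at this
    exact this

end Coordinates

/-! ### Diagonal operators: semigroup, resolvent, extrapolation space -/

section Diagonal

variable {ι X : Type*} [NormedAddCommGroup X] [InnerProductSpace ℝ X]
  {b : HilbertBasis ι ℝ X} {A : X →ₗ.[ℝ] X} {a : ι → ℝ}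

/-- `A` is the maximal diagonal operator with diagonal entries `a α` in the basis `b`. -/
def IsDiagonal (b : HilbertBasis ι ℝ X) (A : X →ₗ.[ℝ] X) (a : ι → ℝ) : Prop :=
  ∀ x y : X, (x, y) ∈ A.graph ↔ ∀ α, ⟪b α, y⟫ = a α * ⟪b α, x⟫

theorem IsDiagonal.basis_mem (hA : IsDiagonal b A a) (α : ι) : (b α, a α • b α) ∈ A.graph := by
  classical
  rw [hA]
  intro β
  rw [inner_smul_right, inner_basis]
  split_ifs with h
  · rw [h]
  · simp

theorem abs_exp_sub_one_div_sub_one_le {s : ℝ} (hs : s ≤ 0) :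
    |Real.exp s - 1 - s| ≤ |s| := by
  have h1 := Real.add_one_le_exp s
  have h2 : Real.exp s ≤ 1 := Real.exp_le_one_iff.2 hs
  rw [abs_of_nonneg (by linarith), abs_of_nonpos hs]
  linarith

theorem tendsto_exp_quotient (r : ℝ) :
    Tendsto (fun h : ℝ => h⁻¹ * (Real.exp (h * r) - 1)) (𝓝[>] 0) (𝓝 r) := by
  have h1 : HasDerivAt (fun h : ℝ => Real.exp (h * r)) r 0 := by
    simpa using ((hasDerivAt_id (0 : ℝ)).mul_const r).exp
  have h2 := (hasDerivAt_iff_tendsto_slope_zero.1 h1).mono_left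
    (nhdsWithin_mono (0 : ℝ) (show Ioi (0 : ℝ) ⊆ {0}ᶜ from fun x hx => ne_of_gt hx))
  simpa using h2

theorem IsDiagonal.exists_semigroup (hA : IsDiagonal b A a) (ha : ∀ α, a α ≤ 0) :
    ∃ T, IsSemigroupGeneratedBy A T := by
  -- The multipliers are bounded only for nonnegative times; `max t 0` gives a harmless operator at
  -- negative ones.
  have hle : ∀ t : ℝ, ∀ α, |Real.exp (max t 0 * a α)| ≤ 1 := fun t α => by
    rw [abs_of_pos (Real.exp_pos _)]
    exact Real.exp_le_one_iff.2 (mul_nonpos_of_nonneg_of_nonpos (le_max_right _ _) (ha α))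
  choose T hT using fun t => exists_diagonal b (hle t)
  have hT' : ∀ {t : ℝ}, 0 ≤ t → ∀ α x, ⟪b α, T t x⟫ = Real.exp (t * a α) * ⟪b α, x⟫ := by
    intro t ht α x
    rw [hT, max_eq_left ht]
  refine ⟨T, ?_, ?_, ?_, ?_⟩
  · ext x
    exact hilbert_ext b fun α => by simp [hT' le_rfl]
  · intro s t hs ht
    ext x
    refine hilbert_ext b fun α => ?_
    rw [ContinuousLinearMap.comp_apply, hT' (add_nonneg hs ht), hT' hs, hT' ht, add_mul,
      Real.exp_add, mul_assoc]
  · intro x t₀ _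
    refine ContinuousAt.continuousWithinAt ?_
    have : Tendsto (fun t => T t x - T t₀ x) (𝓝 t₀) (𝓝 0) := by
      refine tendsto_zero_of_coord b (C := 2)
        (d := fun t α => Real.exp (max t 0 * a α) - Real.exp (max t₀ 0 * a α))
        (Eventually.of_forall fun t α => ?_) (fun α => ?_) x
        (Eventually.of_forall fun t α => by rw [inner_sub_right, hT, hT, sub_mul])
      · exact (abs_sub _ _).trans (by linarith [hle t α, hle t₀ α])
      · have hc : Continuous fun t : ℝ => Real.exp (max t 0 * a α) - Real.exp (max t₀ 0 * a α) := by
          fun_prop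
        simpa using hc.tendsto t₀
    have h2 := this.add_const (T t₀ x)
    simp only [sub_add_cancel, zero_add] at h2
    exact h2
  · intro x y
    rw [hA]
    constructor
    · intro h
      have : Tendsto (fun h : ℝ => h⁻¹ • (T h x - x) - y) (𝓝[>] 0) (𝓝 0) := by
        refine tendsto_zero_of_coord b (C := 1) (y := y)
          -- The error is written as a multiple of the coordinate of `y`, which is `a α` times that
          -- of `x`. Relative to `y` the multiplier is bounded by one uniformly in `α`, which is not
          -- true relative to `x`.
          (d := fun h α => if a α = 0 then 0 else (h⁻¹ * (Real.exp (h * a α) - 1) - a α) / a α)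
          ?_ ?_ ?_
        · filter_upwards [self_mem_nhdsWithin] with h hh α
          have hh' : 0 < h := hh
          split_ifs with h0
          · simp
          · have := abs_exp_sub_one_div_sub_one_le
              (mul_nonpos_of_nonneg_of_nonpos hh'.le (ha α))
            have e : (h⁻¹ * (Real.exp (h * a α) - 1) - a α) / a α =
              (Real.exp (h * a α) - 1 - h * a α) / (h * a α) := by field_simp
            rw [e, abs_div]
            exact div_le_one_of_le₀ this (abs_nonneg _)
        · intro α
          split_ifs with h0
          · exact tendsto_const_nhds
          · have := ((tendsto_exp_quotient (a α)).sub_const (a α)).div_const (a α)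
            simpa using this
        · filter_upwards [self_mem_nhdsWithin] with k hk α
          have hk' : 0 < k := hk
          rw [inner_sub_right, inner_smul_right, inner_sub_right, hT' hk'.le, h α]
          split_ifs with h0
          · simp [h0]
          · field_simp
      simpa using this.add_const y
    · intro h α
      have h1 : Tendsto (fun k : ℝ => ⟪b α, k⁻¹ • (T k x - x)⟫) (𝓝[>] 0) (𝓝 ⟪b α, y⟫) :=
        ((innerSL ℝ (b α)).continuous.tendsto y).comp h
      have h2 : Tendsto (fun k : ℝ => ⟪b α, k⁻¹ • (T k x - x)⟫) (𝓝[>] 0)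
          (𝓝 (a α * ⟪b α, x⟫)) := by
        refine ((tendsto_exp_quotient (a α)).mul_const ⟪b α, x⟫).congr' ?_
        filter_upwards [self_mem_nhdsWithin] with k hk
        have hk' : 0 < k := hk
        rw [inner_smul_right, inner_sub_right, hT' hk'.le]
        ring
      exact tendsto_nhds_unique h1 h2

/-- The function `s ↦ e^{-sr} T(s) x` is continuous with zero right derivative, hence constant. This
holds for every semigroup generated by `A`, in particular for the one picked by `semigroup`. -/
theorem IsSemigroupGeneratedBy.apply_eigenvector {T : ℝ → X →L[ℝ] X}
    (hT : IsSemigroupGeneratedBy A T) {x : X} {r : ℝ} (hx : (x, r • x) ∈ A.graph) {t : ℝ}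
    (ht : 0 ≤ t) : T t x = Real.exp (t * r) • x := by
  have hgen := (hT.generator x (r • x)).1 hx
  have hcont : ContinuousOn (fun s => Real.exp (-(s * r)) • T s x) (Icc 0 t) :=
    ContinuousOn.smul (by fun_prop) ((hT.continuousOn x).mono Icc_subset_Ici_self)
  have hder : ∀ s ∈ Ico (0 : ℝ) t,
      HasDerivWithinAt (fun s => Real.exp (-(s * r)) • T s x) 0 (Ici s) s := by
    intro s hs
    have h1 : HasDerivWithinAt (fun s => T s x) (r • T s x) (Ici s) s := by
      rw [hasDerivWithinAt_iff_tendsto_slope, Ici_sdiff_left]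
      have hshift : Tendsto (fun v : ℝ => v - s) (𝓝[>] s) (𝓝[>] 0) := by
        refine tendsto_nhdsWithin_iff.2 ⟨?_, ?_⟩
        · have : Tendsto (fun v : ℝ => v - s) (𝓝 s) (𝓝 (s - s)) := by
            exact (continuous_sub_right s).tendsto s
          rw [sub_self] at this
          exact this.mono_left nhdsWithin_le_nhds
        · filter_upwards [self_mem_nhdsWithin] with v hv
          exact mem_Ioi.2 (sub_pos.2 (mem_Ioi.1 hv))
      have h2 := ((T s).continuous.tendsto (r • x)).comp (hgen.comp hshift)
      rw [map_smul] at h2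
      refine h2.congr' ?_
      filter_upwards [self_mem_nhdsWithin] with v hv
      have hv' : 0 ≤ v - s := (sub_pos.2 (mem_Ioi.1 hv)).le
      have : T v x = T s (T (v - s) x) := by
        rw [← ContinuousLinearMap.comp_apply, ← hT.add s (v - s) hs.1 hv', add_sub_cancel]
      simp only [Function.comp, slope_def_module, map_smul, map_sub, this]
    have h3 : HasDerivWithinAt (fun s => Real.exp (-(s * r))) (Real.exp (-(s * r)) * -r)
        (Ici s) s := by
      have := ((hasDerivAt_id s).mul_const r).neg.exp
      simpa using this.hasDerivWithinAt
    refine (h3.smul h1).congr_deriv ?_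
    rw [smul_smul, ← add_smul]
    simp
  have := constant_of_has_deriv_right_zero hcont hder t ⟨ht, le_rfl⟩
  simp only [zero_mul, neg_zero, Real.exp_zero, one_smul, hT.zero,
    ContinuousLinearMap.id_apply] at this
  conv_rhs => rw [← this, smul_smul, ← Real.exp_add]
  simp

/-- `semigroup A` is a choice, so it cannot be unfolded to the diagonal construction. Its values on
the basis vectors are forced by `apply_eigenvector`, and density does the rest. -/
theorem IsDiagonal.inner_semigroup (hA : IsDiagonal b A a) (ha : ∀ α, a α ≤ 0) {t : ℝ}
    (ht : 0 ≤ t) (α : ι) (x : X) :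
    ⟪b α, semigroup A t x⟫ = Real.exp (t * a α) * ⟪b α, x⟫ := by
  classical
  have hex := hA.exists_semigroup ha
  have hT : IsSemigroupGeneratedBy A (semigroup A) := by
    rw [semigroup, dif_pos hex]; exact hex.choose_spec
  have : (innerSL ℝ (b α)).comp (semigroup A t) = Real.exp (t * a α) • innerSL ℝ (b α) := by
    refine clm_ext_basis b fun β => ?_
    simp only [ContinuousLinearMap.comp_apply, hT.apply_eigenvector (hA.basis_mem β) ht,
      innerSL_apply_apply, inner_smul_right, smul_apply, smul_eq_mul,
      inner_basis]
    split_ifs with h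
    · rw [h]
    · simp
  exact congrArg (fun D : X →L[ℝ] ℝ => D x) this

theorem IsDiagonal.inner_resolventAt (hA : IsDiagonal b A a) (ha : ∀ α, a α ≤ 0) {β : ℝ}
    (hβ : 0 < β) (α : ι) (x : X) : ⟪b α, resolventAt A β x⟫ = (β - a α)⁻¹ * ⟪b α, x⟫ := by
  have hpos : ∀ α, 0 < β - a α := fun α => by linarith [ha α]
  have hex : ∃ R, IsResolventAt A β R := by
    obtain ⟨R, hR⟩ := exists_diagonal b (d := fun α => (β - a α)⁻¹) (C := β⁻¹) fun α => by
      rw [abs_of_pos (inv_pos.2 (hpos α))]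
      exact inv_anti₀ hβ (by linarith [ha α])
    refine ⟨R, fun x => (hA _ _).2 fun α => ?_, fun x y hxy => hilbert_ext b fun α => ?_⟩
    · rw [inner_sub_right, inner_smul_right, hR]
      have := (hpos α).ne'
      field_simp; ring
    · rw [hR, inner_sub_right, inner_smul_right, (hA _ _).1 hxy α, ← sub_mul, ← mul_assoc,
        inv_mul_cancel₀ (hpos α).ne', one_mul]
  have hR : IsResolventAt A β (resolventAt A β) := by
    rw [resolventAt, dif_pos hex]; exact hex.choose_spec
  have := (hA _ _).1 (hR.1 x) α
  rw [inner_sub_right, inner_smul_right] at this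
  rw [eq_inv_mul_iff_mul_eq₀ (hpos α).ne']
  linarith

theorem denseRange_toExtrapolation (A : X →ₗ.[ℝ] X) (β : ℝ) :
    DenseRange (toExtrapolation A β) :=
  UniformSpace.Completion.denseRange_coe (α := PreExtrapolation A β)

theorem norm_toExtrapolation (A : X →ₗ.[ℝ] X) (β : ℝ) (x : X) :
    ‖toExtrapolation A β x‖ = ‖resolventAt A β x‖ :=
  UniformSpace.Completion.norm_coe (E := PreExtrapolation A β) x

/-- The extension of the resolvent to the extrapolation space, with values in `X`. -/
def resolventExt [CompleteSpace X] (A : X →ₗ.[ℝ] X) (β : ℝ) : Extrapolation A β →L[ℝ] X :=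
  ContinuousLinearMap.extend
    ((PreExtrapolation.toX A β).mkContinuous 1 fun x => by rw [one_mul]; exact le_rfl)
    (UniformSpace.Completion.toComplL (𝕜 := ℝ) (E := PreExtrapolation A β))

variable [CompleteSpace X]

theorem resolventExt_toExtrapolation (A : X →ₗ.[ℝ] X) (β : ℝ) (x : X) :
    resolventExt A β (toExtrapolation A β x) = resolventAt A β x := by
  refine ContinuousLinearMap.extend_eq
    ((PreExtrapolation.toX A β).mkContinuous 1 fun x => by rw [one_mul]; exact le_rfl)
    (e := UniformSpace.Completion.toComplL (𝕜 := ℝ) (E := PreExtrapolation A β)) ?_ ?_ x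
  · exact UniformSpace.Completion.denseRange_coe
  · exact UniformSpace.Completion.isUniformInducing_coe _

theorem norm_resolventExt (A : X →ₗ.[ℝ] X) (β : ℝ) (y : Extrapolation A β) :
    ‖resolventExt A β y‖ = ‖y‖ := by
  refine (denseRange_toExtrapolation A β).induction_on (p := fun y => ‖resolventExt A β y‖ = ‖y‖) y
    (isClosed_eq (by fun_prop) continuous_norm) fun x => ?_
  rw [resolventExt_toExtrapolation, norm_toExtrapolation]

theorem resolventExt_injective (A : X →ₗ.[ℝ] X) (β : ℝ) :
    Function.Injective (resolventExt A β) :=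
  (AddMonoidHomClass.isometry_of_norm (resolventExt A β) (norm_resolventExt A β)).injective

/-- An isometry from a complete space has closed range, and this range contains every basis vector,
because each is an eigenvector of the resolvent with nonzero eigenvalue. -/
theorem IsDiagonal.resolventExt_surjective (hA : IsDiagonal b A a) (ha : ∀ α, a α ≤ 0) {β : ℝ}
    (hβ : 0 < β) : Function.Surjective (resolventExt A β) := by
  classical
  have hiso := AddMonoidHomClass.isometry_of_norm (resolventExt A β) (norm_resolventExt A β)
  have hclosed : IsClosed (Set.range (resolventExt A β)) :=
    hiso.isClosedEmbedding.isClosed_range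
  have hsub : Submodule.span ℝ (Set.range b) ≤
      LinearMap.range (resolventExt A β : Extrapolation A β →ₗ[ℝ] X) := by
    rw [Submodule.span_le]
    rintro _ ⟨α, rfl⟩
    have hpos : 0 < β - a α := by linarith [ha α]
    refine ⟨toExtrapolation A β ((β - a α) • b α), ?_⟩
    change resolventExt A β _ = _
    rw [resolventExt_toExtrapolation]
    refine hilbert_ext b fun γ => ?_
    rw [hA.inner_resolventAt ha hβ, inner_smul_right, inner_basis]
    split_ifs with h
    · rw [h, mul_one, inv_mul_cancel₀ hpos.ne']
    · simp
  have hdense : Dense (Set.range (resolventExt A β)) := by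
    have := b.dense_span
    rw [← Submodule.dense_iff_topologicalClosure_eq_top] at this
    exact this.mono hsub
  intro x
  have := hdense.closure_eq
  rw [hclosed.closure_eq] at this
  change x ∈ Set.range (resolventExt A β)
  exact this.symm ▸ mem_univ x

/-- Resolvent and semigroup commute on `X`, since both are diagonal. This makes the semigroup
uniformly continuous for the extrapolation norm, so the completed map is a true extension and the
identity passes to the completion. -/
theorem IsDiagonal.resolventExt_semigroupExt (hA : IsDiagonal b A a) (ha : ∀ α, a α ≤ 0) {β : ℝ}
    (hβ : 0 < β) {t : ℝ} (ht : 0 ≤ t) (y : Extrapolation A β) :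
    resolventExt A β (semigroupExt A β t y) = semigroup A t (resolventExt A β y) := by
  have hcomm : ∀ x, resolventAt A β (semigroup A t x) = semigroup A t (resolventAt A β x) :=
    fun x => hilbert_ext b fun α => by
      rw [hA.inner_resolventAt ha hβ, hA.inner_semigroup ha ht, hA.inner_semigroup ha ht,
        hA.inner_resolventAt ha hβ]
      ring
  let S : PreExtrapolation A β →ₗ[ℝ] PreExtrapolation A β := (semigroup A t : X →ₗ[ℝ] X)
  have hS : ∀ x : PreExtrapolation A β, ‖S x‖ ≤ ‖semigroup A t‖ * ‖x‖ := by
    intro x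
    change ‖resolventAt A β (semigroup A t x)‖ ≤ ‖semigroup A t‖ * ‖resolventAt A β x‖
    have := (semigroup A t).le_opNorm (resolventAt A β (show X from x))
    rw [← hcomm] at this
    exact this
  have huc : UniformContinuous S := (S.mkContinuous _ hS).uniformContinuous
  have hcoe : ∀ x : X, semigroupExt A β t (toExtrapolation A β x) =
      toExtrapolation A β (semigroup A t x) := fun x =>
    UniformSpace.Completion.map_coe huc (show PreExtrapolation A β from x)
  have hcont : Continuous (semigroupExt A β t) := UniformSpace.Completion.continuous_map
  refine (denseRange_toExtrapolation A β).induction_on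
    (p := fun y => resolventExt A β (semigroupExt A β t y) = semigroup A t (resolventExt A β y)) y
    (isClosed_eq (by fun_prop) (by fun_prop)) fun x => ?_
  rw [hcoe, resolventExt_toExtrapolation, resolventExt_toExtrapolation, hcomm]

/-- The extrapolation space is isometric to `X` through the resolvent. -/
def IsDiagonal.extrapolationEquiv (hA : IsDiagonal b A a) (ha : ∀ α, a α ≤ 0) {β : ℝ}
    (hβ : 0 < β) : Extrapolation A β ≃L[ℝ] X :=
  (LinearIsometryEquiv.ofSurjective
    ⟨(resolventExt A β : Extrapolation A β →ₗ[ℝ] X), norm_resolventExt A β⟩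
    (hA.resolventExt_surjective ha hβ)).toContinuousLinearEquiv

end Diagonal

end

/-! ### The Gaussian weight and functions of exponential growth -/

section

variable {n : ℕ}

/-! ### Spectral data of the drift matrix and the Gaussian weight -/

/-- An orthonormal eigenbasis of `Γ` with positive eigenvalues `c * lam i`. -/
structure EigenData (Γ : Matrix (Fin n) (Fin n) ℝ) (c : ℝ) where
  /-- the eigenbasis -/
  b : OrthonormalBasis (Fin n) ℝ (EuclideanSpace ℝ (Fin n))
  /-- the eigenvalues, divided by `c` -/
  lam : Fin n → ℝ
  lam_pos : ∀ i, 0 < lam i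
  act_b : ∀ i, act Γ (b i) = (c * lam i) • b i
  c_pos : 0 < c

theorem exists_eigenData {Γ : Matrix (Fin n) (Fin n) ℝ} (hΓ : Γ.PosDef) {c : ℝ} (hc : 0 < c) :
    Nonempty (EigenData Γ c) := by
  refine ⟨⟨hΓ.isHermitian.eigenvectorBasis, fun i => hΓ.isHermitian.eigenvalues i / c,
    fun i => div_pos (hΓ.eigenvalues_pos i) hc, fun i => ?_, hc⟩⟩
  have := hΓ.isHermitian.mulVec_eigenvectorBasis i
  rw [mul_div_cancel₀ _ hc.ne']
  ext j
  have := congrFun this j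
  simpa [act, Matrix.toLpLin_apply] using this

variable {Γ : Matrix (Fin n) (Fin n) ℝ} {c : ℝ}

theorem EigenData.act_eq (D : EigenData Γ c) (x : EuclideanSpace ℝ (Fin n)) :
    act Γ x = ∑ i, (c * D.lam i * ⟪D.b i, x⟫) • D.b i := by
  conv_lhs => rw [← D.b.sum_repr' x]
  unfold act
  rw [map_sum]
  refine Finset.sum_congr rfl fun i _ => ?_
  rw [map_smul]
  have := D.act_b i
  unfold act at this
  rw [this, smul_smul, mul_comm]

theorem EigenData.inner_act (D : EigenData Γ c) (x : EuclideanSpace ℝ (Fin n)) (i : Fin n) :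
    ⟪D.b i, act Γ x⟫ = c * D.lam i * ⟪D.b i, x⟫ := by
  rw [D.act_eq, inner_sum, Finset.sum_eq_single i]
  · rw [inner_smul_right, real_inner_self_eq_norm_sq, D.b.orthonormal.1 i]; ring
  · intro j _ hj
    rw [inner_smul_right, D.b.orthonormal.2 (Ne.symm hj), mul_zero]
  · simp

theorem EigenData.phi_eq (D : EigenData Γ c) (x : EuclideanSpace ℝ (Fin n)) :
    phi Γ c x = 1 / 2 * ∑ i, D.lam i * ⟪D.b i, x⟫ ^ 2 := by
  have hc := D.c_pos.ne'
  rw [phi, D.act_eq, inner_sum, Finset.mul_sum, Finset.mul_sum]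
  refine Finset.sum_congr rfl fun i _ => ?_
  rw [inner_smul_right, real_inner_comm]
  field_simp

/-- The scaled eigencoordinates `√λ_i ⟨b_i, x⟩`. -/
def EigenData.y (D : EigenData Γ c) (i : Fin n) (x : EuclideanSpace ℝ (Fin n)) : ℝ :=
  Real.sqrt (D.lam i) * ⟪D.b i, x⟫

theorem EigenData.exists_phi_ge (D : EigenData Γ c) :
    ∃ δ : ℝ, 0 < δ ∧ ∀ x, δ * ‖x‖ ^ 2 ≤ phi Γ c x := by
  obtain ⟨δ, hδ, h⟩ : ∃ δ : ℝ, 0 < δ ∧ ∀ i, δ ≤ D.lam i := by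
    rcases isEmpty_or_nonempty (Fin n) with h | h
    · exact ⟨1, one_pos, fun i => h.elim i⟩
    · obtain ⟨i, hi⟩ := Finite.exists_min D.lam
      exact ⟨D.lam i, D.lam_pos i, hi⟩
  refine ⟨1 / 2 * δ, by positivity, fun x => ?_⟩
  rw [D.phi_eq, mul_assoc, ← D.b.sum_sq_inner_right x, Finset.mul_sum]
  gcongr with i
  exact h i

@[fun_prop]
theorem continuous_phi : Continuous (phi Γ c) := by
  unfold phi act
  exact continuous_const.mul (continuous_id.inner
    (LinearMap.continuous_of_finiteDimensional (Matrix.toEuclideanLin Γ)))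

theorem measurable_weightDensity :
    Measurable fun x => ENNReal.ofReal (Real.exp (phi Γ c x)) :=
  (ENNReal.continuous_ofReal.comp (Real.continuous_exp.comp continuous_phi)).measurable

theorem weight_absolutelyContinuous : weight Γ c ≪ volume := withDensity_absolutelyContinuous _ _

theorem integral_weight {F : Type*} [NormedAddCommGroup F] [NormedSpace ℝ F]
    (f : EuclideanSpace ℝ (Fin n) → F) :
    ∫ x, f x ∂(weight Γ c) = ∫ x, Real.exp (phi Γ c x) • f x := by
  rw [weight, integral_withDensity_eq_integral_toReal_smul measurable_weightDensity
    (ae_of_all _ fun x => ENNReal.ofReal_lt_top)]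
  simp only [ENNReal.toReal_ofReal (Real.exp_pos _).le]

theorem integrable_weight_iff {F : Type*} [NormedAddCommGroup F] [NormedSpace ℝ F]
    {f : EuclideanSpace ℝ (Fin n) → F} :
    Integrable f (weight Γ c) ↔ Integrable fun x => Real.exp (phi Γ c x) • f x := by
  rw [weight, integrable_withDensity_iff_integrable_smul' measurable_weightDensity
    (ae_of_all _ fun x => ENNReal.ofReal_lt_top)]
  simp only [ENNReal.toReal_ofReal (Real.exp_pos _).le]

/-! ### Functions of at most exponential growth -/

/-- Continuous functions of at most exponential growth. -/
def Growth (f : EuclideanSpace ℝ (Fin n) → ℝ) : Prop :=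
  Continuous f ∧ ∃ C a : ℝ, 0 ≤ C ∧ 0 ≤ a ∧ ∀ x, |f x| ≤ C * Real.exp (a * ‖x‖)

theorem Growth.const (r : ℝ) : Growth fun _ : EuclideanSpace ℝ (Fin n) => r :=
  ⟨continuous_const, |r|, 0, abs_nonneg _, le_rfl, fun x => by simp⟩

theorem Growth.inner (v : EuclideanSpace ℝ (Fin n)) : Growth fun x => ⟪v, x⟫ := by
  refine ⟨by fun_prop, ‖v‖, 1, norm_nonneg _, zero_le_one, fun x => ?_⟩
  refine (abs_real_inner_le_norm v x).trans ?_
  have := Real.add_one_le_exp (1 * ‖x‖)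
  gcongr
  linarith

theorem Growth.exp_inner (v : EuclideanSpace ℝ (Fin n)) : Growth fun x => Real.exp ⟪v, x⟫ := by
  refine ⟨by fun_prop, 1, ‖v‖, zero_le_one, norm_nonneg _, fun x => ?_⟩
  rw [abs_of_pos (Real.exp_pos _), one_mul]
  exact Real.exp_le_exp.2 (real_inner_le_norm v x)

theorem Growth.add {f g : EuclideanSpace ℝ (Fin n) → ℝ} (hf : Growth f) (hg : Growth g) :
    Growth fun x => f x + g x := by
  obtain ⟨cf, C, a, hC, ha, hf⟩ := hf
  obtain ⟨cg, C', a', hC', ha', hg⟩ := hg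
  refine ⟨cf.add cg, C + C', a + a', by positivity, by positivity, fun x => ?_⟩
  calc |f x + g x| ≤ C * Real.exp (a * ‖x‖) + C' * Real.exp (a' * ‖x‖) :=
        (abs_add_le _ _).trans (add_le_add (hf x) (hg x))
    _ ≤ C * Real.exp ((a + a') * ‖x‖) + C' * Real.exp ((a + a') * ‖x‖) := by
        gcongr <;> linarith
    _ = _ := by ring

theorem Growth.mul {f g : EuclideanSpace ℝ (Fin n) → ℝ} (hf : Growth f) (hg : Growth g) :
    Growth fun x => f x * g x := by
  obtain ⟨cf, C, a, hC, ha, hf⟩ := hf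
  obtain ⟨cg, C', a', hC', ha', hg⟩ := hg
  refine ⟨cf.mul cg, C * C', a + a', by positivity, by positivity, fun x => ?_⟩
  rw [abs_mul, add_mul, Real.exp_add]
  calc |f x| * |g x| ≤ (C * Real.exp (a * ‖x‖)) * (C' * Real.exp (a' * ‖x‖)) := by
        gcongr
        · exact hf x
        · exact hg x
    _ = _ := by ring

theorem Growth.const_mul {f : EuclideanSpace ℝ (Fin n) → ℝ} (hf : Growth f) (r : ℝ) :
    Growth fun x => r * f x := (Growth.const r).mul hf

theorem Growth.sub {f g : EuclideanSpace ℝ (Fin n) → ℝ} (hf : Growth f) (hg : Growth g) :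
    Growth fun x => f x - g x := by
  simpa [sub_eq_add_neg] using hf.add (hg.const_mul (-1))

theorem Growth.prod {ι : Type*} (s : Finset ι) {f : ι → EuclideanSpace ℝ (Fin n) → ℝ}
    (hf : ∀ i, Growth (f i)) : Growth fun x => ∏ i ∈ s, f i x := by
  classical
  induction s using Finset.induction_on with
  | empty => simpa using Growth.const 1
  | insert i s hi ih => simpa [Finset.prod_insert hi] using (hf i).mul ih

theorem Growth.aeval {f : EuclideanSpace ℝ (Fin n) → ℝ} (hf : Growth f) (p : Polynomial ℤ) :
    Growth fun x => Polynomial.aeval (f x) p := by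
  induction p using Polynomial.induction_on' with
  | add p q hp hq => simpa using hp.add hq
  | monomial k r =>
    have : Growth fun x => f x ^ k := by
      simpa using Growth.prod (Finset.range k) (f := fun _ => f) fun _ => hf
    simpa [Polynomial.aeval_monomial] using this.const_mul (r : ℝ)

theorem EigenData.growth_y (D : EigenData Γ c) (i : Fin n) : Growth (D.y i) :=
  (Growth.inner (D.b i)).const_mul _

theorem integrable_exp_neg_mul_norm_sq {δ : ℝ} (hδ : 0 < δ) :
    Integrable fun x : EuclideanSpace ℝ (Fin n) => Real.exp (-δ * ‖x‖ ^ 2) := by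
  have := (GaussianFourier.integrable_cexp_neg_mul_sq_norm_add (b := (δ : ℂ)) (by simpa using hδ) 0
    (0 : EuclideanSpace ℝ (Fin n))).norm
  refine this.congr (ae_of_all _ fun x => ?_)
  simp only [Complex.norm_exp]
  congr 1
  simp [← Complex.ofReal_pow]

/-- As `φ ≥ δ‖x‖²`, the integrand is dominated by a Gaussian after completing the square in `a r - δ
r² ≤ a²/(2δ) - (δ/2) r²`. -/
theorem EigenData.integrable_growth (D : EigenData Γ c) {f : EuclideanSpace ℝ (Fin n) → ℝ}
    (hf : Growth f) : Integrable fun x => f x * Real.exp (-phi Γ c x) := by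
  obtain ⟨cf, C, a, hC, ha, hf⟩ := hf
  obtain ⟨δ, hδ, hphi⟩ := D.exists_phi_ge
  refine Integrable.mono' ((integrable_exp_neg_mul_norm_sq (n := n) (half_pos hδ)).const_mul
    (C * Real.exp (a ^ 2 / (2 * δ)))) (by fun_prop) (ae_of_all _ fun x => ?_)
  rw [Real.norm_eq_abs, abs_mul, abs_of_pos (Real.exp_pos _)]
  calc |f x| * Real.exp (-phi Γ c x)
      ≤ (C * Real.exp (a * ‖x‖)) * Real.exp (-(δ * ‖x‖ ^ 2)) := by
        gcongr
        · exact hf x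
        · exact hphi x
    _ = C * Real.exp (a * ‖x‖ - δ * ‖x‖ ^ 2) := by
        rw [mul_assoc, ← Real.exp_add]; ring_nf
    _ ≤ C * Real.exp (a ^ 2 / (2 * δ) + -(δ / 2) * ‖x‖ ^ 2) := by
        gcongr
        have : a ^ 2 / (2 * δ) + -(δ / 2) * ‖x‖ ^ 2 - (a * ‖x‖ - δ * ‖x‖ ^ 2) =
          (a - δ * ‖x‖) ^ 2 / (2 * δ) := by field_simp; ring
        have h2 : 0 ≤ (a - δ * ‖x‖) ^ 2 / (2 * δ) := by positivity
        linarith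
    _ = _ := by rw [Real.exp_add]; ring

theorem EigenData.memLp_growth (D : EigenData Γ c) {f : EuclideanSpace ℝ (Fin n) → ℝ}
    (hf : Growth f) : MemLp (fun x => f x * Real.exp (-phi Γ c x)) 2 (weight Γ c) := by
  have hc : Continuous fun x => f x * Real.exp (-phi Γ c x) := by
    have := hf.1; fun_prop
  rw [memLp_two_iff_integrable_sq hc.aestronglyMeasurable, integrable_weight_iff]
  refine (D.integrable_growth (hf.mul hf)).congr (ae_of_all _ fun x => ?_)
  simp only [smul_eq_mul]
  rw [mul_pow, ← Real.exp_nat_mul, mul_left_comm, ← Real.exp_add]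
  ring_nf

/-- The element `e^{-φ} f` of `𝔥`, for `f` of at most exponential growth. -/
def EigenData.vec (D : EigenData Γ c) {f : EuclideanSpace ℝ (Fin n) → ℝ} (hf : Growth f) :
    FrakH Γ c := (D.memLp_growth hf).toLp

theorem EigenData.vec_ae (D : EigenData Γ c) {f : EuclideanSpace ℝ (Fin n) → ℝ} (hf : Growth f) :
    ∀ᵐ x, D.vec hf x = f x * Real.exp (-phi Γ c x) :=
  ae_weight_iff (D.memLp_growth hf).coeFn_toLp

theorem EigenData.integrable_growth_mul (D : EigenData Γ c)
    {f : EuclideanSpace ℝ (Fin n) → ℝ} (hf : Growth f) (z : FrakH Γ c) :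
    Integrable fun x => f x * z x := by
  have h1 : Integrable (fun x => ⟪D.vec hf x, z x⟫) (weight Γ c) := L2.integrable_inner _ _
  rw [integrable_weight_iff] at h1
  refine h1.congr ?_
  filter_upwards [D.vec_ae hf] with x hx
  simp only [hx, smul_eq_mul, RCLike.inner_apply, conj_trivial]
  rw [show Real.exp (phi Γ c x) * (z x * (f x * Real.exp (-phi Γ c x))) =
    (Real.exp (phi Γ c x) * Real.exp (-phi Γ c x)) * (f x * z x) by ring, ← Real.exp_add]
  simp

/-- The weight `e^φ` cancels the factor `e^{-φ}` in the vector. Thus mass, moments and Laplace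
transforms are inner products in `𝔥` with fixed elements. -/
theorem EigenData.inner_vec (D : EigenData Γ c)
    {f : EuclideanSpace ℝ (Fin n) → ℝ} (hf : Growth f) (z : FrakH Γ c) :
    ⟪D.vec hf, z⟫ = ∫ x, f x * z x := by
  rw [L2.inner_def, integral_weight]
  refine integral_congr_ae ?_
  filter_upwards [D.vec_ae hf] with x hx
  simp only [hx, smul_eq_mul, RCLike.inner_apply, conj_trivial]
  rw [show Real.exp (phi Γ c x) * (z x * (f x * Real.exp (-phi Γ c x))) =
    (Real.exp (phi Γ c x) * Real.exp (-phi Γ c x)) * (f x * z x) by ring, ← Real.exp_add]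
  simp

theorem EigenData.inner_vec_vec (D : EigenData Γ c)
    {f g : EuclideanSpace ℝ (Fin n) → ℝ} (hf : Growth f) (hg : Growth g) :
    ⟪D.vec hf, D.vec hg⟫ = ∫ x, f x * g x * Real.exp (-phi Γ c x) := by
  rw [D.inner_vec]
  refine integral_congr_ae ?_
  filter_upwards [D.vec_ae hg] with x hx
  rw [hx, mul_assoc]

theorem mulVec_ae (v : FrakH Γ c) (a : EuclideanSpace ℝ (Fin n)) :
    ∀ᵐ x ∂(weight Γ c), mulVec v a x = v x • a := by
  filter_upwards [(ContinuousLinearMap.toSpanSingleton ℝ a).coeFn_compLp v] with x hx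
  rw [mulVec, hx, ContinuousLinearMap.toSpanSingleton_apply]

theorem inner_mulVec_mulVec (v w : FrakH Γ c) (a a' : EuclideanSpace ℝ (Fin n)) :
    ⟪mulVec v a, mulVec w a'⟫ = ⟪v, w⟫ * ⟪a, a'⟫ := by
  rw [L2.inner_def, L2.inner_def, ← integral_mul_const]
  refine integral_congr_ae ?_
  filter_upwards [mulVec_ae v a, mulVec_ae w a'] with x h1 h2
  rw [h1, h2, inner_smul_left, inner_smul_right]
  simp; ring

/-- `mulVec` as a continuous bilinear map. -/
def mulVecL (Γ : Matrix (Fin n) (Fin n) ℝ) (c : ℝ) :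
    FrakH Γ c →L[ℝ] EuclideanSpace ℝ (Fin n) →L[ℝ] FrakHn Γ c :=
  LinearMap.mkContinuous₂ (LinearMap.mk₂ ℝ (fun v a => mulVec (Γ := Γ) (c := c) v a)
    (fun v w a => by simp only [mulVec]; exact map_add ((ContinuousLinearMap.toSpanSingleton ℝ
      a).compLpL 2 (weight Γ c)) v w)
    (fun r v a => by simp only [mulVec]; exact map_smul ((ContinuousLinearMap.toSpanSingleton ℝ
      a).compLpL 2 (weight Γ c)) r v)
    (fun v a a' => by
      refine Lp.ext ?_
      filter_upwards [mulVec_ae v a, mulVec_ae v a', mulVec_ae v (a + a'),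
        Lp.coeFn_add (mulVec v a) (mulVec v a')] with x h1 h2 h3 h4
      rw [h3, h4, Pi.add_apply, h1, h2, smul_add])
    (fun r v a => by
      refine Lp.ext ?_
      filter_upwards [mulVec_ae v a, mulVec_ae v (r • a),
        Lp.coeFn_smul r (mulVec v a)] with x h1 h3 h4
      rw [h3, h4, Pi.smul_apply, h1, smul_comm])) 1 fun v a => by
    rw [one_mul, LinearMap.mk₂_apply]
    refine le_of_sq_le_sq ?_ (by positivity)
    rw [← real_inner_self_eq_norm_sq, inner_mulVec_mulVec, real_inner_self_eq_norm_sq,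
      real_inner_self_eq_norm_sq, mul_pow]

@[simp] theorem mulVecL_apply (v : FrakH Γ c) (a : EuclideanSpace ℝ (Fin n)) :
    mulVecL Γ c v a = mulVec v a := rfl

end

/-! ### Weak gradients, the adjoint of the weighted gradient, completeness of `𝔙` -/

section

variable {n : ℕ} {Γ : Matrix (Fin n) (Fin n) ℝ} {c : ℝ}

/-! ### Weak gradients -/

theorem single_inner (x : EuclideanSpace ℝ (Fin n)) (i : Fin n) :
    ⟪x, EuclideanSpace.single i (1 : ℝ)⟫ = x i := by
  rw [EuclideanSpace.inner_single_right]; simp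

theorem integrable_mul_fderiv {f θ : EuclideanSpace ℝ (Fin n) → ℝ} (hf : LocallyIntegrable f)
    (hθ : ContDiff ℝ ∞ θ) (hc : HasCompactSupport θ) (v : EuclideanSpace ℝ (Fin n)) :
    Integrable fun x => f x * fderiv ℝ θ x v := by
  have cdθ : Continuous (fun x => fderiv ℝ θ x v) :=
    (hθ.continuous_fderiv (by simp)).clm_apply continuous_const
  simpa [mul_comm] using hf.integrable_smul_left_of_hasCompactSupport cdθ (hc.fderiv_apply ℝ v)

theorem integrable_inner_mul {G : EuclideanSpace ℝ (Fin n) → EuclideanSpace ℝ (Fin n)}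
    {θ : EuclideanSpace ℝ (Fin n) → ℝ} (hG : LocallyIntegrable G)
    (hθ : ContDiff ℝ ∞ θ) (hc : HasCompactSupport θ) (v : EuclideanSpace ℝ (Fin n)) :
    Integrable fun x => ⟪G x, v⟫ * θ x := by
  have h1 := hG.integrable_smul_left_of_hasCompactSupport hθ.continuous hc
  refine (h1.inner_const (𝕜 := ℝ) v).congr (ae_of_all _ fun x => ?_)
  simp [inner_smul_left, mul_comm]

theorem HasWeakGradient.direction {f : EuclideanSpace ℝ (Fin n) → ℝ}
    {G : EuclideanSpace ℝ (Fin n) → EuclideanSpace ℝ (Fin n)} (h : HasWeakGradient f G)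
    {θ : EuclideanSpace ℝ (Fin n) → ℝ} (hθ : ContDiff ℝ ∞ θ) (hc : HasCompactSupport θ)
    (v : EuclideanSpace ℝ (Fin n)) :
    ∫ x, f x * fderiv ℝ θ x v = -∫ x, ⟪G x, v⟫ * θ x := by
  have hv : v = ∑ i, v i • EuclideanSpace.single i (1 : ℝ) := by
    ext j
    simp [Pi.single_apply]
  have e1 : ∀ x, f x * fderiv ℝ θ x v =
      ∑ i, v i * (f x * fderiv ℝ θ x (EuclideanSpace.single i 1)) := by
    intro x
    conv_lhs => rw [hv, map_sum, Finset.mul_sum]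
    exact Finset.sum_congr rfl fun i _ => by rw [map_smul, smul_eq_mul]; ring
  have e2 : ∀ x, ⟪G x, v⟫ * θ x = ∑ i, v i * (G x i * θ x) := by
    intro x
    conv_lhs => rw [hv, inner_sum, Finset.sum_mul]
    exact Finset.sum_congr rfl fun i _ => by rw [inner_smul_right, single_inner]; ring
  simp only [e1, e2]
  rw [integral_finsetSum _ fun i _ => (integrable_mul_fderiv h.1 hθ hc _).const_mul _,
    integral_finsetSum, ← Finset.sum_neg_distrib]
  · refine Finset.sum_congr rfl fun i _ => ?_
    rw [integral_const_mul, integral_const_mul, h.2.2 θ hθ hc i]; ring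
  · intro i _
    have := integrable_inner_mul h.2.1 hθ hc (EuclideanSpace.single i (1 : ℝ))
    simp only [single_inner] at this
    exact this.const_mul _

theorem HasWeakGradient.of_hasFDerivAt {f : EuclideanSpace ℝ (Fin n) → ℝ}
    {G : EuclideanSpace ℝ (Fin n) → EuclideanSpace ℝ (Fin n)} (hG : Continuous G)
    (hf : ∀ x, HasFDerivAt f (innerSL ℝ (G x)) x) : HasWeakGradient f G := by
  have cf : Continuous f := continuous_iff_continuousAt.2 fun x => (hf x).continuousAt
  refine ⟨cf.locallyIntegrable, hG.locallyIntegrable, fun θ hθ hc i => ?_⟩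
  have e : ∀ x, G x i = fderiv ℝ f x (EuclideanSpace.single i 1) := fun x => by
    rw [(hf x).fderiv, innerSL_apply_apply, single_inner]
  simp only [e]
  refine integral_mul_fderiv_eq_neg_fderiv_mul_of_integrable ?_
    (integrable_mul_fderiv cf.locallyIntegrable hθ hc _) ?_
    (fun x _ => (hf x).differentiableAt) (fun x _ => (hθ.differentiable (by simp)) x)
  · have := integrable_inner_mul hG.locallyIntegrable hθ hc (EuclideanSpace.single i (1 : ℝ))
    simpa only [single_inner, e] using this
  · exact (cf.mul hθ.continuous).integrable_of_hasCompactSupport hc.mul_left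

/-! ### Smooth elements of `𝔙` and integration by parts -/

/-- `f` and the components `g i` of its gradient in the eigenbasis have at most exponential
growth. -/
structure EigenData.SmoothGrowth (D : EigenData Γ c) (f : EuclideanSpace ℝ (Fin n) → ℝ)
    (g : Fin n → EuclideanSpace ℝ (Fin n) → ℝ) : Prop where
  growth : Growth f
  growth_grad : ∀ i, Growth (g i)
  contDiff : ContDiff ℝ ∞ f
  hasFDerivAt : ∀ x, HasFDerivAt f (innerSL ℝ (∑ i, g i x • D.b i)) x

theorem mem_frakV_iff (z : WithLp 2 (FrakH Γ c × FrakHn Γ c)) :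
    z ∈ FrakV Γ c ↔ HasWeakGradient (fun x => Real.exp (phi Γ c x) * z.fst x)
      (fun x => Real.exp (phi Γ c x) • z.snd x) := Iff.rfl

/-- The element `e^{-φ} f` of `𝔙`. -/
def EigenData.vecV (D : EigenData Γ c) {f : EuclideanSpace ℝ (Fin n) → ℝ}
    {g : Fin n → EuclideanSpace ℝ (Fin n) → ℝ} (h : D.SmoothGrowth f g) : FrakV Γ c :=
  ⟨WithLp.toLp 2 (D.vec h.growth, ∑ i, mulVec (D.vec (h.growth_grad i)) (D.b i)), by
    rw [mem_frakV_iff]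
    have hG : Continuous fun x => ∑ i, g i x • D.b i :=
      continuous_finsetSum _ fun i _ => (h.growth_grad i).1.smul continuous_const
    refine (HasWeakGradient.of_hasFDerivAt hG h.hasFDerivAt).congr ?_ ?_
    · filter_upwards [D.vec_ae h.growth] with x hx
      change _ = _ * D.vec h.growth x
      rw [hx, mul_left_comm, ← Real.exp_add]; simp
    · have h1 := ae_weight_iff (Lp.coeFn_finsetSum Finset.univ
        (fun i => mulVec (D.vec (h.growth_grad i)) (D.b i)))
      have h2 := ae_all_iff.2 fun i => ae_weight_iff (mulVec_ae (D.vec (h.growth_grad i)) (D.b i))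
      have h3 := ae_all_iff.2 fun i => D.vec_ae (h.growth_grad i)
      filter_upwards [h1, h2, h3] with x h1 h2 h3
      change _ = _ • (∑ i, mulVec (D.vec (h.growth_grad i)) (D.b i) : FrakHn Γ c) x
      rw [h1, Finset.sum_apply, Finset.smul_sum]
      refine Finset.sum_congr rfl fun i _ => ?_
      rw [h2 i, h3 i, smul_smul, mul_left_comm, ← Real.exp_add]; simp⟩

@[simp] theorem EigenData.valV_vecV (D : EigenData Γ c) {f : EuclideanSpace ℝ (Fin n) → ℝ}
    {g : Fin n → EuclideanSpace ℝ (Fin n) → ℝ} (h : D.SmoothGrowth f g) :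
    valV (D.vecV h) = D.vec h.growth := rfl

@[simp] theorem EigenData.gradV_vecV (D : EigenData Γ c) {f : EuclideanSpace ℝ (Fin n) → ℝ}
    {g : Fin n → EuclideanSpace ℝ (Fin n) → ℝ} (h : D.SmoothGrowth f g) :
    gradV (D.vecV h) = ∑ i, mulVec (D.vec (h.growth_grad i)) (D.b i) := rfl

theorem EigenData.hasFDerivAt_exp_phi (D : EigenData Γ c) (x : EuclideanSpace ℝ (Fin n)) :
    HasFDerivAt (fun x => Real.exp (-phi Γ c x))
      (-Real.exp (-phi Γ c x) • innerSL ℝ (∑ i, (D.lam i * ⟪D.b i, x⟫) • D.b i)) x := by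
  have h1 : HasFDerivAt (phi Γ c) (innerSL ℝ (∑ i, (D.lam i * ⟪D.b i, x⟫) • D.b i)) x := by
    have : phi Γ c = fun x => 1 / 2 * ∑ i, D.lam i * ⟪D.b i, x⟫ ^ 2 := funext D.phi_eq
    rw [this]
    have h2 : ∀ i, HasFDerivAt (fun x => D.lam i * ⟪D.b i, x⟫ ^ 2)
        (D.lam i • ((2 * ⟪D.b i, x⟫) • innerSL ℝ (D.b i))) x := fun i => by
      have := (((innerSL ℝ (D.b i)).hasFDerivAt (x := x)).pow 2).const_mul (D.lam i)
      simpa using this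
    refine ((HasFDerivAt.fun_sum (u := Finset.univ) fun i _ => h2 i).const_mul (1 / 2)).congr_fderiv ?_
    rw [map_sum, Finset.smul_sum]
    refine Finset.sum_congr rfl fun i _ => ?_
    ext v
    simp; ring
  simpa using h1.neg.exp

/-- The adjoint of `e^{-φ} ∂_i (e^φ ·)` acts on `e^{-φ} f` as the creation operator `f ↦ (∂_i φ) f -
∂_i f`. The weak gradient may only be tested against compactly supported functions, which is why
`e^{-φ} f` is first cut off. -/
theorem EigenData.inner_gradV (D : EigenData Γ c) {f : EuclideanSpace ℝ (Fin n) → ℝ}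
    {g : Fin n → EuclideanSpace ℝ (Fin n) → ℝ} (h : D.SmoothGrowth f g) (i : Fin n)
    {k : EuclideanSpace ℝ (Fin n) → ℝ} (hk : Growth k)
    (hkf : ∀ x, k x = D.lam i * ⟪D.b i, x⟫ * f x - g i x) (z : FrakV Γ c) :
    ⟪mulVec (D.vec h.growth) (D.b i), gradV z⟫ = ⟪D.vec hk, valV z⟫ := by
  have hw : HasWeakGradient (fun x => Real.exp (phi Γ c x) * valV z x)
    (fun x => Real.exp (phi Γ c x) • gradV z x) := (mem_frakV_iff _).1 z.2
  -- The identity for the product with a cut-off function, then dominated convergence.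
  set e : EuclideanSpace ℝ (Fin n) → ℝ := fun x => Real.exp (-phi Γ c x) with he
  have hee : ∀ x, Real.exp (phi Γ c x) * e x = 1 := fun x => by
    rw [he, ← Real.exp_add]; simp
  have hsm_e : ContDiff ℝ ∞ e := by
    have : phi Γ c = fun x => 1 / 2 * ∑ i, D.lam i * ⟪D.b i, x⟫ ^ 2 := funext D.phi_eq
    simp only [he, this]
    have h1 : ∀ i, ContDiff ℝ ∞ fun x => ⟪D.b i, x⟫ := fun i => (innerSL ℝ (D.b i)).contDiff
    fun_prop
  let χ : ContDiffBump (0 : EuclideanSpace ℝ (Fin n)) := ⟨1, 2, one_pos, one_lt_two⟩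
  -- Cut-offs dilated by `N + 1`, so that `N = 0` is allowed: they tend to one pointwise and their
  -- gradients are of order `1/(N+1)`.
  set ψ : ℕ → EuclideanSpace ℝ (Fin n) → ℝ := fun N x => χ (((N : ℝ) + 1)⁻¹ • x) with hψ
  have hN : ∀ N : ℕ, ((N : ℝ) + 1)⁻¹ ≠ 0 := fun N => by positivity
  have hψs : ∀ N, ContDiff ℝ ∞ (ψ N) := fun N =>
    χ.contDiff.comp (contDiff_const_smul _)
  have hψc : ∀ N, HasCompactSupport (ψ N) := fun N => χ.hasCompactSupport.comp_smul (hN N)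
  obtain ⟨M, hM⟩ : ∃ M, ∀ x, ‖fderiv ℝ χ x (D.b i)‖ ≤ M := by
    have hcont : Continuous fun x => fderiv ℝ χ x (D.b i) :=
      ((χ.contDiff (n := (⊤ : ℕ∞))).continuous_fderiv (by simp)).clm_apply continuous_const
    exact hcont.bounded_above_of_compact_support (χ.hasCompactSupport.fderiv_apply ℝ _)
  have hdψ : ∀ N x, fderiv ℝ (ψ N) x (D.b i) =
      ((N : ℝ) + 1)⁻¹ * fderiv ℝ χ (((N : ℝ) + 1)⁻¹ • x) (D.b i) := by
    intro N x
    have h1 : HasFDerivAt (ψ N) ((fderiv ℝ χ (((N : ℝ) + 1)⁻¹ • x)).comp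
        (((N : ℝ) + 1)⁻¹ • ContinuousLinearMap.id ℝ _)) x :=
      (((χ.contDiff (n := (⊤ : ℕ∞))).differentiable (by simp) _).hasFDerivAt).comp x
        (((N : ℝ) + 1)⁻¹ • ContinuousLinearMap.id ℝ (EuclideanSpace ℝ (Fin n))).hasFDerivAt
    rw [h1.fderiv]
    simp
  have hsm : ∀ N, ContDiff ℝ ∞ fun x => ψ N x * (f x * e x) := fun N =>
    (hψs N).mul (h.contDiff.mul hsm_e)
  have hd : ∀ N x, fderiv ℝ (fun x => ψ N x * (f x * e x)) x (D.b i) =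
      fderiv ℝ (ψ N) x (D.b i) * (f x * e x) - ψ N x * (k x * e x) := by
    intro N x
    have h2 := (h.hasFDerivAt x).mul (D.hasFDerivAt_exp_phi x)
    have h3 := (((hψs N).differentiable (by simp) x).hasFDerivAt).mul h2
    have h4 : fderiv ℝ (fun x => ψ N x * (f x * e x)) x = _ := h3.fderiv
    rw [h4]
    have hin : ∀ w : Fin n → ℝ, ⟪∑ j, w j • D.b j, D.b i⟫ = w i := fun w => by
      rw [real_inner_comm]; exact D.b.orthonormal.inner_right_fintype w i
    simp only [_root_.add_apply, smul_apply, innerSL_apply_apply, hin, smul_eq_mul, hkf, Pi.mul_apply, he]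
    ring
  have key : ∀ N, ∫ x, fderiv ℝ (ψ N) x (D.b i) * (f x * valV z x) - ψ N x * (k x * valV z x) =
      -∫ x, ψ N x * (f x * ⟪gradV z x, D.b i⟫) := by
    intro N
    have := hw.direction (hsm N) ((hψc N).mul_right) (D.b i)
    refine Eq.trans ?_ (this.trans ?_)
    · refine integral_congr_ae (ae_of_all _ fun x => ?_)
      simp only [hd]
      linear_combination (-(fderiv ℝ (ψ N) x (D.b i) * (f x * valV z x) -
        ψ N x * (k x * valV z x))) * hee x
    · congr 1
      refine integral_congr_ae (ae_of_all _ fun x => ?_)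
      simp only [inner_smul_left, conj_trivial]
      linear_combination (ψ N x * (f x * ⟪gradV z x, D.b i⟫)) * hee x
  have hψ1 : ∀ N x, |ψ N x| ≤ 1 := fun N x => by
    rw [abs_of_nonneg χ.nonneg]; exact χ.le_one
  have hlimN : Tendsto (fun N : ℕ => ((N : ℝ) + 1)⁻¹) atTop (𝓝 0) := by
    simpa using tendsto_one_div_add_atTop_nhds_zero_nat (𝕜 := ℝ)
  have hψlim : ∀ x, Tendsto (fun N => ψ N x) atTop (𝓝 1) := by
    intro x
    have h1 : Tendsto (fun N : ℕ => ((N : ℝ) + 1)⁻¹ • x) atTop (𝓝 0) := by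
      simpa using hlimN.smul_const x
    have h2 := (χ.continuous.tendsto 0).comp h1
    rwa [χ.one_of_mem_closedBall (by simp [χ])] at h2
  have hdlim : ∀ x, Tendsto (fun N => fderiv ℝ (ψ N) x (D.b i)) atTop (𝓝 0) := by
    intro x
    simp only [hdψ]
    refine squeeze_zero_norm (a := fun N : ℕ => ((N : ℝ) + 1)⁻¹ * M) (fun N => ?_)
      (by simpa using hlimN.mul_const M)
    rw [norm_mul, Real.norm_of_nonneg (by positivity)]
    exact mul_le_mul_of_nonneg_left (hM _) (by positivity)
  have hM0 : 0 ≤ M := (norm_nonneg _).trans (hM 0)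
  have hdb : ∀ N x, |fderiv ℝ (ψ N) x (D.b i)| ≤ M := by
    intro N x
    rw [hdψ, abs_mul, abs_of_nonneg (by positivity)]
    refine (mul_le_mul_of_nonneg_left (hM _) (by positivity)).trans
      (mul_le_of_le_one_left hM0 (inv_le_one_of_one_le₀ ?_))
    linarith [Nat.cast_nonneg (α := ℝ) N]
  have If := D.integrable_growth_mul h.growth (valV z)
  have Ik := D.integrable_growth_mul hk (valV z)
  have Ig : Integrable fun x => f x * ⟪gradV z x, D.b i⟫ := by
    have h1 : Integrable (fun x => ⟪mulVec (D.vec h.growth) (D.b i) x, gradV z x⟫) (weight Γ c) :=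
      L2.integrable_inner _ _
    rw [integrable_weight_iff] at h1
    refine h1.congr ?_
    filter_upwards [D.vec_ae h.growth, ae_weight_iff (mulVec_ae (D.vec h.growth) (D.b i))]
      with x h1 h2
    rw [h2, h1, inner_smul_left, real_inner_comm]
    simp only [smul_eq_mul, conj_trivial]
    linear_combination (f x * ⟪gradV z x, D.b i⟫) * hee x
  have L1 : Tendsto (fun N => ∫ x, fderiv ℝ (ψ N) x (D.b i) * (f x * valV z x) -
      ψ N x * (k x * valV z x)) atTop (𝓝 (∫ x, 0 * (f x * valV z x) - 1 * (k x * valV z x))) := by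
    refine tendsto_integral_of_dominated_convergence
      (fun x => M * |f x * valV z x| + |k x * valV z x|) (fun N => ?_)
      ((If.abs.const_mul M).add Ik.abs) (fun N => ae_of_all _ fun x => ?_)
      (ae_of_all _ fun x => ((hdlim x).mul_const _).sub ((hψlim x).mul_const _))
    · refine AEStronglyMeasurable.sub (AEStronglyMeasurable.mul ?_ If.1)
        ((hψs N).continuous.aestronglyMeasurable.mul Ik.1)
      exact (((hψs N).continuous_fderiv (by simp)).clm_apply
        continuous_const).aestronglyMeasurable
    · rw [Real.norm_eq_abs]
      refine (abs_sub _ _).trans (add_le_add ?_ ?_)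
      · rw [abs_mul]; exact mul_le_mul_of_nonneg_right (hdb N x) (abs_nonneg _)
      · rw [abs_mul]; exact mul_le_of_le_one_left (abs_nonneg _) (hψ1 N x)
  have L2' : Tendsto (fun N => ∫ x, ψ N x * (f x * ⟪gradV z x, D.b i⟫)) atTop
      (𝓝 (∫ x, 1 * (f x * ⟪gradV z x, D.b i⟫))) := by
    refine tendsto_integral_of_dominated_convergence
      (fun x => |f x * ⟪gradV z x, D.b i⟫|) (fun N => ?_) Ig.abs
      (fun N => ae_of_all _ fun x => ?_) (ae_of_all _ fun x => (hψlim x).mul_const _)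
    · exact (hψs N).continuous.aestronglyMeasurable.mul Ig.1
    · rw [Real.norm_eq_abs, abs_mul]
      exact mul_le_of_le_one_left (abs_nonneg _) (hψ1 N x)
  simp only [key] at L1
  have hfin := tendsto_nhds_unique L1 L2'.neg
  simp only [zero_mul, one_mul, zero_sub, integral_neg, neg_inj] at hfin
  rw [D.inner_vec, hfin, L2.inner_def, integral_weight]
  refine integral_congr_ae ?_
  filter_upwards [D.vec_ae h.growth, ae_weight_iff (mulVec_ae (D.vec h.growth) (D.b i))]
    with x h1 h2
  rw [h2, h1, inner_smul_left, real_inner_comm]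
  simp only [smul_eq_mul, conj_trivial]
  linear_combination (f x * ⟪gradV z x, D.b i⟫) * hee x

theorem isLocallyFiniteMeasure_weight : IsLocallyFiniteMeasure (weight Γ c) :=
  IsLocallyFiniteMeasure.withDensity_ofReal (by fun_prop)

theorem locallyIntegrable_exp_smul {F : Type*} [NormedAddCommGroup F] [NormedSpace ℝ F]
    (f : Lp F 2 (weight Γ c)) : LocallyIntegrable fun x => Real.exp (phi Γ c x) • f x := by
  have := isLocallyFiniteMeasure_weight (Γ := Γ) (c := c)
  have h1 : LocallyIntegrable f (weight Γ c) := (Lp.memLp f).locallyIntegrable one_le_two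
  rw [locallyIntegrable_iff] at h1 ⊢
  intro K hK
  have h2 : Integrable f ((volume.withDensity
      fun x => ENNReal.ofReal (Real.exp (phi Γ c x))).restrict K) := h1 K hK
  rw [restrict_withDensity hK.measurableSet,
    integrable_withDensity_iff_integrable_smul' measurable_weightDensity
    (ae_of_all _ fun x => ENNReal.ofReal_lt_top)] at h2
  simp only [ENNReal.toReal_ofReal (Real.exp_pos _).le] at h2
  exact h2

/-- Local integrability is automatic for elements of the weighted spaces, so membership is a family
of equations, one for each test function and direction. Each side is an inner product with a fixed
`L²` function, hence continuous. -/
theorem frakV_isClosed : IsClosed (FrakV Γ c : Set (WithLp 2 (FrakH Γ c × FrakHn Γ c))) := by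
  have := isLocallyFiniteMeasure_weight (Γ := Γ) (c := c)
  have hd : ∀ θ : EuclideanSpace ℝ (Fin n) → ℝ, ContDiff ℝ ∞ θ → HasCompactSupport θ →
      ∀ i : Fin n, MemLp (fun x => fderiv ℝ θ x (EuclideanSpace.single i 1)) 2 (weight Γ c) :=
    fun θ hθ hc i => ((hθ.continuous_fderiv (by simp)).clm_apply
      continuous_const).memLp_of_hasCompactSupport (hc.fderiv_apply ℝ _)
  have hm : ∀ θ : EuclideanSpace ℝ (Fin n) → ℝ, ContDiff ℝ ∞ θ → HasCompactSupport θ →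
      ∀ i : Fin n, MemLp (fun x => θ x • EuclideanSpace.single i (1 : ℝ)) 2 (weight Γ c) :=
    fun θ hθ hc i => (hθ.continuous.smul continuous_const).memLp_of_hasCompactSupport
      hc.smul_right
  have : (FrakV Γ c : Set (WithLp 2 (FrakH Γ c × FrakHn Γ c))) =
      ⋂ (θ : EuclideanSpace ℝ (Fin n) → ℝ) (hθ : ContDiff ℝ ∞ θ) (hc : HasCompactSupport θ)
        (i : Fin n), {z | ⟪(hd θ hθ hc i).toLp, z.fst⟫ = -⟪(hm θ hθ hc i).toLp, z.snd⟫} := by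
    ext z
    simp only [SetLike.mem_coe, mem_iInter, mem_ofPred_eq, mem_frakV_iff, HasWeakGradient]
    have e1 : ∀ θ hθ hc i, ⟪(hd θ hθ hc i).toLp, z.fst⟫ = ∫ x, Real.exp (phi Γ c x) *
        z.fst x * fderiv ℝ θ x (EuclideanSpace.single i 1) := by
      intro θ hθ hc i
      rw [L2.inner_def, integral_weight]
      refine integral_congr_ae ?_
      filter_upwards [ae_weight_iff (hd θ hθ hc i).coeFn_toLp] with x hx
      rw [hx]
      simp; ring
    have e2 : ∀ θ hθ hc i, ⟪(hm θ hθ hc i).toLp, z.snd⟫ = ∫ x, (Real.exp (phi Γ c x) •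
        z.snd x) i * θ x := by
      intro θ hθ hc i
      rw [L2.inner_def, integral_weight]
      refine integral_congr_ae ?_
      filter_upwards [ae_weight_iff (hm θ hθ hc i).coeFn_toLp] with x hx
      rw [hx, inner_smul_left, real_inner_comm, single_inner]
      simp; ring
    have e3 : ∀ θ hθ hc i, (⟪(hd θ hθ hc i).toLp, z.fst⟫ = -⟪(hm θ hθ hc i).toLp, z.snd⟫) ↔ _ :=
      fun θ hθ hc i => by rw [e1 θ hθ hc i, e2 θ hθ hc i]
    rw [forall_congr' fun θ => forall_congr' fun hθ => forall_congr' fun hc => forall_congr' fun i =>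
      e3 θ hθ hc i]
    exact ⟨fun h => h.2.2, fun h => ⟨locallyIntegrable_exp_smul z.fst,
      locallyIntegrable_exp_smul z.snd, h⟩⟩
  rw [this]
  refine isClosed_iInter fun θ => isClosed_iInter fun hθ => isClosed_iInter fun hc =>
    isClosed_iInter fun i => isClosed_eq ?_ ?_
  · exact (innerSL ℝ _).continuous.comp (WithLp.fstL 2 ℝ (FrakH Γ c) (FrakHn Γ c)).continuous
  · exact ((innerSL ℝ _).continuous.comp
      (WithLp.sndL 2 ℝ (FrakH Γ c) (FrakHn Γ c)).continuous).neg

instance instCompleteSpaceFrakV : CompleteSpace (FrakV Γ c) :=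
  frakV_isClosed.completeSpace_coe

theorem inner_frakV (z w : FrakV Γ c) : ⟪z, w⟫ = ⟪valV z, valV w⟫ + form z w := by
  rw [Submodule.coe_inner, WithLp.prod_inner_apply]
  rfl

end

/-! ### Completeness of the Hermite functions in `𝔥` -/

section

variable {n : ℕ} {Γ : Matrix (Fin n) (Fin n) ℝ} {c : ℝ}

/-! ### Laplace transforms determine finite measures -/

/-- Restricted to a line, the transform is a moment generating function finite on all of `ℝ`. Its
complex extension is entire and determined by the real values; at `i` it is the characteristic
function. -/
theorem measure_ext_of_laplace {E : Type*} [NormedAddCommGroup E] [InnerProductSpace ℝ E]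
    [CompleteSpace E] [SecondCountableTopology E] [MeasurableSpace E] [BorelSpace E]
    {μ ν : Measure E} [IsFiniteMeasure μ]
    [IsFiniteMeasure ν] (hμ : ∀ ξ : E, Integrable (fun x => Real.exp ⟪ξ, x⟫) μ)
    (h : ∀ ξ : E, ∫ x, Real.exp ⟪ξ, x⟫ ∂μ = ∫ x, Real.exp ⟪ξ, x⟫ ∂ν) : μ = ν := by
  refine Measure.ext_of_charFun (funext fun t => ?_)
  have hmgf : ProbabilityTheory.mgf (fun x => ⟪t, x⟫) μ =
      ProbabilityTheory.mgf (fun x => ⟪t, x⟫) ν := by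
    funext s
    have := h (s • t)
    simpa only [ProbabilityTheory.mgf, inner_smul_left, conj_trivial] using this
  have hset : ProbabilityTheory.integrableExpSet (fun x => ⟪t, x⟫) μ = univ := by
    refine eq_univ_of_forall fun s => ?_
    have := hμ (s • t)
    simp only [inner_smul_left, conj_trivial] at this
    exact this
  have hzero : μ = 0 ↔ ν = 0 := by
    have h0 := h 0
    simp only [inner_zero_left, Real.exp_zero, integral_const, smul_eq_mul, mul_one] at h0
    rw [← Measure.measure_univ_eq_zero, ← Measure.measure_univ_eq_zero,
      ← measureReal_eq_zero_iff, ← measureReal_eq_zero_iff, h0]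
  have key := ProbabilityTheory.eqOn_complexMGF_of_mgf' hmgf hzero (x := Complex.I)
    (by simp [hset])
  simp only [ProbabilityTheory.complexMGF] at key
  rw [charFun_apply, charFun_apply]
  simpa only [mul_comm Complex.I, real_inner_comm] using key

/-! ### Multi-index series -/

theorem multiIndex_induction {P : (Fin n → ℕ) → Prop} (h0 : P 0)
    (hs : ∀ α i, P α → P (raise α i)) (α : Fin n → ℕ) : P α := by
  obtain ⟨N, hN⟩ : ∃ N, ∑ i, α i = N := ⟨_, rfl⟩
  induction N generalizing α with
  | zero =>
    have : α = 0 := funext fun i => by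
      have := Finset.sum_eq_zero_iff.1 hN i (Finset.mem_univ i)
      simpa using this
    rwa [this]
  | succ N ih =>
    have hN' : (Finset.univ.sum α) = N + 1 := hN
    obtain ⟨i, hi⟩ : ∃ i, α i ≠ 0 := by
      by_contra! hcon
      simp [hcon] at hN
    rw [← raise_lower hi]
    refine hs _ i (ih _ ?_)
    change Finset.univ.sum (lower α i) = N
    have e := Finset.add_sum_erase Finset.univ α (Finset.mem_univ i)
    have e' := Finset.add_sum_erase Finset.univ (lower α i) (Finset.mem_univ i)
    rw [Finset.sum_congr rfl (g := α)
      (fun j hj => lower_of_ne α (Finset.ne_of_mem_erase hj)), lower_same] at e'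
    change _ + (Finset.univ.erase i).sum α = _ at e e'
    change _ = Finset.univ.sum (lower α i) at e'
    change _ = Finset.univ.sum α at e
    omega

theorem tendsto_box : Tendsto (fun N : ℕ => Fintype.piFinset fun _ : Fin n => Finset.range N)
    atTop atTop := by
  refine tendsto_atTop_finset_of_monotone (fun N M h => ?_) fun α => ?_
  · exact Fintype.piFinset_subset _ _ fun _ => Finset.range_mono h
  · refine ⟨∑ i, α i + 1, Fintype.mem_piFinset.2 fun i => Finset.mem_range.2 ?_⟩
    have := Finset.single_le_sum (f := α) (fun _ _ => Nat.zero_le _) (Finset.mem_univ i)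
    omega

/-- Over boxes the sum factors into one-dimensional partial sums of exponential series, and boxes
are cofinal among finite sets. Absolute summability permits passing to that subsequence. -/
theorem hasSum_multiExp (x : Fin n → ℝ) :
    HasSum (fun α : Fin n → ℕ => ∏ i, x i ^ α i / (α i).factorial) (Real.exp (∑ i, x i)) := by
  have hbox : ∀ (y : Fin n → ℝ) (N : ℕ),
      ∑ α ∈ Fintype.piFinset fun _ : Fin n => Finset.range N, ∏ i, y i ^ α i / (α i).factorial =
        ∏ i, ∑ k ∈ Finset.range N, y i ^ k / k.factorial := fun y N =>
    (Finset.prod_univ_sum (fun _ => Finset.range N)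
      (fun i k => y i ^ k / (k.factorial : ℝ))).symm
  have hs : Summable fun α : Fin n → ℕ => ∏ i, x i ^ α i / (α i).factorial := by
    refine Summable.of_norm_bounded (g := fun α : Fin n → ℕ => ∏ i, |x i| ^ α i / (α i).factorial)
      ?_ fun α => ?_
    · refine summable_of_sum_le (c := ∏ i, Real.exp |x i|)
        (fun α => Finset.prod_nonneg fun i _ => by positivity) fun s => ?_
      obtain ⟨N, hN⟩ := (tendsto_box.eventually_ge_atTop s).exists
      refine (Finset.sum_le_sum_of_subset_of_nonneg hN fun α _ _ =>
        Finset.prod_nonneg fun i _ => by positivity).trans ?_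
      rw [hbox]
      exact Finset.prod_le_prod (fun i _ => Finset.sum_nonneg fun k _ => by positivity)
        fun i _ => Real.sum_le_exp_of_nonneg (abs_nonneg _) N
    · rw [Real.norm_eq_abs, Finset.abs_prod]
      refine le_of_eq (Finset.prod_congr rfl fun i _ => ?_)
      rw [abs_div, abs_pow, Nat.abs_cast]
  have h1 := hs.hasSum.comp tendsto_box
  have h2 : Tendsto (fun N => ∏ i, ∑ k ∈ Finset.range N, x i ^ k / k.factorial) atTop
      (𝓝 (∏ i, Real.exp (x i))) := by
    refine tendsto_finsetProd _ fun i _ => ?_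
    have := (NormedSpace.expSeries_div_hasSum_exp (x i)).tendsto_sum_nat
    rwa [← Real.exp_eq_exp_ℝ] at this
  have h3 : Tendsto (fun N => ∏ i, ∑ k ∈ Finset.range N, x i ^ k / k.factorial) atTop
      (𝓝 (∑' α : Fin n → ℕ, ∏ i, x i ^ α i / (α i).factorial)) := by
    refine h1.congr fun N => ?_
    rw [← hbox]; rfl
  rw [Real.exp_sum, tendsto_nhds_unique h2 h3]
  exact hs.hasSum

theorem sqf_sq (α : Fin n → ℕ) : sqf α ^ 2 = ∏ i, ((α i).factorial : ℝ) := by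
  rw [sqf, ← Finset.prod_pow]
  exact Finset.prod_congr rfl fun i _ => Real.sq_sqrt (Nat.cast_nonneg _)

/-! ### Hermite functions -/

/-- The probabilists' Hermite polynomials as real functions. -/
def He (k : ℕ) (y : ℝ) : ℝ := Polynomial.aeval y (Polynomial.hermite k)

/-- The Appell property, by differentiating the defining recursion. It turns that recursion into the
three-term recurrence `He_succ`. -/
theorem derivative_hermite_succ (k : ℕ) : Polynomial.derivative (Polynomial.hermite (k + 1)) =
    ((k : Polynomial ℤ) + 1) * Polynomial.hermite k := by
  induction k with
  | zero => simp
  | succ k ih =>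
    rw [Polynomial.hermite_succ (k + 1), Polynomial.derivative_sub, Polynomial.derivative_mul,
      Polynomial.derivative_X, ih, Polynomial.derivative_mul, Polynomial.hermite_succ k]
    simp
    ring

@[simp] theorem He_zero (y : ℝ) : He 0 y = 1 := by simp [He]

theorem He_one (y : ℝ) : He 1 y = y := by simp [He]

theorem hasDerivAt_He (k : ℕ) (y : ℝ) : HasDerivAt (He k) (k * He (k - 1) y) y := by
  have h := (Polynomial.hermite k).hasDerivAt_aeval (𝕜 := ℝ) y
  refine h.congr_deriv ?_
  rcases k with _ | k
  · simp
  · rw [derivative_hermite_succ]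
    simp [He]

theorem He_succ (k : ℕ) (y : ℝ) : He (k + 1) y = y * He k y - k * He (k - 1) y := by
  rcases k with _ | k
  · simp [He_one]
  · simp only [He]
    rw [Polynomial.hermite_succ, derivative_hermite_succ]
    simp

/-- Products of Hermite polynomials in the scaled eigencoordinates. -/
def EigenData.herm (D : EigenData Γ c) (α : Fin n → ℕ) (x : EuclideanSpace ℝ (Fin n)) : ℝ :=
  ∏ i, He (α i) (D.y i x)

theorem EigenData.growth_herm (D : EigenData Γ c) (α : Fin n → ℕ) : Growth (D.herm α) :=
  Growth.prod _ fun i => (D.growth_y i).aeval _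

theorem EigenData.hasFDerivAt_herm (D : EigenData Γ c) (α : Fin n → ℕ)
    (x : EuclideanSpace ℝ (Fin n)) : HasFDerivAt (D.herm α) (innerSL ℝ
      (∑ i, (Real.sqrt (D.lam i) * α i * D.herm (lower α i) x) • D.b i)) x := by
  have h1 : ∀ i, HasFDerivAt (fun x => He (α i) (D.y i x))
      ((α i * He (α i - 1) (D.y i x)) • (Real.sqrt (D.lam i) • innerSL ℝ (D.b i))) x := fun i =>
    (hasDerivAt_He (α i) (D.y i x)).comp_hasFDerivAt x
      (((innerSL ℝ (D.b i)).hasFDerivAt (x := x)).const_mul (Real.sqrt (D.lam i)))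
  have h2 := HasFDerivAt.finsetProd (u := Finset.univ) fun i _ => h1 i
  refine h2.congr_fderiv ?_ |>.congr_of_eventuallyEq (Eventually.of_forall fun y => ?_)
  · rw [map_sum]
    refine Finset.sum_congr rfl fun i _ => ?_
    rw [map_smul, smul_smul, smul_smul]
    congr 1
    rw [EigenData.herm, ← Finset.mul_prod_erase _ _ (Finset.mem_univ i), lower_same,
      Finset.prod_congr rfl (s₁ := Finset.univ.erase i)
        (f := fun j => He (lower α i j) (D.y j x)) (g := fun j => He (α j) (D.y j x))
        fun j hj => by rw [lower_of_ne α (Finset.ne_of_mem_erase hj)]]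
    ring
  · simp [EigenData.herm]

theorem EigenData.smoothGrowth_herm (D : EigenData Γ c) (α : Fin n → ℕ) :
    D.SmoothGrowth (D.herm α)
      (fun i x => Real.sqrt (D.lam i) * α i * D.herm (lower α i) x) := by
  refine ⟨D.growth_herm α, fun i => (D.growth_herm _).const_mul _, ?_, D.hasFDerivAt_herm α⟩
  refine contDiff_prod fun i _ => ?_
  have h1 : ContDiff ℝ ∞ (D.y i) := contDiff_const.mul (innerSL ℝ (D.b i)).contDiff
  exact ((Polynomial.hermite (α i)).contDiff_aeval ∞).comp h1

/-- The (not normalised) Hermite functions `e^{-φ} ∏ He_{α_i}(y_i)`. -/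
def EigenData.hv (D : EigenData Γ c) (α : Fin n → ℕ) : FrakH Γ c := D.vec (D.growth_herm α)

/-- The Hermite functions as elements of `𝔙`. -/
def EigenData.hvV (D : EigenData Γ c) (α : Fin n → ℕ) : FrakV Γ c :=
  D.vecV (D.smoothGrowth_herm α)

@[simp] theorem EigenData.valV_hvV (D : EigenData Γ c) (α : Fin n → ℕ) :
    valV (D.hvV α) = D.hv α := rfl

theorem EigenData.vec_const_mul (D : EigenData Γ c) {f g : EuclideanSpace ℝ (Fin n) → ℝ}
    (hf : Growth f) (hg : Growth g) (r : ℝ) (h : ∀ x, g x = r * f x) :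
    D.vec hg = r • D.vec hf := by
  refine Lp.ext ?_
  filter_upwards [Lp.coeFn_smul r (D.vec hf), (D.memLp_growth hf).coeFn_toLp,
    (D.memLp_growth hg).coeFn_toLp] with x h1 h2 h3
  rw [h1, EigenData.vec, h3, Pi.smul_apply, EigenData.vec, h2, h, smul_eq_mul, mul_assoc]

theorem mulVec_smul_left (r : ℝ) (v : FrakH Γ c) (a : EuclideanSpace ℝ (Fin n)) :
    mulVec (r • v) a = r • mulVec v a := by
  simp only [← mulVecL_apply, map_smul, smul_apply]

theorem EigenData.gradV_hvV (D : EigenData Γ c) (α : Fin n → ℕ) : gradV (D.hvV α) =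
    ∑ i, (Real.sqrt (D.lam i) * α i) • mulVec (D.hv (lower α i)) (D.b i) := by
  rw [EigenData.hvV, D.gradV_vecV]
  refine Finset.sum_congr rfl fun i _ => ?_
  rw [D.vec_const_mul (D.growth_herm (lower α i)) _ _ fun x => rfl, mulVec_smul_left,
    EigenData.hv]

theorem EigenData.herm_raise (D : EigenData Γ c) (α : Fin n → ℕ) (i : Fin n)
    (x : EuclideanSpace ℝ (Fin n)) : D.herm (raise α i) x =
      D.y i x * D.herm α x - α i * D.herm (lower α i) x := by
  have key : ∀ γ : Fin n → ℕ, (∀ j, j ≠ i → γ j = α j) → D.herm γ x =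
      He (γ i) (D.y i x) * ∏ j ∈ Finset.univ.erase i, He (α j) (D.y j x) := by
    intro γ hγ
    rw [EigenData.herm, ← Finset.mul_prod_erase _ _ (Finset.mem_univ i)]
    congr 1
    exact Finset.prod_congr rfl fun j hj => by rw [hγ j (Finset.ne_of_mem_erase hj)]
  rw [key _ fun j hj => raise_of_ne α hj, key α fun _ _ => rfl, key _ fun j hj => lower_of_ne α hj,
    raise_same, lower_same, He_succ]
  ring

/-- For a Hermite product the creation operator of `inner_gradV` is the three-term recurrence: it
raises the `i`-th index. Pairing with gradients thus never needs the gradient itself. -/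
theorem EigenData.inner_mulVec_gradV (D : EigenData Γ c) (α : Fin n → ℕ) (i : Fin n)
    (z : FrakV Γ c) : ⟪mulVec (D.hv α) (D.b i), gradV z⟫ =
      Real.sqrt (D.lam i) * ⟪D.hv (raise α i), valV z⟫ := by
  have h := D.inner_gradV (D.smoothGrowth_herm α) i
    (k := fun x => Real.sqrt (D.lam i) * D.herm (raise α i) x)
    ((D.growth_herm (raise α i)).const_mul _) (fun x => ?_) z
  · rw [D.vec_const_mul (D.growth_herm (raise α i)) _ _ fun x => rfl, inner_smul_left] at h
    exact h
  · have := Real.mul_self_sqrt (D.lam_pos i).le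
    rw [D.herm_raise, EigenData.y]
    linear_combination (⟪D.b i, x⟫ * D.herm α x) * this

theorem EigenData.sqrt_lam_pos (D : EigenData Γ c) (i : Fin n) : 0 < Real.sqrt (D.lam i) :=
  Real.sqrt_pos.2 (D.lam_pos i)

theorem EigenData.inner_basis_b (D : EigenData Γ c) (i j : Fin n) :
    ⟪D.b i, D.b j⟫ = if i = j then 1 else 0 := orthonormal_iff_ite.1 D.b.orthonormal i j

/-- Creation is adjoint to annihilation: `inner_mulVec_gradV` is applied to another Hermite
function, whose gradient lowers its index. -/
theorem EigenData.inner_hv_raise (D : EigenData Γ c) (α β : Fin n → ℕ) (i : Fin n) :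
    ⟪D.hv (raise α i), D.hv β⟫ = β i * ⟪D.hv α, D.hv (lower β i)⟫ := by
  have h := D.inner_mulVec_gradV α i (D.hvV β)
  rw [D.gradV_hvV, inner_sum, Finset.sum_eq_single i] at h
  · rw [inner_smul_right, inner_mulVec_mulVec, D.inner_basis_b, if_pos rfl] at h
    have h0 := (D.sqrt_lam_pos i).ne'
    refine mul_left_cancel₀ h0 ?_
    rw [← D.valV_hvV β, ← h]; ring
  · intro j _ hj
    rw [inner_smul_right, inner_mulVec_mulVec, D.inner_basis_b, if_neg (Ne.symm hj)]; simp
  · simp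

/-- The normalisation constant `∫ e^{-φ}`. -/
def gaussMass (Γ : Matrix (Fin n) (Fin n) ℝ) (c : ℝ) : ℝ := ∫ x, Real.exp (-phi Γ c x)

theorem EigenData.integrable_gauss (D : EigenData Γ c) :
    Integrable fun x => Real.exp (-phi Γ c x) := by
  simpa using D.integrable_growth (Growth.const 1)

theorem EigenData.gaussMass_pos (D : EigenData Γ c) : 0 < gaussMass Γ c :=
  integral_exp_pos D.integrable_gauss

theorem EigenData.herm_zero (D : EigenData Γ c) (x : EuclideanSpace ℝ (Fin n)) :
    D.herm 0 x = 1 := by simp [EigenData.herm]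

/-- Indices are moved from `α` to `β` until one of them is exhausted; a surviving index on the other
side gives zero. The factors collected on the diagonal form the multi-index factorial. -/
theorem EigenData.inner_hv (D : EigenData Γ c) (α β : Fin n → ℕ) :
    ⟪D.hv α, D.hv β⟫ = if α = β then sqf α ^ 2 * gaussMass Γ c else 0 := by
  induction α using multiIndex_induction generalizing β with
  | h0 =>
    split_ifs with h
    · subst h
      rw [EigenData.hv, D.inner_vec_vec]
      simp [D.herm_zero, gaussMass]
    · obtain ⟨i, hi⟩ := Function.ne_iff.1 h
      have hi' : β i ≠ 0 := fun h => hi (by simp [h])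
      rw [real_inner_comm, ← raise_lower hi', D.inner_hv_raise]
      simp
  | hs α i ih =>
    rw [D.inner_hv_raise, ih]
    by_cases hβ : β i = 0
    · rw [hβ, if_neg (fun h : raise α i = β => by simp [← h] at hβ)]; simp
    · by_cases h : α = lower β i
      · have h2 : raise α i = β := by rw [h, raise_lower hβ]
        rw [if_pos h, if_pos h2, ← h2, sqf_raise, mul_pow, Real.sq_sqrt (by positivity)]
        simp; ring
      · rw [if_neg h, if_neg (fun h2 => h (by rw [← h2, lower_raise])), mul_zero]

/-! ### Exponential elements -/

theorem EigenData.smoothGrowth_exp (D : EigenData Γ c) (ξ : EuclideanSpace ℝ (Fin n)) :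
    D.SmoothGrowth (fun x => Real.exp ⟪ξ, x⟫) (fun i x => ⟪D.b i, ξ⟫ * Real.exp ⟪ξ, x⟫) := by
  refine ⟨Growth.exp_inner ξ, fun i => (Growth.exp_inner ξ).const_mul _,
    Real.contDiff_exp.comp (innerSL ℝ ξ).contDiff, fun x => ?_⟩
  refine ((innerSL ℝ ξ).hasFDerivAt (x := x)).exp.congr_fderiv ?_
  rw [show ∑ i, (⟪D.b i, ξ⟫ * Real.exp ⟪ξ, x⟫) • D.b i = Real.exp ⟪ξ, x⟫ • ξ by
    conv_rhs => rw [← D.b.sum_repr' ξ, Finset.smul_sum]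
    refine Finset.sum_congr rfl fun i _ => ?_
    rw [smul_smul, D.b.sum_repr' ξ, mul_comm], map_smul]
  rfl

/-- The element `e^{-φ + ξ·x}` of `𝔥`. -/
def EigenData.ev (D : EigenData Γ c) (ξ : EuclideanSpace ℝ (Fin n)) : FrakH Γ c :=
  D.vec (Growth.exp_inner ξ)

/-- The scaled coordinates `⟨b_i, ξ⟩ / √λ_i` of a dual variable. -/
def EigenData.dualCoord (D : EigenData Γ c) (ξ : EuclideanSpace ℝ (Fin n)) (i : Fin n) : ℝ :=
  ⟪D.b i, ξ⟫ / Real.sqrt (D.lam i)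

/-- Exponentials are eigenvectors of the gradient, so the adjoint relation trades each raised index
for one factor `dualCoord ξ i`. -/
theorem EigenData.inner_hv_raise_ev (D : EigenData Γ c) (α : Fin n → ℕ) (i : Fin n)
    (ξ : EuclideanSpace ℝ (Fin n)) :
    ⟪D.hv (raise α i), D.ev ξ⟫ = D.dualCoord ξ i * ⟪D.hv α, D.ev ξ⟫ := by
  have h := D.inner_mulVec_gradV α i (D.vecV (D.smoothGrowth_exp ξ))
  rw [D.gradV_vecV, inner_sum, Finset.sum_eq_single i] at h
  · rw [inner_mulVec_mulVec, D.inner_basis_b, if_pos rfl, mul_one,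
      D.vec_const_mul (Growth.exp_inner ξ) _ _ (fun _ => rfl), inner_smul_right,
      D.valV_vecV] at h
    have h0 := (D.sqrt_lam_pos i).ne'
    refine mul_left_cancel₀ h0 ?_
    rw [EigenData.ev, ← h, EigenData.dualCoord]
    field_simp
  · intro j _ hj
    rw [inner_mulVec_mulVec, D.inner_basis_b, if_neg (Ne.symm hj), mul_zero]
  · simp

/-- Completing the square identifies the integrand with a constant times the Gaussian centred at
`m`, and Lebesgue measure is translation invariant. -/
theorem EigenData.integral_exp_gauss (D : EigenData Γ c) (ξ : EuclideanSpace ℝ (Fin n)) :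
    ∫ x, Real.exp ⟪ξ, x⟫ * Real.exp (-phi Γ c x) =
      gaussMass Γ c * Real.exp (1 / 2 * ∑ i, D.dualCoord ξ i ^ 2) := by
  set m : EuclideanSpace ℝ (Fin n) := ∑ i, (⟪D.b i, ξ⟫ / D.lam i) • D.b i with hm
  have hbm : ∀ i, ⟪D.b i, m⟫ = ⟪D.b i, ξ⟫ / D.lam i := fun i =>
    D.b.orthonormal.inner_right_fintype (fun i => ⟪D.b i, ξ⟫ / D.lam i) i
  rw [gaussMass, ← integral_sub_right_eq_self (fun x => Real.exp (-phi Γ c x)) m,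
    ← integral_mul_const]
  refine integral_congr_ae (ae_of_all _ fun x => ?_)
  simp only
  rw [← Real.exp_add, ← Real.exp_add]
  congr 1
  have h1 : ⟪ξ, x⟫ = ∑ i, ⟪D.b i, ξ⟫ * ⟪D.b i, x⟫ := by
    rw [← D.b.sum_inner_mul_inner ξ x]
    exact Finset.sum_congr rfl fun i _ => by rw [real_inner_comm]
  rw [D.phi_eq, D.phi_eq, h1, ← sub_eq_zero]
  simp only [Finset.mul_sum, ← Finset.sum_neg_distrib, ← Finset.sum_add_distrib,
    ← Finset.sum_sub_distrib]
  refine Finset.sum_eq_zero fun i _ => ?_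
  have h0 := (D.lam_pos i).ne'
  rw [inner_sub_right, hbm, EigenData.dualCoord, div_pow, Real.sq_sqrt (D.lam_pos i).le]
  field_simp
  ring

theorem EigenData.inner_hv_ev (D : EigenData Γ c) (α : Fin n → ℕ)
    (ξ : EuclideanSpace ℝ (Fin n)) : ⟪D.hv α, D.ev ξ⟫ =
      (∏ i, D.dualCoord ξ i ^ α i) *
        (gaussMass Γ c * Real.exp (1 / 2 * ∑ i, D.dualCoord ξ i ^ 2)) := by
  induction α using multiIndex_induction with
  | h0 =>
    rw [EigenData.hv, EigenData.ev, D.inner_vec_vec, ← D.integral_exp_gauss]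
    simp [D.herm_zero]
  | hs α i ih =>
    rw [D.inner_hv_raise_ev, ih, ← mul_assoc]
    congr 1
    rw [← Finset.mul_prod_erase _ (fun j => D.dualCoord ξ j ^ α j) (Finset.mem_univ i),
      ← Finset.mul_prod_erase _ (fun j => D.dualCoord ξ j ^ raise α i j) (Finset.mem_univ i),
      raise_same, pow_succ, Finset.prod_congr rfl (s₁ := Finset.univ.erase i)
        (f := fun j => D.dualCoord ξ j ^ raise α i j) (g := fun j => D.dualCoord ξ j ^ α j)
        fun j hj => by rw [raise_of_ne α (Finset.ne_of_mem_erase hj)]]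
    ring

theorem EigenData.norm_ev_sq (D : EigenData Γ c) (ξ : EuclideanSpace ℝ (Fin n)) :
    ‖D.ev ξ‖ ^ 2 = gaussMass Γ c * Real.exp (2 * ∑ i, D.dualCoord ξ i ^ 2) := by
  rw [← real_inner_self_eq_norm_sq, EigenData.ev, D.inner_vec_vec]
  have := D.integral_exp_gauss ((2 : ℝ) • ξ)
  simp only [← Real.exp_add, inner_smul_left, conj_trivial, two_mul] at this ⊢
  rw [this]
  congr 2
  simp only [EigenData.dualCoord, ← two_mul, mul_pow, inner_smul_right,
    mul_div_assoc, ← Finset.mul_sum]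
  ring

/-! ### The Hermite basis of `𝔥` -/

/-- The normalised Hermite functions. -/
def EigenData.nv (D : EigenData Γ c) (α : Fin n → ℕ) : FrakH Γ c :=
  (sqf α * Real.sqrt (gaussMass Γ c))⁻¹ • D.hv α

theorem EigenData.sqrt_gaussMass_pos (D : EigenData Γ c) : 0 < Real.sqrt (gaussMass Γ c) :=
  Real.sqrt_pos.2 D.gaussMass_pos

theorem EigenData.hv_eq (D : EigenData Γ c) (α : Fin n → ℕ) :
    D.hv α = (sqf α * Real.sqrt (gaussMass Γ c)) • D.nv α := by
  rw [EigenData.nv, smul_smul, mul_inv_cancel₀, one_smul]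
  exact (mul_pos (sqf_pos α) D.sqrt_gaussMass_pos).ne'

theorem EigenData.orthonormal_nv (D : EigenData Γ c) : Orthonormal ℝ D.nv := by
  rw [orthonormal_iff_ite]
  intro α β
  rw [EigenData.nv, EigenData.nv, inner_smul_left, inner_smul_right, D.inner_hv]
  split_ifs with h
  · subst h
    have h1 := (sqf_pos α).ne'
    have h2 := D.sqrt_gaussMass_pos.ne'
    have h3 := Real.mul_self_sqrt D.gaussMass_pos.le
    simp only [conj_trivial]
    rw [← h3]
    field_simp
    simp
  · simp

/-- Parseval's identity for the single vector `ev ξ`, checked by hand through the exponential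
series. It places `ev ξ` in the closed span of the Hermite functions before completeness is known.
-/
theorem EigenData.hasSum_sq_inner_nv_ev (D : EigenData Γ c) (ξ : EuclideanSpace ℝ (Fin n)) :
    HasSum (fun α => ⟪D.nv α, D.ev ξ⟫ ^ 2) (‖D.ev ξ‖ ^ 2) := by
  have h := (hasSum_multiExp fun i => D.dualCoord ξ i ^ 2).mul_left
    (gaussMass Γ c * Real.exp (∑ i, D.dualCoord ξ i ^ 2))
  rw [D.norm_ev_sq, two_mul, Real.exp_add, ← mul_assoc]
  refine h.congr_fun fun α => ?_
  rw [EigenData.nv, inner_smul_left, D.inner_hv_ev, conj_trivial]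
  have h1 := (sqf_pos α).ne'
  have h3 := Real.sq_sqrt D.gaussMass_pos.le
  have h2 := D.gaussMass_pos.ne'
  have h4 : Real.exp (∑ i, D.dualCoord ξ i ^ 2) =
    Real.exp (1 / 2 * ∑ i, D.dualCoord ξ i ^ 2) ^ 2 := by
    rw [← Real.exp_nat_mul]; ring_nf
  rw [Finset.prod_div_distrib, ← sqf_sq, h4, mul_pow, inv_pow, mul_pow, mul_pow, mul_pow, h3,
    ← Finset.prod_pow]
  simp only [← pow_mul, mul_comm _ 2]
  field_simp

/-- Subtracting a finite Hermite sum from `ev ξ` does not change its pairing with `z`, while the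
norm of the remainder tends to zero by the Parseval identity above. -/
theorem EigenData.inner_ev_eq_zero (D : EigenData Γ c) {z : FrakH Γ c}
    (hz : ∀ α, ⟪D.nv α, z⟫ = 0) (ξ : EuclideanSpace ℝ (Fin n)) : ⟪D.ev ξ, z⟫ = 0 := by
  set E := D.ev ξ with hE
  have hon := D.orthonormal_nv
  have hbound : ∀ s : Finset (Fin n → ℕ),
      ⟪E, z⟫ ^ 2 ≤ (‖E‖ ^ 2 - ∑ α ∈ s, ⟪D.nv α, E⟫ ^ 2) * ‖z‖ ^ 2 := by
    intro s
    set p := ∑ α ∈ s, ⟪D.nv α, E⟫ • D.nv α with hp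
    have h1 : ⟪E, z⟫ = ⟪E - p, z⟫ := by
      rw [inner_sub_left, hp, sum_inner]
      simp [inner_smul_left, hz]
    have h2 : ⟪E, p⟫ = ∑ α ∈ s, ⟪D.nv α, E⟫ ^ 2 := by
      rw [hp, inner_sum]
      refine Finset.sum_congr rfl fun α _ => ?_
      rw [inner_smul_right, real_inner_comm, sq]
    have h3 : ‖p‖ ^ 2 = ∑ α ∈ s, ⟪D.nv α, E⟫ ^ 2 := by
      rw [← real_inner_self_eq_norm_sq, hp, hon.inner_sum]
      exact Finset.sum_congr rfl fun α _ => by rw [conj_trivial, sq]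
    have h4 : ‖E - p‖ ^ 2 = ‖E‖ ^ 2 - ∑ α ∈ s, ⟪D.nv α, E⟫ ^ 2 := by
      rw [norm_sub_sq_real, h2, h3]; ring
    rw [h1, ← h4, ← mul_pow, ← sq_abs]
    exact pow_le_pow_left₀ (abs_nonneg _) (abs_real_inner_le_norm _ _) 2
  have hlim := ((D.hasSum_sq_inner_nv_ev ξ).const_sub (‖E‖ ^ 2)).mul_const (‖z‖ ^ 2)
  rw [← hE, sub_self, zero_mul] at hlim
  have := ge_of_tendsto' hlim hbound
  exact pow_eq_zero_iff two_ne_zero |>.1 (le_antisymm this (sq_nonneg _))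

/-- The uniqueness theorem is for positive measures, so the negative part of `z dx` is moved to the
side of `ν`. -/
theorem EigenData.ae_nonneg_of_laplace (D : EigenData Γ c) (z : FrakH Γ c)
    (ν : Measure (EuclideanSpace ℝ (Fin n))) [IsFiniteMeasure ν]
    (hν : ∀ ξ : EuclideanSpace ℝ (Fin n), Integrable (fun x => Real.exp ⟪ξ, x⟫) ν)
    (h : ∀ ξ : EuclideanSpace ℝ (Fin n), ⟪D.ev ξ, z⟫ = ∫ x, Real.exp ⟪ξ, x⟫ ∂ν) :
    volume.withDensity (fun x => ENNReal.ofReal (z x)) =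
      volume.withDensity (fun x => ENNReal.ofReal (-z x)) + ν := by
  have hz : AEMeasurable (fun x => z x) volume :=
    (Lp.stronglyMeasurable z).measurable.aemeasurable
  have hz1 : Integrable fun x => z x := by
    simpa using D.integrable_growth_mul (Growth.const 1) z
  have hfin1 : IsFiniteMeasure (volume.withDensity fun x => ENNReal.ofReal (z x)) :=
    isFiniteMeasure_withDensity_ofReal hz1.2
  have hfin2 : IsFiniteMeasure (volume.withDensity fun x => ENNReal.ofReal (-z x)) :=
    isFiniteMeasure_withDensity_ofReal hz1.neg.2
  have hI : ∀ w : EuclideanSpace ℝ (Fin n) → ℝ, Measurable w → (∀ ξ : EuclideanSpace ℝ (Fin n),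
      Integrable fun x => Real.exp ⟪ξ, x⟫ * w x) → ∀ ξ : EuclideanSpace ℝ (Fin n),
      Integrable (fun x => Real.exp ⟪ξ, x⟫) (volume.withDensity fun x => ENNReal.ofReal (w x)) ∧
      ∫ x, Real.exp ⟪ξ, x⟫ ∂(volume.withDensity fun x => ENNReal.ofReal (w x)) =
        ∫ x, max (w x) 0 * Real.exp ⟪ξ, x⟫ := by
    intro w hw hint ξ
    have hm : Measurable fun x => ENNReal.ofReal (w x) := hw.ennreal_ofReal
    have hlt : ∀ᵐ x : EuclideanSpace ℝ (Fin n), ENNReal.ofReal (w x) < ⊤ :=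
      ae_of_all _ fun x => ENNReal.ofReal_lt_top
    constructor
    · rw [integrable_withDensity_iff_integrable_smul' hm hlt]
      refine (hint ξ).mono (by fun_prop) (ae_of_all _ fun x => ?_)
      simp only [smul_eq_mul, norm_mul, ENNReal.toReal_ofReal']
      rw [mul_comm]
      gcongr
      rw [Real.norm_eq_abs, Real.norm_eq_abs, abs_of_nonneg (le_max_right _ _)]
      exact max_le (le_abs_self _) (abs_nonneg _)
    · rw [integral_withDensity_eq_integral_toReal_smul hm hlt]
      simp only [ENNReal.toReal_ofReal', smul_eq_mul]
  have hzm : Measurable fun x => z x := (Lp.stronglyMeasurable z).measurable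
  have I1 := hI (fun x => z x) hzm fun ξ => D.integrable_growth_mul (Growth.exp_inner ξ) z
  have I2 := hI (fun x => -z x) hzm.neg fun ξ => by
    simpa using (D.integrable_growth_mul (Growth.exp_inner ξ) z).neg
  refine measure_ext_of_laplace (fun ξ => (I1 ξ).1) fun ξ => ?_
  rw [integral_add_measure (I2 ξ).1 (hν ξ), (I1 ξ).2, (I2 ξ).2, ← h ξ, EigenData.ev, D.inner_vec]
  have hmax : ∀ w : EuclideanSpace ℝ (Fin n) → ℝ, Measurable w → (∀ ξ : EuclideanSpace ℝ (Fin n),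
      Integrable fun x => Real.exp ⟪ξ, x⟫ * w x) →
      Integrable fun x => max (w x) 0 * Real.exp ⟪ξ, x⟫ := by
    intro w hw hint
    have h1 := ((hI w hw hint) ξ).1
    rw [integrable_withDensity_iff_integrable_smul' hw.ennreal_ofReal
      (ae_of_all _ fun x => ENNReal.ofReal_lt_top)] at h1
    simpa only [ENNReal.toReal_ofReal', smul_eq_mul] using h1
  rw [← integral_add (hmax (fun x => -z x) hzm.neg fun ξ => by
    simpa using (D.integrable_growth_mul (Growth.exp_inner ξ) z).neg)
    (D.integrable_growth_mul (Growth.exp_inner ξ) z)]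
  refine integral_congr_ae (ae_of_all _ fun x => ?_)
  simp only
  rcases le_total (z x) 0 with h | h
  · rw [max_eq_right h, max_eq_left (by linarith)]; ring
  · rw [max_eq_left h, max_eq_right (by linarith)]; ring

/-- On the set where `z < 0` the positive part carries no mass, so the preceding identity of
measures forces the negative part to vanish there as well. -/
theorem EigenData.ae_nonneg_of_laplace_eq (D : EigenData Γ c) (z : FrakH Γ c)
    (ν : Measure (EuclideanSpace ℝ (Fin n))) [IsFiniteMeasure ν]
    (hν : ∀ ξ : EuclideanSpace ℝ (Fin n), Integrable (fun x => Real.exp ⟪ξ, x⟫) ν)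
    (h : ∀ ξ : EuclideanSpace ℝ (Fin n), ⟪D.ev ξ, z⟫ = ∫ x, Real.exp ⟪ξ, x⟫ ∂ν) :
    ∀ᵐ x, 0 ≤ z x := by
  have heq := D.ae_nonneg_of_laplace z ν hν h
  have hzm : Measurable fun x => z x := (Lp.stronglyMeasurable z).measurable
  set s : Set (EuclideanSpace ℝ (Fin n)) := {x | z x < 0} with hs
  have hsm : MeasurableSet s := measurableSet_lt hzm measurable_const
  have h1 : (volume.withDensity fun x => ENNReal.ofReal (z x)) s = 0 := by
    rw [withDensity_apply _ hsm, setLIntegral_congr_fun (g := fun _ => 0) hsm fun x hx => by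
      exact ENNReal.ofReal_of_nonpos (le_of_lt hx)]
    simp
  have h2 : (volume.withDensity fun x => ENNReal.ofReal (-z x)) s = 0 := by
    rw [heq] at h1
    exact (add_eq_zero.1 h1).1
  have hzn : Measurable fun x => -z x := hzm.neg
  rw [withDensity_apply _ hsm, setLIntegral_eq_zero_iff hsm hzn.ennreal_ofReal] at h2
  filter_upwards [h2] with x hx
  by_contra hcon
  have := hx (not_le.1 hcon)
  rw [ENNReal.ofReal_eq_zero] at this
  linarith

/-- With `ν = 0` the sign criterion applies to both `z` and `-z`. This is the completeness of the
exponentials, and with `inner_ev_eq_zero` that of the Hermite functions. -/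
theorem EigenData.eq_zero_of_inner_ev (D : EigenData Γ c) {z : FrakH Γ c}
    (h : ∀ ξ, ⟪D.ev ξ, z⟫ = 0) : z = 0 := by
  have h1 := D.ae_nonneg_of_laplace_eq z 0 (fun _ => integrable_zero_measure) (by simpa using h)
  have h2 := D.ae_nonneg_of_laplace_eq (-z) 0 (fun _ => integrable_zero_measure)
    (by simpa using h)
  refine Lp.ext ?_
  refine weight_absolutelyContinuous.ae_le ?_
  filter_upwards [h1, h2, ae_weight_iff (Lp.coeFn_neg z),
    ae_weight_iff (Lp.coeFn_zero ℝ 2 (weight Γ c))] with x h1 h2 h3 h4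
  rw [h3, Pi.neg_apply] at h2
  rw [h4, Pi.zero_apply]
  linarith

/-- The Hermite basis of `𝔥`. -/
def EigenData.basis (D : EigenData Γ c) : HilbertBasis (Fin n → ℕ) ℝ (FrakH Γ c) :=
  HilbertBasis.mkOfOrthogonalEqBot D.orthonormal_nv (by
    rw [Submodule.eq_bot_iff]
    intro z hz
    refine D.eq_zero_of_inner_ev (D.inner_ev_eq_zero fun α => ?_)
    exact (Submodule.mem_orthogonal _ _).1 hz _ (Submodule.subset_span (mem_range_self α)))

@[simp] theorem EigenData.basis_apply (D : EigenData Γ c) (α : Fin n → ℕ) :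
    D.basis α = D.nv α := by
  rw [EigenData.basis, HilbertBasis.coe_mkOfOrthogonalEqBot]

end

/-! ### The form domain and the operators in Hermite coordinates -/

section

variable {n : ℕ} {Γ : Matrix (Fin n) (Fin n) ℝ} {c : ℝ}

/-! ### Hermite coordinates in `𝔙` -/

/-- The normalised Hermite functions as elements of `𝔙`. -/
def EigenData.nvV (D : EigenData Γ c) (α : Fin n → ℕ) : FrakV Γ c :=
  (sqf α * Real.sqrt (gaussMass Γ c))⁻¹ • D.hvV α

@[simp] theorem EigenData.valV_nvV (D : EigenData Γ c) (α : Fin n → ℕ) :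
    valV (D.nvV α) = D.nv α := rfl

theorem EigenData.gradV_nvV (D : EigenData Γ c) (α : Fin n → ℕ) : gradV (D.nvV α) =
    ∑ i, (Real.sqrt (D.lam i) * Real.sqrt (α i)) • mulVec (D.nv (lower α i)) (D.b i) := by
  have : gradV (D.nvV α) = (sqf α * Real.sqrt (gaussMass Γ c))⁻¹ • gradV (D.hvV α) := rfl
  rw [this, D.gradV_hvV, Finset.smul_sum]
  refine Finset.sum_congr rfl fun i _ => ?_
  rw [D.hv_eq, mulVec_smul_left, smul_smul, smul_smul]
  congr 1
  by_cases h : α i = 0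
  · simp [h]
  · rw [sqf_lower h]
    have h1 := (sqf_pos (lower α i)).ne'
    have h2 : Real.sqrt (α i : ℝ) ≠ 0 :=
      (Real.sqrt_pos.2 (by exact_mod_cast Nat.pos_of_ne_zero h)).ne'
    have h3 := D.sqrt_gaussMass_pos.ne'
    field_simp
    rw [Real.sq_sqrt (Nat.cast_nonneg _)]
    ring

theorem EigenData.inner_mulVec_nv_gradV (D : EigenData Γ c) (α : Fin n → ℕ) (i : Fin n)
    (z : FrakV Γ c) : ⟪mulVec (D.nv α) (D.b i), gradV z⟫ =
      Real.sqrt (D.lam i) * (Real.sqrt (α i + 1) * ⟪D.nv (raise α i), valV z⟫) := by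
  rw [EigenData.nv, mulVec_smul_left, inner_smul_left, D.inner_mulVec_gradV, D.hv_eq,
    inner_smul_left, sqf_raise]
  have h1 := (sqf_pos α).ne'
  have h3 := D.sqrt_gaussMass_pos.ne'
  simp only [conj_trivial]
  field_simp

/-- Lowering and then raising the `i`-th index restores `α` with the factor `λ_i α_i`; the Hermite
functions are therefore eigenvectors of the form. -/
theorem EigenData.form_nvV (D : EigenData Γ c) (z : FrakV Γ c) (α : Fin n → ℕ) :
    form z (D.nvV α) = wsum D.lam α * ⟪D.nv α, valV z⟫ := by
  rw [form, D.gradV_nvV, inner_sum, wsum, Finset.sum_mul]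
  refine Finset.sum_congr rfl fun i _ => ?_
  rw [inner_smul_right, real_inner_comm, D.inner_mulVec_nv_gradV]
  by_cases h : α i = 0
  · simp [h]
  · have e : ((lower α i i : ℕ) : ℝ) + 1 = α i := by
      rw [lower_same, ← Nat.cast_succ, Nat.succ_eq_add_one,
        Nat.sub_add_cancel (Nat.one_le_iff_ne_zero.2 h)]
    rw [raise_lower h, e]
    have h1 := Real.mul_self_sqrt (D.lam_pos i).le
    have h2 := Real.mul_self_sqrt (Nat.cast_nonneg (α := ℝ) (α i))
    linear_combination (⟪D.nv α, valV z⟫ * (Real.sqrt (α i) * Real.sqrt (α i))) * h1 +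
      (⟪D.nv α, valV z⟫ * D.lam i) * h2

theorem EigenData.lam_nonneg (D : EigenData Γ c) (i : Fin n) : 0 ≤ D.lam i := (D.lam_pos i).le

theorem EigenData.one_add_wsum_pos (D : EigenData Γ c) (α : Fin n → ℕ) :
    0 < 1 + wsum D.lam α := by linarith [wsum_nonneg D.lam_nonneg α]

theorem inner_frakV_comm (z w : FrakV Γ c) : form z w = form w z := real_inner_comm _ _

theorem EigenData.inner_nvV (D : EigenData Γ c) (z : FrakV Γ c) (α : Fin n → ℕ) :
    ⟪D.nvV α, z⟫ = (1 + wsum D.lam α) * ⟪D.nv α, valV z⟫ := by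
  rw [inner_frakV, inner_frakV_comm, D.form_nvV, D.valV_nvV]; ring

theorem valV_smul (r : ℝ) (z : FrakV Γ c) : valV (r • z) = r • valV z := rfl

theorem form_smul_left (r : ℝ) (z w : FrakV Γ c) : form (r • z) w = r * form z w := by
  have : gradV (r • z) = r • gradV z := rfl
  rw [form, this, inner_smul_left]; rfl

/-- The Hermite functions normalised in `𝔙`. -/
def EigenData.wv (D : EigenData Γ c) (α : Fin n → ℕ) : FrakV Γ c :=
  (Real.sqrt (1 + wsum D.lam α))⁻¹ • D.nvV α

theorem EigenData.inner_wv (D : EigenData Γ c) (z : FrakV Γ c) (α : Fin n → ℕ) :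
    ⟪D.wv α, z⟫ = Real.sqrt (1 + wsum D.lam α) * ⟪D.nv α, valV z⟫ := by
  have h0 := D.one_add_wsum_pos α
  have h1 := (Real.sqrt_pos.2 h0).ne'
  rw [EigenData.wv, inner_frakV, valV_smul, form_smul_left, inner_smul_left, conj_trivial,
    ← mul_add, ← inner_frakV, D.inner_nvV]
  have h2 := Real.mul_self_sqrt h0.le
  field_simp
  linear_combination (-⟪D.nv α, valV z⟫) * h2

theorem EigenData.inner_nv (D : EigenData Γ c) (α β : Fin n → ℕ) :
    ⟪D.nv α, D.nv β⟫ = if α = β then 1 else 0 := orthonormal_iff_ite.1 D.orthonormal_nv α β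

theorem EigenData.orthonormal_wv (D : EigenData Γ c) : Orthonormal ℝ D.wv := by
  rw [orthonormal_iff_ite]
  intro α β
  rw [D.inner_wv]
  have : valV (D.wv β) = (Real.sqrt (1 + wsum D.lam β))⁻¹ • D.nv β := rfl
  rw [this, inner_smul_right, D.inner_nv]
  split_ifs with h
  · subst h
    have h1 := (Real.sqrt_pos.2 (D.one_add_wsum_pos α)).ne'
    field_simp
  · simp

theorem eq_zero_of_inner_mulVec (D : EigenData Γ c) {G : FrakHn Γ c}
    (h : ∀ α i, ⟪mulVec (D.nv α) (D.b i), G⟫ = 0) : G = 0 := by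
  have hcomp : ∀ i, (innerSL ℝ (D.b i)).compLp G = 0 := by
    intro i
    refine hilbert_ext D.basis fun α => ?_
    rw [D.basis_apply, inner_zero_right, ← h α i, L2.inner_def, L2.inner_def]
    refine integral_congr_ae ?_
    filter_upwards [(innerSL ℝ (D.b i)).coeFn_compLp G, mulVec_ae (D.nv α) (D.b i)] with x h1 h2
    rw [h1, h2, inner_smul_left, innerSL_apply_apply]
    simp [mul_comm]
  refine Lp.ext ?_
  have h1 := ae_all_iff.2 fun i => (innerSL ℝ (D.b i)).coeFn_compLp G
  filter_upwards [h1, Lp.coeFn_zero ℝ 2 (weight Γ c),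
    Lp.coeFn_zero (EuclideanSpace ℝ (Fin n)) 2 (weight Γ c)] with x h1 h2 h3
  rw [h3, Pi.zero_apply, ← D.b.sum_repr' (G x)]
  refine Finset.sum_eq_zero fun i _ => ?_
  have := h1 i
  rw [hcomp i, h2, Pi.zero_apply, innerSL_apply_apply] at this
  rw [← this, zero_smul]

/-- The gradient stored in an element of `𝔙` is determined by the value, because its pairings with
all `nv α · b i` are coordinates of that value. -/
theorem frakV_eq_zero (D : EigenData Γ c) {z : FrakV Γ c} (h : valV z = 0) : z = 0 := by
  refine Subtype.ext ((WithLp.ofLp_injective 2) (Prod.ext h ?_))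
  exact eq_zero_of_inner_mulVec (G := gradV z) D fun α i => by
    rw [D.inner_mulVec_nv_gradV, h, inner_zero_right, mul_zero, mul_zero]

/-- The Hermite basis of `𝔙`. -/
def EigenData.basisV (D : EigenData Γ c) : HilbertBasis (Fin n → ℕ) ℝ (FrakV Γ c) :=
  HilbertBasis.mkOfOrthogonalEqBot D.orthonormal_wv (by
    rw [Submodule.eq_bot_iff]
    intro z hz
    refine frakV_eq_zero D (hilbert_ext D.basis fun α => ?_)
    have h1 := (Submodule.mem_orthogonal _ _).1 hz _ (Submodule.subset_span (mem_range_self α))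
    rw [D.inner_wv] at h1
    rw [D.basis_apply, inner_zero_right]
    exact (mul_eq_zero.1 h1).resolve_left (Real.sqrt_pos.2 (D.one_add_wsum_pos α)).ne')

@[simp] theorem EigenData.basisV_apply (D : EigenData Γ c) (α : Fin n → ℕ) :
    D.basisV α = D.wv α := by
  rw [EigenData.basisV, HilbertBasis.coe_mkOfOrthogonalEqBot]

theorem EigenData.exists_frakV (D : EigenData Γ c) {q : (Fin n → ℕ) → ℝ}
    (hq : Summable fun α => (1 + wsum D.lam α) * q α ^ 2) :
    ∃ z : FrakV Γ c, (∀ α, ⟪D.nv α, valV z⟫ = q α) ∧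
      ‖z‖ ^ 2 = ∑' α, (1 + wsum D.lam α) * q α ^ 2 := by
  have e : ∀ α, (Real.sqrt (1 + wsum D.lam α) * q α) ^ 2 = (1 + wsum D.lam α) * q α ^ 2 :=
    fun α => by rw [mul_pow, Real.sq_sqrt (D.one_add_wsum_pos α).le]
  obtain ⟨z, hz⟩ := exists_of_summable_sq D.basisV
    (q := fun α => Real.sqrt (1 + wsum D.lam α) * q α) (by simpa only [e] using hq)
  simp only [D.basisV_apply] at hz
  refine ⟨z, fun α => ?_, ?_⟩
  · have := hz α
    rw [D.inner_wv] at this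
    exact mul_left_cancel₀ (Real.sqrt_pos.2 (D.one_add_wsum_pos α)).ne' this
  · rw [← (hasSum_sq_coord D.basisV z).tsum_eq]
    exact tsum_congr fun α => by rw [D.basisV_apply, hz, e]

theorem EigenData.hasSum_frakV (D : EigenData Γ c) (z : FrakV Γ c) :
    HasSum (fun α => (1 + wsum D.lam α) * ⟪D.nv α, valV z⟫ ^ 2) (‖z‖ ^ 2) := by
  refine (hasSum_sq_coord D.basisV z).congr_fun fun α => ?_
  rw [D.basisV_apply, D.inner_wv, mul_pow, Real.sq_sqrt (D.one_add_wsum_pos α).le]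

theorem EigenData.clm_ext_nvV (D : EigenData Γ c) {Y : Type*} [NormedAddCommGroup Y]
    [NormedSpace ℝ Y] {f g : FrakV Γ c →L[ℝ] Y} (h : ∀ α, f (D.nvV α) = g (D.nvV α)) : f = g := by
  refine clm_ext_basis D.basisV fun α => ?_
  rw [D.basisV_apply, EigenData.wv, map_smul, map_smul, h]

/-! ### The operators in Hermite coordinates -/

theorem toHmHalf_apply (v : FrakH Γ c) (z : FrakV Γ c) : toHmHalf v z = ⟪v, valV z⟫ := rfl

theorem B1Half_apply (w : FrakHn Γ c) (z : FrakV Γ c) : B1Half w z = ⟪w, gradV z⟫ := rfl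

theorem norm_gradV_le (z : FrakV Γ c) : ‖gradV z‖ ≤ ‖z‖ :=
  WithLp.norm_snd_le _ (z : WithLp 2 (FrakH Γ c × FrakHn Γ c))

theorem norm_valV_le (z : FrakV Γ c) : ‖valV z‖ ≤ ‖z‖ :=
  WithLp.norm_fst_le _ (z : WithLp 2 (FrakH Γ c × FrakHn Γ c))

/-- `toHmHalf` as a continuous linear map. -/
def toHmHalfL (Γ : Matrix (Fin n) (Fin n) ℝ) (c : ℝ) : FrakH Γ c →L[ℝ] FrakHmHalf Γ c :=
  LinearMap.mkContinuous
    { toFun := toHmHalf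
      map_add' := fun v w => by
        ext z; simp only [toHmHalf_apply, inner_add_left, _root_.add_apply]
      map_smul' := fun r v => by
        ext z
        simp only [toHmHalf_apply, inner_smul_left, smul_apply, conj_trivial, smul_eq_mul,
          RingHom.id_apply] } 1 fun v => by
    rw [one_mul]
    refine ContinuousLinearMap.opNorm_le_bound _ (norm_nonneg _) fun z => ?_
    exact (norm_inner_le_norm (𝕜 := ℝ) v (valV z)).trans
      (mul_le_mul_of_nonneg_left (norm_valV_le z) (norm_nonneg _))

/-- `B1Half` as a continuous linear map. -/
def B1HalfL (Γ : Matrix (Fin n) (Fin n) ℝ) (c : ℝ) : FrakHn Γ c →L[ℝ] FrakHmHalf Γ c :=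
  LinearMap.mkContinuous
    { toFun := B1Half
      map_add' := fun v w => by
        ext z; simp only [B1Half_apply, inner_add_left, _root_.add_apply]
      map_smul' := fun r v => by
        ext z
        simp only [B1Half_apply, inner_smul_left, smul_apply, conj_trivial, smul_eq_mul,
          RingHom.id_apply] } 1 fun v => by
    rw [one_mul]
    refine ContinuousLinearMap.opNorm_le_bound _ (norm_nonneg _) fun z => ?_
    exact (norm_inner_le_norm (𝕜 := ℝ) v (gradV z)).trans
      (mul_le_mul_of_nonneg_left (norm_gradV_le z) (norm_nonneg _))

@[simp] theorem B1HalfL_apply (v : FrakHn Γ c) : B1HalfL Γ c v = B1Half v := rfl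

theorem EigenData.B1Half_mulVec_nvV (D : EigenData Γ c) (v : FrakH Γ c)
    (a : EuclideanSpace ℝ (Fin n)) (α : Fin n → ℕ) : B1Half (mulVec v a) (D.nvV α) =
      ∑ i, Real.sqrt (α i) * (Real.sqrt (D.lam i) * ⟪D.b i, a⟫) * ⟪D.nv (lower α i), v⟫ := by
  rw [B1Half_apply, D.gradV_nvV, inner_sum]
  refine Finset.sum_congr rfl fun i _ => ?_
  rw [inner_smul_right, inner_mulVec_mulVec, real_inner_comm v, real_inner_comm a]
  ring

/-- The eigenvalues `κ_i = c λ_i` of `Γ`. -/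
def EigenData.kap (D : EigenData Γ c) (i : Fin n) : ℝ := c * D.lam i

theorem EigenData.kap_pos (D : EigenData Γ c) (i : Fin n) : 0 < D.kap i :=
  mul_pos D.c_pos (D.lam_pos i)

theorem EigenData.wsum_kap (D : EigenData Γ c) (α : Fin n → ℕ) :
    wsum D.kap α = c * wsum D.lam α := by
  rw [wsum, wsum, Finset.mul_sum]
  exact Finset.sum_congr rfl fun i _ => by rw [EigenData.kap]; ring

theorem EigenData.wsum_kap_nonneg (D : EigenData Γ c) (α : Fin n → ℕ) : 0 ≤ wsum D.kap α :=
  wsum_nonneg (fun i => (D.kap_pos i).le) α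

/-- Forwards, the form is tested with Hermite functions. Backwards, the coordinate condition first
has to place `x` in `𝔙`; then both sides are continuous functionals on `𝔙` that agree on its Hermite
basis. -/
theorem EigenData.mem_opGraph_iff (D : EigenData Γ c) (x y : FrakH Γ c) :
    (x, y) ∈ opGraph Γ c ↔ ∀ α, ⟪D.nv α, y⟫ = wsum D.lam α * ⟪D.nv α, x⟫ := by
  change (∃ v : FrakV Γ c, valV v = x ∧ ∀ w : FrakV Γ c, form v w = ⟪y, valV w⟫) ↔ _
  constructor
  · rintro ⟨v, rfl, hv⟩ α
    have := hv (D.nvV α)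
    rw [D.form_nvV, D.valV_nvV] at this
    rw [real_inner_comm, ← this]
  · intro h
    obtain ⟨v, hv, -⟩ := D.exists_frakV (q := fun α => ⟪D.nv α, x⟫) (by
      have h1 := (hasSum_sq_coord D.basis x).summable.add (hasSum_sq_coord D.basis y).summable
      simp only [D.basis_apply, h] at h1
      -- Since `1 + w ≤ 2 (1 + w²)`, square summability of `x` and of `w x` gives the weighted
      -- summability that characterises `𝔙`.
      refine Summable.of_nonneg_of_le
        (fun α => mul_nonneg (D.one_add_wsum_pos α).le (sq_nonneg _)) (fun α => ?_)
        (h1.mul_left 2)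
      have : 0 ≤ (1 - wsum D.lam α) ^ 2 * ⟪D.nv α, x⟫ ^ 2 := by positivity
      have h0 : 0 ≤ (wsum D.lam α) ^ 2 * ⟪D.nv α, x⟫ ^ 2 := by positivity
      nlinarith [sq_nonneg ⟪D.nv α, x⟫])
    have hvx : valV v = x := hilbert_ext D.basis fun α => by rw [D.basis_apply, hv]
    refine ⟨v, hvx, fun w => ?_⟩
    have : B1Half (gradV v) = toHmHalf y := by
      refine D.clm_ext_nvV fun α => ?_
      rw [B1Half_apply, toHmHalf_apply, D.valV_nvV, real_inner_comm (D.nv α), h]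
      exact (D.form_nvV v α).trans (by rw [hvx])
    exact congrArg (fun f : FrakHmHalf Γ c => f w) this

theorem EigenData.isDiagonal (D : EigenData Γ c) :
    IsDiagonal D.basis (fpOp Γ c) (fun α => -wsum D.kap α) := by
  have hgraph : (frakA Γ c).graph = opGraph Γ c := by
    refine Submodule.toLinearPMap_graph_eq _ fun p hp hp0 => ?_
    have hxy := (D.mem_opGraph_iff p.1 p.2).1 hp
    exact hilbert_ext D.basis fun α => by rw [D.basis_apply, hxy, hp0]; simp
  intro x y
  rw [fpOp, LinearPMap.smul_graph, hgraph]
  simp only [D.basis_apply, D.wsum_kap]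
  have hc := D.c_pos.ne'
  constructor
  · rintro ⟨⟨x', y'⟩, h, heq⟩ α
    have h1 : x' = x := congrArg Prod.fst heq
    have h2 : (-c) • y' = y := congrArg Prod.snd heq
    subst h1 h2
    have := (D.mem_opGraph_iff _ _).1 h α
    rw [inner_smul_right, this]; ring
  · intro h
    refine ⟨(x, (-c)⁻¹ • y), (D.mem_opGraph_iff _ _).2 fun α => ?_, ?_⟩
    · rw [inner_smul_right, h]; field_simp
    · refine Prod.ext rfl ?_
      change (-c) • (-c)⁻¹ • y = y
      rw [smul_smul, mul_inv_cancel₀ (neg_ne_zero.2 hc), one_smul]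

theorem EigenData.neg_wsum_kap (D : EigenData Γ c) (α : Fin n → ℕ) : -wsum D.kap α ≤ 0 :=
  neg_nonpos.2 (D.wsum_kap_nonneg α)

theorem EigenData.inner_semigroup (D : EigenData Γ c) {t : ℝ} (ht : 0 ≤ t) (α : Fin n → ℕ)
    (x : FrakH Γ c) :
    ⟪D.nv α, semigroup (fpOp Γ c) t x⟫ = Real.exp (-t * wsum D.kap α) * ⟪D.nv α, x⟫ := by
  have := D.isDiagonal.inner_semigroup D.neg_wsum_kap ht α x
  rw [D.basis_apply] at this
  rw [this]; ring_nf

/-- The Riesz map `𝔥_{-1/2} → 𝔙`. -/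
def rieszInv (Γ : Matrix (Fin n) (Fin n) ℝ) (c : ℝ) : FrakHmHalf Γ c →L[ℝ] FrakV Γ c :=
  LinearMap.mkContinuous
    { toFun := (InnerProductSpace.toDual ℝ (FrakV Γ c)).symm
      map_add' := fun f g => map_add _ f g
      map_smul' := fun r f => by rw [map_smulₛₗ]; rfl } 1 fun f => by
    rw [one_mul]
    exact ((InnerProductSpace.toDual ℝ (FrakV Γ c)).symm.norm_map f).le

theorem inner_rieszInv (f : FrakHmHalf Γ c) (z : FrakV Γ c) : ⟪rieszInv Γ c f, z⟫ = f z :=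
  InnerProductSpace.toDual_symm_apply

/-- The Riesz isomorphism `𝔙 ≃ 𝔥_{-1/2}` composed with `(1 + c𝔄)⁻¹`, in coordinates. -/
theorem EigenData.exists_resolvent_half (D : EigenData Γ c) :
    ∃ Q : FrakHmHalf Γ c →L[ℝ] FrakH Γ c, ∀ f α,
      ⟪D.nv α, Q f⟫ = (1 + wsum D.kap α)⁻¹ * f (D.nvV α) := by
  obtain ⟨d, hd⟩ := exists_diagonal D.basis
    (d := fun α => (1 + wsum D.lam α) / (1 + wsum D.kap α)) (C := max 1 c⁻¹) fun α => by
      have h1 := D.one_add_wsum_pos α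
      have h2 := D.wsum_kap_nonneg α
      have hc := D.c_pos
      have h3 := wsum_nonneg D.lam_nonneg α
      rw [abs_of_nonneg (by positivity), div_le_iff₀ (by positivity), D.wsum_kap]
      have hm1 := le_max_left 1 c⁻¹
      have hm2 : 1 ≤ max 1 c⁻¹ * c := by
        calc (1 : ℝ) = c⁻¹ * c := (inv_mul_cancel₀ hc.ne').symm
          _ ≤ _ := mul_le_mul_of_nonneg_right (le_max_right _ _) hc.le
      nlinarith
  refine ⟨d ∘L (WithLp.fstL 2 ℝ (FrakH Γ c) (FrakHn Γ c)).comp (FrakV Γ c).subtypeL ∘L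
    rieszInv Γ c, fun f α => ?_⟩
  set z := rieszInv Γ c f with hz
  have h1 : f (D.nvV α) = (1 + wsum D.lam α) * ⟪D.nv α, valV z⟫ := by
    rw [← D.inner_nvV, real_inner_comm, hz, inner_rieszInv]
  have h2 := hd α (valV z)
  rw [D.basis_apply] at h2
  refine h2.trans ?_
  rw [h1]
  ring

/-- `halfToM1` is a choice, so an embedding is first exhibited through `Q`. The chosen one must
agree with it: both are continuous and coincide on the functionals coming from `𝔥`, which already
contain the Riesz images of the Hermite basis of `𝔙`. -/
theorem EigenData.inner_halfToM1 (D : EigenData Γ c) (f : FrakHmHalf Γ c) (α : Fin n → ℕ) :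
    ⟪D.nv α, resolventExt (fpOp Γ c) 1 (halfToM1 Γ c f)⟫ =
      (1 + wsum D.kap α)⁻¹ * f (D.nvV α) := by
  obtain ⟨Q, hQ⟩ := D.exists_resolvent_half
  let J := D.isDiagonal.extrapolationEquiv D.neg_wsum_kap one_pos
  have hJ : ∀ y, J y = resolventExt (fpOp Γ c) 1 y := fun _ => rfl
  have hcoord : ∀ v α, ⟪D.nv α, resolventAt (fpOp Γ c) 1 v⟫ =
      (1 + wsum D.kap α)⁻¹ * ⟪D.nv α, v⟫ := fun v α => by
    have := D.isDiagonal.inner_resolventAt D.neg_wsum_kap one_pos α v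
    rwa [D.basis_apply, sub_neg_eq_add] at this
  have hQv : ∀ v, Q (toHmHalf v) = resolventAt (fpOp Γ c) 1 v := fun v =>
    hilbert_ext D.basis fun α => by
      rw [D.basis_apply, hQ, hcoord, toHmHalf_apply, D.valV_nvV, real_inner_comm]
  have hex : ∃ j : FrakHmHalf Γ c →L[ℝ] FrakHm1 Γ c,
      ∀ v : FrakH Γ c, j (toHmHalf v) = toExtrapolation (fpOp Γ c) 1 v := by
    refine ⟨(J.symm : FrakH Γ c →L[ℝ] FrakHm1 Γ c) ∘L Q, fun v => ?_⟩
    rw [ContinuousLinearMap.comp_apply, hQv, ← resolventExt_toExtrapolation, ← hJ]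
    exact J.symm_apply_apply _
  have hj : ∀ v : FrakH Γ c, halfToM1 Γ c (toHmHalf v) = toExtrapolation (fpOp Γ c) 1 v := by
    rw [halfToM1, dif_pos hex]; exact hex.choose_spec
  -- The canonical embedding is determined on the dense range of the Riesz map.
  let S : FrakV Γ c →L[ℝ] FrakHmHalf Γ c :=
    toHmHalfL Γ c ∘L (WithLp.fstL 2 ℝ (FrakH Γ c) (FrakHn Γ c)).comp (FrakV Γ c).subtypeL +
      B1HalfL Γ c ∘L (WithLp.sndL 2 ℝ (FrakH Γ c) (FrakHn Γ c)).comp (FrakV Γ c).subtypeL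
  have hS : ∀ z w, S z w = ⟪z, w⟫ := fun z w => (inner_frakV z w).symm
  have hSinv : S (rieszInv Γ c f) = f := by
    ext z; rw [hS, inner_rieszInv]
  have heq : (resolventExt (fpOp Γ c) 1) ∘L (halfToM1 Γ c) ∘L S = Q ∘L S := by
    refine D.clm_ext_nvV fun α => ?_
    have : S (D.nvV α) = toHmHalf ((1 + wsum D.lam α) • D.nv α) := by
      ext z
      rw [hS, D.inner_nvV, toHmHalf_apply, inner_smul_left, conj_trivial]
    simp only [ContinuousLinearMap.comp_apply]
    rw [this, hj, hQv, resolventExt_toExtrapolation]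
  have := congrArg (fun F => F (rieszInv Γ c f)) heq
  simp only [ContinuousLinearMap.comp_apply, hSinv] at this
  rw [this, hQ]

end

/-! ### Uniform bounds, smoothing and continuity of the flow -/

section

variable {n : ℕ}

/-! ### Bounds for the flow in Hermite coordinates -/

/-- Every finite set of multi-indices lies in a box, so the box estimates of the flow pass to full
series. -/
theorem sum_le_of_box_le {f : (Fin n → ℕ) → ℝ} (hf : ∀ α, 0 ≤ f α) {K : ℝ}
    (h : ∀ A : Fin n → ℕ, ∑ α ∈ Finset.Iic A, f α ≤ K) (s : Finset (Fin n → ℕ)) :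
    ∑ α ∈ s, f α ≤ K := by
  refine (Finset.sum_le_sum_of_subset_of_nonneg (t := Finset.Iic (s.sup id)) ?_
    fun α _ _ => hf α).trans (h _)
  intro α hα
  exact Finset.mem_Iic.2 (Finset.le_sup (f := id) hα)

theorem summable_of_box_le {f : (Fin n → ℕ) → ℝ} (hf : ∀ α, 0 ≤ f α) {K : ℝ}
    (h : ∀ A : Fin n → ℕ, ∑ α ∈ Finset.Iic A, f α ≤ K) : Summable f ∧ ∑' α, f α ≤ K := by
  have h1 := sum_le_of_box_le hf h
  have hs := summable_of_sum_le hf h1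
  exact ⟨hs, hs.tsum_le_of_sum_le h1⟩

theorem flow_sub (κ : Fin n → ℝ) (m : Fin n → ℝ) (t : ℝ) (q r : (Fin n → ℕ) → ℝ)
    (α : Fin n → ℕ) : flow κ m t (fun β => q β - r β) α = flow κ m t q α - flow κ m t r α := by
  simp only [flow_eq_sum, mul_sub, Finset.sum_sub_distrib]

/-- The bound for the flow along translations with `|m i| ≤ M min(t,1)`. -/
def flowBound (κ : Fin n → ℝ) (M : ℝ) : ℝ :=
  Real.exp (∑ i, (M * (1 + κ i)) ^ 2 / (2 * κ i))

theorem flowBound_pos (κ : Fin n → ℝ) (M : ℝ) : 0 < flowBound κ M := Real.exp_pos _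

theorem decaySeq_sq_le {κ : Fin n → ℝ} (hκ : ∀ i, 0 < κ i) {t : ℝ} (ht : 0 ≤ t)
    (q : (Fin n → ℕ) → ℝ) (α : Fin n → ℕ) : decaySeq κ t q α ^ 2 ≤ q α ^ 2 := by
  rw [decaySeq, mul_pow]
  refine mul_le_of_le_one_left (sq_nonneg _) (pow_le_one₀ (Real.exp_pos _).le ?_)
  refine Real.exp_le_one_iff.2 ?_
  have := wsum_nonneg (fun i => (hκ i).le) α
  nlinarith

/-- For `t ≤ 1` the exponent of `sum_sq_flow_le` is of order `(M t)² / t ≤ M²`, which is why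
translations starting linearly at zero are admissible. -/
theorem sum_sq_flow_le_bound {κ : Fin n → ℝ} (hκ : ∀ i, 0 < κ i) {M : ℝ} (hM : 0 ≤ M)
    {m : Fin n → ℝ} {t : ℝ} (ht : 0 ≤ t) (hm : ∀ i, |m i| ≤ M * min t 1)
    (q : (Fin n → ℕ) → ℝ) (A : Fin n → ℕ) :
    ∑ α ∈ Finset.Iic A, flow κ m t q α ^ 2 ≤ flowBound κ M * ∑ α ∈ Finset.Iic A, q α ^ 2 := by
  have hq : ∀ r : (Fin n → ℕ) → ℝ, 0 ≤ ∑ α ∈ Finset.Iic A, r α ^ 2 :=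
    fun r => Finset.sum_nonneg fun _ _ => sq_nonneg _
  have hone : 1 ≤ flowBound κ M := Real.one_le_exp (Finset.sum_nonneg fun i _ => by
    have := hκ i; positivity)
  rcases ht.eq_or_lt with rfl | ht
  · have : m = 0 := funext fun i => by simpa using hm i
    subst this
    rw [flow_zero]
    exact le_mul_of_one_le_left (hq _) hone
  rcases le_or_gt t 1 with h1 | h1
  · refine (sum_sq_flow_le hκ m ht q A).trans (mul_le_mul_of_nonneg_right ?_ (hq _))
    refine Real.exp_le_exp.2 (Finset.sum_le_sum fun i _ => ?_)
    have hk := hκ i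
    have hmi := hm i
    rw [min_eq_left h1] at hmi
    calc (|m i| * (1 + κ i * t)) ^ 2 / (2 * κ i * t)
        ≤ (M * t * (1 + κ i * 1)) ^ 2 / (2 * κ i * t) := by gcongr
      _ = t * ((M * (1 + κ i)) ^ 2 / (2 * κ i)) := by field_simp
      _ ≤ 1 * ((M * (1 + κ i)) ^ 2 / (2 * κ i)) := by gcongr
      _ = _ := one_mul _
  -- Beyond time one all but the last unit of time is pure decay, a contraction; this keeps the
  -- constant independent of `t`.
  · have e : flow κ m t q = flow κ m 1 (decaySeq κ (t - 1) q) := by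
      rw [← flow_add]; ring_nf
    rw [e]
    refine (sum_sq_flow_le hκ m one_pos _ A).trans
      (mul_le_mul ?_ (Finset.sum_le_sum fun α _ => decaySeq_sq_le hκ (by linarith) q α) (hq _)
        (flowBound_pos κ M).le)
    refine Real.exp_le_exp.2 (Finset.sum_le_sum fun i _ => ?_)
    have hk := hκ i
    have hmi := hm i
    rw [min_eq_right h1.le, mul_one] at hmi
    simp only [mul_one]
    gcongr

/-- Termwise, `α_i q_α²` is the square of the annihilated sequence at `α - e_i`. Together with the
converse below, this makes the annihilation operators measure the `𝔙`-norm. -/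
theorem sum_mul_sq_le_annih (q : (Fin n → ℕ) → ℝ) (A : Fin n → ℕ) (i : Fin n) :
    ∑ α ∈ Finset.Iic A, (α i : ℝ) * q α ^ 2 ≤ ∑ α ∈ Finset.Iic A, annih i q α ^ 2 := by
  have h1 : ∑ α ∈ Finset.Iic A, (α i : ℝ) * q α ^ 2 =
      ∑ α ∈ Finset.Iic A, (if α i = 0 then 0 else annih i q (lower α i) ^ 2) := by
    refine Finset.sum_congr rfl fun α _ => ?_
    split_ifs with h
    · simp [h]
    · rw [annih, raise_lower h, mul_pow, Real.sq_sqrt (by positivity), lower_same,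
        Nat.cast_sub (Nat.one_le_iff_ne_zero.2 h)]
      simp
  rw [h1, sum_ite_zero_else, ← Finset.sum_image (g := fun α => lower α i)
    (f := fun β => annih i q β ^ 2)]
  · refine Finset.sum_le_sum_of_subset_of_nonneg ?_ fun _ _ _ => sq_nonneg _
    intro β hβ
    obtain ⟨α, hα, rfl⟩ := Finset.mem_image.1 hβ
    simp only [Finset.mem_filter, Finset.mem_Iic] at hα ⊢
    exact (lower_le α i).trans hα.1
  · intro α hα β hβ h
    simp only [Finset.coe_filter, mem_ofPred_eq] at hα hβ
    have := congrArg (fun γ => raise γ i) h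
    simpa [raise_lower hα.2, raise_lower hβ.2] using this

theorem sum_sq_annih_le (q : (Fin n → ℕ) → ℝ) (A : Fin n → ℕ) (i : Fin n) :
    ∑ α ∈ Finset.Iic A, annih i q α ^ 2 ≤
      ∑ α ∈ Finset.Iic (raise A i), (α i : ℝ) * q α ^ 2 := by
  have h1 : ∀ α : Fin n → ℕ, annih i q α ^ 2 = (raise α i i : ℝ) * q (raise α i) ^ 2 := fun α => by
    rw [annih, mul_pow, Real.sq_sqrt (by positivity), raise_same]; simp
  simp only [h1]
  rw [← Finset.sum_image (g := fun α => raise α i) (f := fun β => (β i : ℝ) * q β ^ 2)]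
  · refine Finset.sum_le_sum_of_subset_of_nonneg ?_ fun _ _ _ => by positivity
    intro β hβ
    obtain ⟨α, hα, rfl⟩ := Finset.mem_image.1 hβ
    simp only [Finset.mem_Iic] at hα ⊢
    intro j
    by_cases h : j = i
    · subst h; simpa using hα j
    · simpa [raise_of_ne _ h] using hα j
  · exact (raise_injective i).injOn

/-- By `annih_flow`, annihilation passes through the flow up to the bounded translation `m i`, so
derivative bounds reduce to bounds for the flow of `annih i q`. -/
theorem sum_sq_annih_flow_le {κ : Fin n → ℝ} (hκ : ∀ i, 0 < κ i) {M : ℝ} (hM : 0 ≤ M)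
    {m : Fin n → ℝ} {t : ℝ} (ht : 0 ≤ t) (hm : ∀ i, |m i| ≤ M * min t 1)
    (q : (Fin n → ℕ) → ℝ) (A : Fin n → ℕ) (i : Fin n) :
    ∑ α ∈ Finset.Iic A, annih i (flow κ m t q) α ^ 2 ≤
      2 * ∑ α ∈ Finset.Iic A, flow κ m t (annih i q) α ^ 2 +
      2 * M ^ 2 * flowBound κ M * ∑ α ∈ Finset.Iic A, q α ^ 2 := by
  have hmi : m i ^ 2 ≤ M ^ 2 := by
    rw [← sq_abs]
    exact pow_le_pow_left₀ (abs_nonneg _)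
      ((hm i).trans (mul_le_of_le_one_right hM (min_le_right _ _))) 2
  have hexp : Real.exp (-t * κ i) ^ 2 ≤ 1 := by
    refine pow_le_one₀ (Real.exp_pos _).le (Real.exp_le_one_iff.2 ?_)
    have := hκ i
    nlinarith
  calc ∑ α ∈ Finset.Iic A, annih i (flow κ m t q) α ^ 2
      ≤ ∑ α ∈ Finset.Iic A, (2 * flow κ m t (annih i q) α ^ 2 +
          2 * M ^ 2 * flow κ m t q α ^ 2) := by
        refine Finset.sum_le_sum fun α _ => ?_
        rw [annih_flow]
        have h1 := add_sq_le (a := Real.exp (-t * κ i) * flow κ m t (annih i q) α)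
          (b := m i * flow κ m t q α)
        rw [mul_pow, mul_pow] at h1
        have h2 := mul_le_mul_of_nonneg_right hmi (sq_nonneg (flow κ m t q α))
        have h3 := mul_le_mul_of_nonneg_right hexp (sq_nonneg (flow κ m t (annih i q) α))
        linarith
    _ ≤ _ := by
        rw [Finset.sum_add_distrib, ← Finset.mul_sum, ← Finset.mul_sum, mul_assoc (2 * M ^ 2)]
        have := sum_sq_flow_le_bound hκ hM ht hm q A
        gcongr

theorem mul_exp_neg_le {x : ℝ} : x * Real.exp (-x) ≤ 1 := by
  have h1 := Real.add_one_le_exp x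
  have h2 : Real.exp x * Real.exp (-x) = 1 := by rw [← Real.exp_add]; simp
  have h3 := (Real.exp_pos (-x)).le
  nlinarith

/-- The time is halved. The first half is pure decay, where `α_i e^{-κ_i t α_i} ≤ 1/(κ_i t)` pays
for the annihilation; the second half still makes the translation bounded. -/
theorem sum_sq_flow_annih_smoothing {κ : Fin n → ℝ} (hκ : ∀ i, 0 < κ i) {M : ℝ} (hM : 0 ≤ M)
    {m : Fin n → ℝ} {t : ℝ} (ht : 0 < t) (hm : ∀ i, |m i| ≤ M * min t 1)
    (q : (Fin n → ℕ) → ℝ) (A : Fin n → ℕ) (i : Fin n) {K : ℝ}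
    (hq : ∀ B : Fin n → ℕ, ∑ α ∈ Finset.Iic B, q α ^ 2 ≤ K) :
    ∑ α ∈ Finset.Iic A, flow κ m t (annih i q) α ^ 2 ≤
      flowBound κ (2 * M) * ((1 + 1 / (κ i * t)) * K) := by
  have e : flow κ m t (annih i q) = flow κ m (t / 2) (decaySeq κ (t / 2) (annih i q)) := by
    rw [← flow_add]; ring_nf
  -- The whole translation now has only half of the time available, so its constant doubles.
  have hm2 : ∀ i, |m i| ≤ 2 * M * min (t / 2) 1 := fun i => by
    refine (hm i).trans ?_
    have : min t 1 ≤ 2 * min (t / 2) 1 := by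
      rcases min_cases (t / 2) 1 with h | h
      · rw [h.1]; linarith [min_le_left t 1]
      · rw [h.1]; linarith [min_le_right t 1]
    nlinarith
  rw [e]
  refine (sum_sq_flow_le_bound hκ (by positivity) (by positivity) hm2 _ A).trans
    (mul_le_mul_of_nonneg_left ?_ (flowBound_pos _ _).le)
  have hki := hκ i
  have hterm : ∀ α, decaySeq κ (t / 2) (annih i q) α ^ 2 ≤
      (1 + 1 / (κ i * t)) * q (raise α i) ^ 2 := by
    intro α
    rw [decaySeq, annih, mul_pow, mul_pow, ← mul_assoc, Real.sq_sqrt (by positivity),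
      ← Real.exp_nat_mul]
    refine mul_le_mul_of_nonneg_right ?_ (sq_nonneg _)
    have h1 : κ i * α i ≤ wsum κ α :=
      Finset.single_le_sum (f := fun i => κ i * (α i : ℝ))
        (fun i _ => mul_nonneg (hκ i).le (Nat.cast_nonneg _)) (Finset.mem_univ i)
    have h2 : Real.exp (((2 : ℕ) : ℝ) * (-(t / 2) * wsum κ α)) ≤
        Real.exp (-(κ i * t * α i)) := by
      refine Real.exp_le_exp.2 ?_
      push_cast
      nlinarith
    have h3 : κ i * t * α i * Real.exp (-(κ i * t * α i)) ≤ 1 := mul_exp_neg_le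
    have h4 : Real.exp (-(κ i * t * α i)) ≤ 1 := Real.exp_le_one_iff.2 (by
      have : 0 ≤ κ i * t * α i := by positivity
      linarith)
    have h5 : (α i : ℝ) * Real.exp (-(κ i * t * α i)) ≤ 1 / (κ i * t) := by
      rw [le_div_iff₀ (by positivity)]; linarith
    calc Real.exp (((2 : ℕ) : ℝ) * (-(t / 2) * wsum κ α)) * ((α i : ℝ) + 1)
        ≤ Real.exp (-(κ i * t * α i)) * ((α i : ℝ) + 1) := by gcongr
      _ ≤ _ := by linarith
  refine (Finset.sum_le_sum fun α _ => hterm α).trans ?_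
  rw [← Finset.mul_sum]
  refine mul_le_mul_of_nonneg_left ?_ (by positivity)
  rw [← Finset.sum_image (g := fun α => raise α i) (f := fun β => q β ^ 2)]
  · exact sum_le_of_box_le (fun _ => sq_nonneg _) hq _
  · exact (raise_injective i).injOn

/-! ### The translated flow in `𝔥` -/

/-- A weight with finite sublevel sets makes the bounded set relatively compact: outside `{w ≤ N}`
the squared norm of a difference is at most `4K/N`, and inside there are finitely many continuous
coordinates. -/
theorem continuousOn_of_coord {ι X : Type*} [NormedAddCommGroup X]
    [InnerProductSpace ℝ X] (b : HilbertBasis ι ℝ X) {w : ι → ℝ}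
    (hfin : ∀ N : ℝ, {α | w α ≤ N}.Finite) {S : Set ℝ} {x : ℝ → X} {K : ℝ}
    (hK : ∀ t ∈ S, ∀ s : Finset ι, ∑ α ∈ s, w α * ⟪b α, x t⟫ ^ 2 ≤ K)
    (hc : ∀ α, ContinuousOn (fun t => ⟪b α, x t⟫) S) : ContinuousOn x S := by
  classical
  rcases S.eq_empty_or_nonempty with rfl | ⟨t₁, ht₁⟩
  · exact continuousOn_empty _
  have hK0 : 0 ≤ K := by simpa using hK t₁ ht₁ ∅
  have hbound : ∀ N : ℝ, 0 < N → ∀ t ∈ S, ∀ s ∈ S,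
      ‖x t - x s‖ ^ 2 ≤ ∑ α ∈ (hfin N).toFinset, ⟪b α, x t - x s⟫ ^ 2 + 4 * K / N := by
    intro N hN t ht s hs
    refine le_of_tendsto' (hasSum_sq_coord b (x t - x s)) fun F => ?_
    rw [← Finset.sum_filter_add_sum_filter_not F (fun α => w α ≤ N)]
    refine add_le_add ?_ ?_
    · refine Finset.sum_le_sum_of_subset_of_nonneg (fun α hα => ?_) fun _ _ _ => sq_nonneg _
      simpa using (Finset.mem_filter.1 hα).2
    · have hterm : ∀ α ∈ F.filter (fun α => ¬ w α ≤ N), ⟪b α, x t - x s⟫ ^ 2 ≤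
          N⁻¹ * (2 * (w α * ⟪b α, x t⟫ ^ 2) + 2 * (w α * ⟪b α, x s⟫ ^ 2)) := by
        intro α hα
        have hα' := not_le.1 (Finset.mem_filter.1 hα).2
        rw [inner_sub_right, inv_mul_eq_div, le_div_iff₀ hN]
        nlinarith [sq_nonneg (⟪b α, x t⟫ + ⟪b α, x s⟫), sq_nonneg ⟪b α, x t⟫,
          sq_nonneg ⟪b α, x s⟫, sq_nonneg (⟪b α, x t⟫ - ⟪b α, x s⟫)]
      refine (Finset.sum_le_sum hterm).trans ?_
      rw [← Finset.mul_sum, Finset.sum_add_distrib, ← Finset.mul_sum, ← Finset.mul_sum,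
        inv_mul_eq_div]
      refine div_le_div_of_nonneg_right ?_ hN.le
      linarith [hK t ht (F.filter fun α => ¬ w α ≤ N), hK s hs (F.filter fun α => ¬ w α ≤ N)]
  intro s hs
  have hlim : Tendsto (fun t => ‖x t - x s‖ ^ 2) (𝓝[S] s) (𝓝 0) := by
    rw [Metric.tendsto_nhds]
    intro ε hε
    set N := 8 * (K + 1) / ε with hN
    have hNpos : 0 < N := by positivity
    have h4 : 4 * K / N ≤ ε / 2 := by
      rw [hN, div_div_eq_mul_div, div_le_iff₀ (by positivity)]
      nlinarith
    have hsum : Tendsto (fun t => ∑ α ∈ (hfin N).toFinset, ⟪b α, x t - x s⟫ ^ 2) (𝓝[S] s)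
        (𝓝 0) := by
      have : Tendsto (fun t => ∑ α ∈ (hfin N).toFinset, ⟪b α, x t - x s⟫ ^ 2) (𝓝[S] s)
          (𝓝 (∑ α ∈ (hfin N).toFinset, (0 : ℝ) ^ 2)) := by
        refine tendsto_finsetSum _ fun α _ => ?_
        refine Tendsto.pow ?_ 2
        have := (hc α s hs).sub_const ⟪b α, x s⟫
        simpa only [inner_sub_right, sub_self] using this
      simpa using this
    filter_upwards [hsum.eventually (gt_mem_nhds (half_pos hε)), self_mem_nhdsWithin] with t h1 ht
    rw [Real.dist_eq, sub_zero, abs_of_nonneg (sq_nonneg _)]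
    linarith [hbound N hNpos t ht s hs]
  have h2 := hlim.sqrt
  simp only [Real.sqrt_sq (norm_nonneg _), Real.sqrt_zero] at h2
  exact tendsto_iff_norm_sub_tendsto_zero.2 h2

theorem continuousOn_flow {κ : Fin n → ℝ} {m : ℝ → Fin n → ℝ} {S : Set ℝ}
    (hm : ∀ i, ContinuousOn (fun t => m t i) S) (q : (Fin n → ℕ) → ℝ) (α : Fin n → ℕ) :
    ContinuousOn (fun t => flow κ (m t) t q α) S := by
  simp only [flow_eq_sum, shiftKer]
  fun_prop

theorem finite_wsum_le {κ : Fin n → ℝ} (hκ : ∀ i, 0 < κ i) (N : ℝ) :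
    {α | 1 + wsum κ α ≤ N}.Finite := by
  refine (Set.finite_Iic (fun i => ⌈N / κ i⌉₊)).subset fun α hα i => ?_
  have h1 : κ i * α i ≤ wsum κ α :=
    Finset.single_le_sum (f := fun i => κ i * (α i : ℝ))
      (fun i _ => mul_nonneg (hκ i).le (Nat.cast_nonneg _)) (Finset.mem_univ i)
  have h2 : (α i : ℝ) ≤ N / κ i := by
    rw [le_div_iff₀ (hκ i)]
    have : 1 + wsum κ α ≤ N := hα
    linarith
  exact_mod_cast h2.trans (Nat.le_ceil _)

variable {Γ : Matrix (Fin n) (Fin n) ℝ} {c : ℝ}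

/-- A translation path starting linearly at zero and bounded. -/
structure EigenData.IsPath (D : EigenData Γ c) (M : ℝ) (m : ℝ → Fin n → ℝ) : Prop where
  nonneg : 0 ≤ M
  bound : ∀ t, 0 ≤ t → ∀ i, |m t i| ≤ M * min t 1
  cont : ∀ i, ContinuousOn (fun t => m t i) (Ici 0)

theorem EigenData.sum_box_coord_le (D : EigenData Γ c) (p₀ : FrakH Γ c) (A : Fin n → ℕ) :
    ∑ α ∈ Finset.Iic A, ⟪D.nv α, p₀⟫ ^ 2 ≤ ‖p₀‖ ^ 2 := by
  simpa only [D.basis_apply] using sum_sq_coord_le D.basis p₀ (Finset.Iic A)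

theorem EigenData.exists_flow (D : EigenData Γ c) {M : ℝ} {m : ℝ → Fin n → ℝ}
    (hm : D.IsPath M m) (p₀ : FrakH Γ c) : ∃ p : ℝ → FrakH Γ c,
      (∀ t, 0 ≤ t → ∀ α, ⟪D.nv α, p t⟫ = flow D.kap (m t) t (fun β => ⟪D.nv β, p₀⟫) α) ∧
      ∀ t, ‖p t‖ ^ 2 ≤ flowBound D.kap M * ‖p₀‖ ^ 2 := by
  have : ∀ t : ℝ, ∃ x : FrakH Γ c,
      (0 ≤ t → ∀ α, ⟪D.nv α, x⟫ = flow D.kap (m t) t (fun β => ⟪D.nv β, p₀⟫) α) ∧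
      ‖x‖ ^ 2 ≤ flowBound D.kap M * ‖p₀‖ ^ 2 := by
    intro t
    by_cases ht : 0 ≤ t
    · obtain ⟨hs, hle⟩ := summable_of_box_le (fun α => sq_nonneg _) fun A =>
        (sum_sq_flow_le_bound D.kap_pos hm.nonneg ht (hm.bound t ht)
          (fun β => ⟪D.nv β, p₀⟫) A).trans
          (mul_le_mul_of_nonneg_left (D.sum_box_coord_le p₀ A) (flowBound_pos _ _).le)
      obtain ⟨x, hx⟩ := exists_of_summable_sq D.basis hs
      simp only [D.basis_apply] at hx
      refine ⟨x, fun _ => hx, ?_⟩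
      rw [← (hasSum_sq_coord D.basis x).tsum_eq]
      simpa only [D.basis_apply, hx] using hle
    · exact ⟨0, fun h => absurd h ht, by
        have := flowBound_pos D.kap M
        rw [norm_zero, zero_pow two_ne_zero]; exact mul_nonneg this.le (sq_nonneg _)⟩
  choose p hp using this
  exact ⟨p, fun t => (hp t).1, fun t => (hp t).2⟩

theorem EigenData.sum_weight_le (D : EigenData Γ c) {q : (Fin n → ℕ) → ℝ} {K : ℝ}
    {L : Fin n → ℝ} (A : Fin n → ℕ) (h0 : ∑ α ∈ Finset.Iic A, q α ^ 2 ≤ K)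
    (h1 : ∀ i, ∑ α ∈ Finset.Iic A, annih i q α ^ 2 ≤ L i) :
    ∑ α ∈ Finset.Iic A, (1 + wsum D.lam α) * q α ^ 2 ≤ K + ∑ i, D.lam i * L i := by
  have e : ∑ α ∈ Finset.Iic A, (1 + wsum D.lam α) * q α ^ 2 = ∑ α ∈ Finset.Iic A, q α ^ 2 +
      ∑ i, D.lam i * ∑ α ∈ Finset.Iic A, (α i : ℝ) * q α ^ 2 := by
    simp only [add_mul, one_mul, Finset.sum_add_distrib, Finset.mul_sum]
    congr 1
    rw [Finset.sum_comm]
    refine Finset.sum_congr rfl fun α _ => ?_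
    rw [wsum, Finset.sum_mul]
    exact Finset.sum_congr rfl fun i _ => by ring
  rw [e]
  refine add_le_add h0 (Finset.sum_le_sum fun i _ => mul_le_mul_of_nonneg_left
    ((sum_mul_sq_le_annih q A i).trans (h1 i)) (D.lam_nonneg i))

/-- The factor `1 + 1/t` is the squared `𝔙`-norm produced by the smoothing estimate; its square root
behaves like `t^{-1/2}` at zero, which limits the time regularity to `q < 2`. -/
theorem EigenData.exists_bound_smoothing (D : EigenData Γ c) (M : ℝ) : ∃ K : ℝ, 0 ≤ K ∧
    ∀ m, D.IsPath M m → ∀ p₀ : FrakH Γ c, ∀ t, 0 < t → ∀ A,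
      ∑ α ∈ Finset.Iic A, (1 + wsum D.lam α) *
        flow D.kap (m t) t (fun β => ⟪D.nv β, p₀⟫) α ^ 2 ≤ K * (1 + 1 / t) * ‖p₀‖ ^ 2 := by
  set C₁ := flowBound D.kap M with hC₁
  set C₂ := flowBound D.kap (2 * M) with hC₂
  have hC₁0 : 0 < C₁ := flowBound_pos _ _
  have hC₂0 : 0 < C₂ := flowBound_pos _ _
  have hlk : ∀ i, 0 ≤ D.lam i * (2 * C₂ * (1 + 1 / D.kap i) + 2 * M ^ 2 * C₁) := fun i => by
    have := D.lam_pos i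
    have := D.kap_pos i
    positivity
  refine ⟨C₁ + ∑ i, D.lam i * (2 * C₂ * (1 + 1 / D.kap i) + 2 * M ^ 2 * C₁), ?_, ?_⟩
  · exact add_nonneg hC₁0.le (Finset.sum_nonneg fun i _ => hlk i)
  intro m hm p₀ t ht A
  have hq := D.sum_box_coord_le p₀
  have hN : 0 ≤ ‖p₀‖ ^ 2 := by positivity
  have ht1 : 1 ≤ 1 + 1 / t := by have := one_div_pos.2 ht; linarith
  refine (D.sum_weight_le A (K := C₁ * ‖p₀‖ ^ 2)
    (L := fun i => (2 * C₂ * (1 + 1 / D.kap i) + 2 * M ^ 2 * C₁) * ((1 + 1 / t) * ‖p₀‖ ^ 2))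
    ?_ fun i => ?_).trans ?_
  · exact (sum_sq_flow_le_bound D.kap_pos hm.nonneg ht.le (hm.bound t ht.le) _ A).trans
      (mul_le_mul_of_nonneg_left (hq A) hC₁0.le)
  · refine (sum_sq_annih_flow_le D.kap_pos hm.nonneg ht.le (hm.bound t ht.le) _ A i).trans ?_
    have h1 := sum_sq_flow_annih_smoothing D.kap_pos hm.nonneg ht (hm.bound t ht.le)
      (fun β => ⟪D.nv β, p₀⟫) A i hq
    have hk := D.kap_pos i
    have h2 : 1 + 1 / (D.kap i * t) ≤ (1 + 1 / D.kap i) * (1 + 1 / t) := by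
      have : (1 + 1 / D.kap i) * (1 + 1 / t) = 1 + 1 / (D.kap i * t) + 1 / D.kap i + 1 / t := by
        field_simp; ring
      rw [this]
      have := one_div_pos.2 hk
      have := one_div_pos.2 ht
      linarith
    calc _ ≤ 2 * (C₂ * ((1 + 1 / (D.kap i * t)) * ‖p₀‖ ^ 2)) + 2 * M ^ 2 * C₁ * ‖p₀‖ ^ 2 := by
          have := hq A
          gcongr
      _ ≤ 2 * (C₂ * (((1 + 1 / D.kap i) * (1 + 1 / t)) * ‖p₀‖ ^ 2)) +
          2 * M ^ 2 * C₁ * ((1 + 1 / t) * ‖p₀‖ ^ 2) := by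
          have : ‖p₀‖ ^ 2 ≤ (1 + 1 / t) * ‖p₀‖ ^ 2 := le_mul_of_one_le_left hN ht1
          gcongr
      _ = _ := by ring
  · rw [add_mul C₁, add_mul (C₁ * _), Finset.sum_mul, Finset.sum_mul]
    refine add_le_add ?_ (Finset.sum_le_sum fun i _ => ?_)
    · rw [mul_assoc]
      exact mul_le_mul_of_nonneg_left (le_mul_of_one_le_left hN ht1) hC₁0.le
    · exact le_of_eq (by ring)

/-- For an initial value in `𝔙` the annihilated sequences are square summable already at time zero,
so no smoothing is used and no singularity appears. -/
theorem EigenData.exists_bound_frakV (D : EigenData Γ c) {M : ℝ} {m : ℝ → Fin n → ℝ}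
    (hm : D.IsPath M m) (z : FrakV Γ c) : ∃ K : ℝ, ∀ t, 0 ≤ t → ∀ A,
      ∑ α ∈ Finset.Iic A, (1 + wsum D.lam α) *
        flow D.kap (m t) t (fun β => ⟪D.nv β, valV z⟫) α ^ 2 ≤ K := by
  set C₁ := flowBound D.kap M with hC₁
  have hC₁0 : 0 < C₁ := flowBound_pos _ _
  set q : (Fin n → ℕ) → ℝ := fun β => ⟪D.nv β, valV z⟫ with hqdef
  have hq := D.sum_box_coord_le (valV z)
  have hV : ∀ i A, ∑ α ∈ Finset.Iic A, annih i q α ^ 2 ≤ (D.lam i)⁻¹ * ‖z‖ ^ 2 := by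
    intro i A
    refine (sum_sq_annih_le q A i).trans ?_
    rw [inv_mul_eq_div, le_div_iff₀ (D.lam_pos i), mul_comm, Finset.mul_sum]
    refine (Finset.sum_le_sum fun α _ => ?_).trans
      (sum_le_hasSum (Finset.Iic (raise A i)) (fun α _ => mul_nonneg (D.one_add_wsum_pos α).le
        (sq_nonneg _)) (D.hasSum_frakV z))
    rw [← mul_assoc]
    refine mul_le_mul_of_nonneg_right ?_ (sq_nonneg _)
    have h1 : D.lam i * α i ≤ wsum D.lam α :=
      Finset.single_le_sum (f := fun i => D.lam i * (α i : ℝ))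
        (fun i _ => mul_nonneg (D.lam_nonneg i) (Nat.cast_nonneg _)) (Finset.mem_univ i)
    linarith
  refine ⟨_, fun t ht A => D.sum_weight_le A (K := C₁ * ‖valV z‖ ^ 2)
    (L := fun i => 2 * (C₁ * ((D.lam i)⁻¹ * ‖z‖ ^ 2)) + 2 * M ^ 2 * C₁ * ‖valV z‖ ^ 2)
    ?_ fun i => ?_⟩
  · exact (sum_sq_flow_le_bound D.kap_pos hm.nonneg ht (hm.bound t ht) _ A).trans
      (mul_le_mul_of_nonneg_left (hq A) hC₁0.le)
  · refine (sum_sq_annih_flow_le D.kap_pos hm.nonneg ht (hm.bound t ht) _ A i).trans ?_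
    have h1 := (sum_sq_flow_le_bound D.kap_pos hm.nonneg ht (hm.bound t ht) (annih i q) A).trans
      (mul_le_mul_of_nonneg_left (hV i A) hC₁0.le)
    have := hq A
    gcongr

theorem EigenData.continuousOn_flow_frakV (D : EigenData Γ c) {M : ℝ} {m : ℝ → Fin n → ℝ}
    (hm : D.IsPath M m) (z : FrakV Γ c) {p : ℝ → FrakH Γ c}
    (hp : ∀ t, 0 ≤ t → ∀ α, ⟪D.nv α, p t⟫ = flow D.kap (m t) t (fun β => ⟪D.nv β, valV z⟫) α) :
    ContinuousOn p (Ici 0) := by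
  obtain ⟨K, hK⟩ := D.exists_bound_frakV hm z
  refine continuousOn_of_coord D.basis (w := fun α => 1 + wsum D.lam α)
    (finite_wsum_le D.lam_pos) (K := K) ?_ fun α => ?_
  · intro t ht s
    simp only [D.basis_apply, hp t ht]
    exact sum_le_of_box_le (fun α => mul_nonneg (D.one_add_wsum_pos α).le (sq_nonneg _))
      (hK t ht) s
  · refine (continuousOn_flow (κ := D.kap) hm.cont (fun β => ⟪D.nv β, valV z⟫) α).congr fun t ht => ?_
    rw [D.basis_apply, hp t ht]

theorem EigenData.denseRange_valV (D : EigenData Γ c) :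
    DenseRange (valV : FrakV Γ c → FrakH Γ c) := by
  have h1 : Dense ((Submodule.span ℝ (Set.range D.basis) : Submodule ℝ (FrakH Γ c)) :
      Set (FrakH Γ c)) := by
    rw [Submodule.dense_iff_topologicalClosure_eq_top]; exact D.basis.dense_span
  have h2 : Submodule.span ℝ (Set.range D.basis) ≤ LinearMap.range
      (((WithLp.fstL 2 ℝ (FrakH Γ c) (FrakHn Γ c)).comp (FrakV Γ c).subtypeL :
        FrakV Γ c →L[ℝ] FrakH Γ c) : FrakV Γ c →ₗ[ℝ] FrakH Γ c) := by
    rw [Submodule.span_le]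
    rintro _ ⟨α, rfl⟩
    exact ⟨D.nvV α, by rw [D.basis_apply]; rfl⟩
  exact h1.mono h2

/-- The flow is bounded uniformly in time, so trajectories issuing from the dense subspace `𝔙`,
which are continuous, approximate uniformly on the whole half-line. -/
theorem EigenData.continuousOn_flow_frakH (D : EigenData Γ c) {M : ℝ} {m : ℝ → Fin n → ℝ}
    (hm : D.IsPath M m) (p₀ : FrakH Γ c) {p : ℝ → FrakH Γ c}
    (hp : ∀ t, 0 ≤ t → ∀ α, ⟪D.nv α, p t⟫ = flow D.kap (m t) t (fun β => ⟪D.nv β, p₀⟫) α) :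
    ContinuousOn p (Ici 0) := by
  refine continuousOn_of_uniform_approx_of_continuousOn fun U hU => ?_
  obtain ⟨ε, hε, hεU⟩ := Metric.mem_uniformity_dist.1 hU
  set C := flowBound D.kap M with hC
  have hC0 : 0 < C := flowBound_pos _ _
  obtain ⟨z, hz⟩ := D.denseRange_valV.exists_dist_lt p₀ (ε := ε / Real.sqrt C)
    (div_pos hε (Real.sqrt_pos.2 hC0))
  obtain ⟨p₁, hp₁, -⟩ := D.exists_flow hm (valV z)
  refine ⟨p₁, D.continuousOn_flow_frakV hm z hp₁, fun t ht => hεU ?_⟩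
  have hle : ‖p t - p₁ t‖ ^ 2 ≤ C * ‖p₀ - valV z‖ ^ 2 := by
    rw [← (hasSum_sq_coord D.basis (p t - p₁ t)).tsum_eq]
    refine (summable_of_box_le (fun α => sq_nonneg _) fun A => ?_).2
    have h1 := (sum_sq_flow_le_bound D.kap_pos hm.nonneg ht (hm.bound t ht)
      (fun β => ⟪D.nv β, p₀⟫ - ⟪D.nv β, valV z⟫) A)
    simp only [flow_sub] at h1
    simp only [D.basis_apply, inner_sub_right, hp t ht, hp₁ t ht]
    refine h1.trans (mul_le_mul_of_nonneg_left ?_ hC0.le)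
    have := D.sum_box_coord_le (p₀ - valV z) A
    simpa only [inner_sub_right] using this
  rw [dist_eq_norm]
  rw [dist_eq_norm, lt_div_iff₀ (Real.sqrt_pos.2 hC0)] at hz
  refine lt_of_le_of_lt ?_ hz
  refine le_of_sq_le_sq ?_ (by positivity)
  rw [mul_pow, Real.sq_sqrt hC0.le, mul_comm]
  exact hle

end

/-! ### Absolute continuity and weak derivatives in time -/

section

variable {n : ℕ}

/-! ### Absolutely continuous functions on the half-line -/

theorem AbsolutelyContinuousOnInterval.const' (a : ℝ) (s t : ℝ) :
    AbsolutelyContinuousOnInterval (fun _ : ℝ => a) s t :=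
  (contDiff_const.contDiffOn (n := 1)).absolutelyContinuousOnInterval

/-- `f` is locally absolutely continuous on `[0,∞)`, with derivative `f'` almost everywhere. -/
structure HasACDeriv (f f' : ℝ → ℝ) : Prop where
  ac : ∀ T, 0 ≤ T → AbsolutelyContinuousOnInterval f 0 T
  deriv : ∀ᵐ t : ℝ, 0 < t → HasDerivAt f (f' t) t

namespace HasACDeriv

variable {f f' g g' : ℝ → ℝ}

theorem deriv_eq (h : HasACDeriv f f') {s t : ℝ} (hs : 0 ≤ s) (hst : s ≤ t) :
    ∀ᵐ x, x ∈ uIoc s t → _root_.deriv f x = f' x := by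
  filter_upwards [h.deriv] with x hx hx'
  rw [uIoc_of_le hst] at hx'
  exact (hx (hs.trans_lt hx'.1)).deriv

theorem intervalIntegrable (h : HasACDeriv f f') {t : ℝ} (ht : 0 ≤ t) :
    IntervalIntegrable f' volume 0 t :=
  (h.ac t ht).intervalIntegrable_deriv.congr_ae
    ((ae_restrict_iff' measurableSet_uIoc).2 (h.deriv_eq le_rfl ht))

theorem integral_eq (h : HasACDeriv f f') {t : ℝ} (ht : 0 ≤ t) :
    ∫ x in (0 : ℝ)..t, f' x = f t - f 0 := by
  rw [← (h.ac t ht).integral_deriv_eq_sub]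
  refine intervalIntegral.integral_congr_ae ?_
  filter_upwards [h.deriv_eq le_rfl ht] with x hx hx'
  exact (hx hx').symm

theorem continuousOn (h : HasACDeriv f f') : ContinuousOn f (Ici 0) := by
  intro t ht
  have ht0 : (0 : ℝ) ≤ t := ht
  have h1 := (h.ac (t + 1) (by linarith)).continuousOn t
    (by rw [uIcc_of_le (by linarith)]; exact ⟨ht0, by linarith⟩)
  refine h1.mono_of_mem_nhdsWithin ?_
  rw [uIcc_of_le (by linarith)]
  refine mem_nhdsWithin.2 ⟨Iio (t + 1), isOpen_Iio, by simp, fun x hx => ⟨hx.2, hx.1.le⟩⟩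

theorem add (hf : HasACDeriv f f') (hg : HasACDeriv g g') :
    HasACDeriv (fun t => f t + g t) (fun t => f' t + g' t) where
  ac T hT := (hf.ac T hT).add (hg.ac T hT)
  deriv := by
    filter_upwards [hf.deriv, hg.deriv] with t h1 h2 ht
    exact (h1 ht).add (h2 ht)

theorem mul (hf : HasACDeriv f f') (hg : HasACDeriv g g') :
    HasACDeriv (fun t => f t * g t) (fun t => f' t * g t + f t * g' t) where
  ac T hT := (hf.ac T hT).mul (hg.ac T hT)
  deriv := by
    filter_upwards [hf.deriv, hg.deriv] with t h1 h2 ht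
    exact (h1 ht).mul (h2 ht)

theorem of_contDiff (hf : ContDiff ℝ 1 f) : HasACDeriv f (_root_.deriv f) where
  ac _ _ := hf.contDiffOn.absolutelyContinuousOnInterval
  deriv := Eventually.of_forall fun t _ => (hf.differentiable (by simp) t).hasDerivAt

theorem const_mul (a : ℝ) (hf : HasACDeriv f f') :
    HasACDeriv (fun t => a * f t) (fun t => a * f' t) where
  ac T hT := (hf.ac T hT).const_mul a
  deriv := by
    filter_upwards [hf.deriv] with t h1 ht
    exact (h1 ht).const_mul a

theorem congr_deriv (hf : HasACDeriv f f') (h : ∀ t, 0 < t → f' t = g' t) : HasACDeriv f g' where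
  ac := hf.ac
  deriv := by
    filter_upwards [hf.deriv] with t h1 ht
    rw [← h t ht]
    exact h1 ht

theorem integral (h : ∀ T, 0 ≤ T → IntervalIntegrable f' volume 0 T) :
    HasACDeriv (fun t => ∫ x in (0 : ℝ)..t, f' x) f' where
  ac T hT := (h T hT).absolutelyContinuousOnInterval_intervalIntegral left_mem_uIcc
  deriv := by
    have : ∀ N : ℕ, ∀ᵐ t : ℝ, t ∈ uIcc (0 : ℝ) N →
        HasDerivAt (fun t => ∫ x in (0 : ℝ)..t, f' x) (f' t) t := fun N => by
      filter_upwards [(h N N.cast_nonneg).ae_hasDerivAt_integral] with t ht ht'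
      exact ht ht' 0 left_mem_uIcc
    filter_upwards [ae_all_iff.2 this] with t ht h0
    obtain ⟨N, hN⟩ := exists_nat_ge t
    exact ht N (by rw [uIcc_of_le (by positivity)]; exact ⟨h0.le, hN⟩)

/-- The product `θ f` is absolutely continuous and vanishes at both ends, as the support of `θ`
avoids them. -/
theorem integral_deriv_mul (hf : HasACDeriv f f') {θ : ℝ → ℝ} (hθ : ContDiff ℝ ∞ θ) {T : ℝ}
    (hT : 0 ≤ T) (hs : tsupport θ ⊆ Ioo 0 T) :
    ∫ t in Ioo 0 T, _root_.deriv θ t * f t = -∫ t in Ioo 0 T, θ t * f' t := by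
  have h1 := (of_contDiff (hθ.of_le (by simp))).mul hf
  have h2 := h1.integral_eq hT
  have h0 : θ 0 = 0 := image_eq_zero_of_notMem_tsupport fun h => (hs h).1.false
  have hT0 : θ T = 0 := image_eq_zero_of_notMem_tsupport fun h => (hs h).2.false
  rw [h0, hT0, zero_mul, zero_mul, sub_zero, intervalIntegral.integral_add] at h2
  · rw [← integral_Ioc_eq_integral_Ioo, ← integral_Ioc_eq_integral_Ioo,
      ← intervalIntegral.integral_of_le hT, ← intervalIntegral.integral_of_le hT]
    linarith
  · have hc : ContinuousOn f (uIcc 0 T) := (hf.ac T hT).continuousOn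
    refine ContinuousOn.intervalIntegrable ?_
    exact ((hθ.continuous_deriv (by simp)).continuousOn).mul hc
  · exact (hf.intervalIntegrable hT).continuousOn_mul hθ.continuous.continuousOn

end HasACDeriv

theorem AbsolutelyContinuousOnInterval.sum' {ι : Type*} (s : Finset ι) {f : ι → ℝ → ℝ} {a b : ℝ}
    (h : ∀ i ∈ s, AbsolutelyContinuousOnInterval (f i) a b) :
    AbsolutelyContinuousOnInterval (fun t => ∑ i ∈ s, f i t) a b := by
  classical
  induction s using Finset.induction_on with
  | empty => simpa using AbsolutelyContinuousOnInterval.const' 0 a b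
  | insert i s hi ih =>
    simp only [Finset.sum_insert hi]
    exact (h i (by simp)).add (ih fun j hj => h j (by simp [hj]))

theorem AbsolutelyContinuousOnInterval.prod' {ι : Type*} (s : Finset ι) {f : ι → ℝ → ℝ} {a b : ℝ}
    (h : ∀ i ∈ s, AbsolutelyContinuousOnInterval (f i) a b) :
    AbsolutelyContinuousOnInterval (fun t => ∏ i ∈ s, f i t) a b := by
  classical
  induction s using Finset.induction_on with
  | empty => simpa using AbsolutelyContinuousOnInterval.const' 1 a b
  | insert i s hi ih =>
    simp only [Finset.prod_insert hi]
    exact (h i (by simp)).mul (ih fun j hj => h j (by simp [hj]))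

theorem AbsolutelyContinuousOnInterval.pow' {f : ℝ → ℝ} {a b : ℝ}
    (h : AbsolutelyContinuousOnInterval f a b) (k : ℕ) :
    AbsolutelyContinuousOnInterval (fun t => f t ^ k) a b := by
  have := AbsolutelyContinuousOnInterval.prod' (Finset.range k) (f := fun _ => f) (fun _ _ => h)
  simpa using this

/-! ### Functions with weak derivative in `L^∞(0,∞)` -/

/-- The primitive vanishes to the left of the support of `h`, and to the right of it because the
total integral is zero. Compactness keeps the support away from the origin. -/
theorem exists_primitive_of_integral_eq_zero {h : ℝ → ℝ} (hh : ContDiff ℝ ∞ h)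
    (hs : HasCompactSupport h) (hsub : tsupport h ⊆ Ioi 0) (h0 : ∫ t in Ioi (0 : ℝ), h t = 0) :
    ∃ θ : ℝ → ℝ, ContDiff ℝ ∞ θ ∧ HasCompactSupport θ ∧ tsupport θ ⊆ Ioi 0 ∧ deriv θ = h := by
  have hK : IsCompact (tsupport h) := hs
  have hd : ∀ t, HasDerivAt (fun t => ∫ x in (0 : ℝ)..t, h x) (h t) t := fun t =>
    intervalIntegral.integral_hasDerivAt_right (hh.continuous.intervalIntegrable _ _)
      (hh.continuous.stronglyMeasurableAtFilter _ _) hh.continuous.continuousAt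
  have hderiv : deriv (fun t => ∫ x in (0 : ℝ)..t, h x) = h := funext fun t => (hd t).deriv
  obtain ⟨R, hR⟩ := hK.bddAbove
  have hpos : ∃ ε > 0, tsupport h ⊆ Ici ε := by
    rcases (tsupport h).eq_empty_or_nonempty with he | hne
    · exact ⟨1, one_pos, by simp [he]⟩
    · obtain ⟨ε, hε, hmin⟩ := hK.exists_isMinOn hne continuousOn_id
      exact ⟨ε, hsub hε, fun x hx => hmin hx⟩
  obtain ⟨ε, hε, hsubε⟩ := hpos
  have hzero : ∀ x, x < ε → h x = 0 := fun x hx =>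
    image_eq_zero_of_notMem_tsupport fun hx' => absurd (hsubε hx') (not_le.2 hx)
  have hzero' : ∀ x, R < x → h x = 0 := fun x hx =>
    image_eq_zero_of_notMem_tsupport fun hx' => absurd (hR hx') (not_le.2 hx)
  have hsupp : tsupport (fun t => ∫ x in (0 : ℝ)..t, h x) ⊆ Icc ε (max R 0) := by
    refine closure_minimal (fun t ht => ?_) isClosed_Icc
    by_contra hcon
    refine ht ?_
    rw [mem_Icc, not_and_or, not_le, not_le] at hcon
    rcases hcon with hcon | hcon
    · refine (intervalIntegral.integral_congr (g := fun _ => 0) fun x hx => hzero x ?_).trans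
        (by simp)
      exact lt_of_le_of_lt hx.2 (max_lt hε hcon)
    · have ht0 : 0 ≤ t := (le_max_right _ _).trans hcon.le
      change ∫ x in (0 : ℝ)..t, h x = 0
      rw [intervalIntegral.integral_of_le ht0]
      refine Eq.trans ?_ h0
      symm
      refine setIntegral_eq_of_subset_of_forall_sdiff_eq_zero measurableSet_Ioi
        Ioc_subset_Ioi_self fun x hx => hzero' x ?_
      have : t < x := by
        by_contra hx'
        exact hx.2 ⟨hx.1, not_lt.1 hx'⟩
      exact (le_max_left _ _).trans_lt (hcon.trans this)
  refine ⟨fun t => ∫ x in (0 : ℝ)..t, h x, ?_, ?_, ?_, hderiv⟩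
  · rw [contDiff_infty_iff_deriv, hderiv]
    exact ⟨fun t => (hd t).differentiableAt, hh⟩
  · exact isCompact_Icc.of_isClosed_subset (isClosed_tsupport _) hsupp
  · exact fun x hx => hε.trans_le (hsupp hx).1

/-- The lemma of du Bois-Reymond: a test function minus its integral times a fixed unit bump is the
derivative of a test function. Hence `g` equals its mean against that bump almost everywhere, and by
continuity everywhere, including at zero. -/
theorem eq_of_weakDeriv_eq_zero {g : ℝ → ℝ} (hg : ContinuousOn g (Ici 0))
    (h : ∀ θ : ℝ → ℝ, ContDiff ℝ ∞ θ → HasCompactSupport θ → tsupport θ ⊆ Ioi 0 →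
      ∫ t in Ioi 0, deriv θ t * g t = 0) {t : ℝ} (ht : 0 ≤ t) : g t = g 0 := by
  have hint : ∀ ψ : ℝ → ℝ, Continuous ψ → HasCompactSupport ψ → tsupport ψ ⊆ Ioi 0 →
      IntegrableOn (fun t => ψ t * g t) (Ioi 0) := by
    intro ψ hψ hs hsub
    have hK : IsCompact (tsupport ψ) := hs
    have h1 : IntegrableOn (fun t => ψ t * g t) (tsupport ψ) :=
      (hψ.continuousOn.mul (hg.mono (hsub.trans Ioi_subset_Ici_self))).integrableOn_compact hK
    refine IntegrableOn.of_forall_sdiff_eq_zero h1 measurableSet_Ioi fun x hx => ?_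
    rw [image_eq_zero_of_notMem_tsupport hx.2, zero_mul]
  -- Supported in `[1, 3]`, away from the boundary point zero.
  let ρ₀ : ContDiffBump (2 : ℝ) := ⟨1 / 2, 1, by norm_num, by norm_num⟩
  set ρ : ℝ → ℝ := ρ₀.normed volume with hρ
  have hρs : ContDiff ℝ ∞ ρ := ρ₀.contDiff_normed
  have hρc : HasCompactSupport ρ := ρ₀.hasCompactSupport_normed
  have hρsub : tsupport ρ ⊆ Ioi 0 := by
    rw [hρ, ρ₀.tsupport_normed_eq, Real.closedBall_eq_Icc]
    intro x hx
    have h1 : (2 : ℝ) - 1 ≤ x := hx.1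
    rw [mem_Ioi]
    linarith
  have hfull : ∀ ψ : ℝ → ℝ, tsupport ψ ⊆ Ioi 0 → ∫ t in Ioi (0 : ℝ), ψ t = ∫ t, ψ t := by
    intro ψ hsub
    refine setIntegral_eq_integral_of_forall_compl_eq_zero fun x hx => ?_
    exact image_eq_zero_of_notMem_tsupport fun hx' => hx (hsub hx')
  have hρ1 : ∫ t in Ioi (0 : ℝ), ρ t = 1 := by
    rw [hfull ρ hρsub]
    exact ρ₀.integral_normed
  set k := ∫ t in Ioi 0, ρ t * g t with hk
  have hae : ∀ᵐ x : ℝ, x ∈ Ioi (0 : ℝ) → g x - k = 0 := by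
    refine isOpen_Ioi.ae_eq_zero_of_integral_contDiff_smul_eq_zero ?_ fun ψ hψ hψc hψsub => ?_
    · exact ((hg.mono Ioi_subset_Ici_self).sub continuousOn_const).locallyIntegrableOn
        measurableSet_Ioi
    · have hψi : IntegrableOn ψ (Ioi 0) := (hψ.continuous.integrable_of_hasCompactSupport
        hψc).integrableOn
      have hρi : IntegrableOn ρ (Ioi 0) := (hρs.continuous.integrable_of_hasCompactSupport
        hρc).integrableOn
      set I := ∫ t in Ioi (0 : ℝ), ψ t with hI
      have hsub : tsupport (fun t => ψ t - I * ρ t) ⊆ Ioi 0 := by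
        refine (tsupport_sub _ _).trans (union_subset hψsub ?_)
        exact (tsupport_mul_subset_right (f := fun _ => I)).trans hρsub
      obtain ⟨θ, hθ, hθc, hθs, hθd⟩ := exists_primitive_of_integral_eq_zero
        (h := fun t => ψ t - I * ρ t) (hψ.sub (contDiff_const.mul hρs))
        (hψc.sub (hρc.mul_left (f := fun _ => I))) hsub (by
          rw [integral_sub hψi (hρi.const_mul I), integral_const_mul, hρ1]; simp [hI])
      have h2 := h θ hθ hθc hθs
      rw [hθd] at h2
      have i1 := hint ψ hψ.continuous hψc hψsub
      have i2 := hint ρ hρs.continuous hρc hρsub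
      have h3 : ∫ t in Ioi 0, ψ t * g t = I * k := by
        have e : ∀ t, (ψ t - I * ρ t) * g t = ψ t * g t - I * (ρ t * g t) := fun t => by ring
        simp only [e] at h2
        rw [integral_sub i1 (i2.const_mul I), integral_const_mul] at h2
        linarith
      rw [← hfull (fun x => ψ x • (g x - k)) ((tsupport_smul_subset_left _ _).trans hψsub)]
      simp only [smul_eq_mul, mul_sub]
      rw [integral_sub i1 (hψi.mul_const k), integral_mul_const, h3, sub_self]
  have hEq : EqOn g (fun _ => k) (Ici 0) := by
    refine Measure.eqOn_of_ae_eq (μ := volume) ?_ hg continuousOn_const (by simp)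
    rw [← restrict_Ioi_eq_restrict_Ici]
    refine (ae_restrict_iff' measurableSet_Ioi).2 ?_
    filter_upwards [hae] with x hx hx'
    linarith [hx hx']
  rw [hEq (mem_Ici.2 ht), hEq (mem_Ici.2 le_rfl)]

theorem bound_of_continuousOn_of_ae {E : Type*} [NormedAddCommGroup E] {f : ℝ → E}
    (hf : ContinuousOn f (Ici 0)) {B : ℝ} (h : ∀ᵐ t ∂(volume.restrict (Ioi (0 : ℝ))), ‖f t‖ ≤ B)
    {t : ℝ} (ht : 0 ≤ t) : ‖f t‖ ≤ B := by
  have hEq : EqOn (fun t => min ‖f t‖ B) (fun t => ‖f t‖) (Ici 0) := by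
    refine Measure.eqOn_of_ae_eq (μ := volume) ?_ (hf.norm.inf continuousOn_const) hf.norm
      (by simp)
    rw [← restrict_Ioi_eq_restrict_Ici]
    filter_upwards [h] with x hx
    exact min_eq_left hx
  exact min_eq_left_iff.1 (hEq (mem_Ici.2 ht))

theorem exists_bound_of_memLp_top {E : Type*} [NormedAddCommGroup E] {f : ℝ → E}
    {μ : Measure ℝ} (h : MemLp f ⊤ μ) : ∃ B : ℝ, 0 ≤ B ∧ ∀ᵐ t ∂μ, ‖f t‖ ≤ B := by
  refine ⟨(eLpNorm f ⊤ μ).toReal, ENNReal.toReal_nonneg, ?_⟩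
  have h2 := h.2
  rw [eLpNorm_exponent_top] at h2 ⊢
  filter_upwards [enorm_ae_le_eLpNormEssSup f μ] with t ht
  rw [← toReal_enorm]
  exact ENNReal.toReal_mono h2.ne ht

theorem intervalIntegrable_of_memLp_top {E : Type*} [NormedAddCommGroup E] {f : ℝ → E}
    (h : MemLp f ⊤ (volume.restrict (Ioi 0))) {s t : ℝ} (hs : 0 ≤ s) (ht : 0 ≤ t) :
    IntervalIntegrable f volume s t := by
  rw [intervalIntegrable_iff]
  have h1 : MemLp f ⊤ (volume.restrict (uIoc s t)) :=
    h.mono_measure (Measure.restrict_mono (fun x hx => (le_min hs ht).trans_lt hx.1) le_rfl)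
  have : IsFiniteMeasure (volume.restrict (uIoc s t)) := ⟨by simp [uIoc]⟩
  exact h1.integrable le_top

/-- The difference between the scalar component and the integral of its weak derivative is
continuous with zero weak derivative, hence constant. -/
theorem inner_eq_integral_of_memW1With {E : Type*} [NormedAddCommGroup E] [InnerProductSpace ℝ E]
    [CompleteSpace E] {f f' : ℝ → E} (hf : ContinuousOn f (Ici 0))
    (h : MemW1With ⊤ f f' (Ioi 0)) (b : E) {t : ℝ} (ht : 0 ≤ t) :
    ⟪b, f t⟫ = ⟪b, f 0⟫ + ∫ s in (0 : ℝ)..t, ⟪b, f' s⟫ := by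
  obtain ⟨h1, h2, -, -, h3⟩ := h
  have hb' : MemLp (fun t => ⟪b, f' t⟫) ⊤ (volume.restrict (Ioi 0)) :=
    (innerSL ℝ b).comp_memLp' h2
  have hF : HasACDeriv (fun t => ∫ s in (0 : ℝ)..t, ⟪b, f' s⟫) (fun t => ⟪b, f' t⟫) :=
    HasACDeriv.integral fun T hT => intervalIntegrable_of_memLp_top hb' le_rfl hT
  have hfc : ContinuousOn (fun t => ⟪b, f t⟫) (Ici 0) := continuousOn_const.inner hf
  have key : (⟪b, f t⟫ - ∫ s in (0 : ℝ)..t, ⟪b, f' s⟫) =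
      ⟪b, f 0⟫ - ∫ s in (0 : ℝ)..0, ⟪b, f' s⟫ := by
    refine eq_of_weakDeriv_eq_zero (g := fun t => ⟪b, f t⟫ - ∫ s in (0 : ℝ)..t, ⟪b, f' s⟫)
      (hfc.sub hF.continuousOn) (fun θ hθ hθc hθs => ?_) ht
    have hint : ∀ {X : Type _} [NormedAddCommGroup X] [NormedSpace ℝ X] {ψ : ℝ → ℝ} {v : ℝ → X},
        Continuous ψ → HasCompactSupport ψ → MemLp v ⊤ (volume.restrict (Ioi 0)) →
        IntegrableOn (fun t => ψ t • v t) (Ioi 0) := by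
      intro X _ _ ψ v hψ hψc hv
      have : MemLp ψ 1 (volume.restrict (Ioi 0)) :=
        memLp_one_iff_integrable.2 (hψ.integrable_of_hasCompactSupport hψc).integrableOn
      exact memLp_one_iff_integrable.1 (hv.smul this)
    have hθ' : Continuous (deriv θ) := hθ.continuous_deriv (by simp)
    have e1 : ∫ t in Ioi (0 : ℝ), deriv θ t * ⟪b, f t⟫ =
        -∫ t in Ioi (0 : ℝ), θ t * ⟪b, f' t⟫ := by
      have h4 := congrArg (fun v => ⟪b, v⟫) (h3 θ hθ hθc hθs)
      simp only [inner_neg_right] at h4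
      rw [← integral_inner (hint hθ' hθc.deriv h1), ← integral_inner (hint hθ.continuous hθc h2)]
        at h4
      simpa only [inner_smul_right] using h4
    obtain ⟨R, hR0, hR⟩ : ∃ R : ℝ, 0 ≤ R ∧ tsupport θ ⊆ Ioo 0 R := by
      obtain ⟨R, hR⟩ := (show IsCompact (tsupport θ) from hθc).bddAbove
      exact ⟨max R 0 + 1, by positivity, fun x hx => ⟨hθs hx,
        ((hR hx).trans (le_max_left _ _)).trans_lt (lt_add_one _)⟩⟩
    have e2 := hF.integral_deriv_mul hθ hR0 hR
    have cut : ∀ v w : ℝ → ℝ, (∀ x ∉ tsupport θ, v x = 0) →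
        ∫ t in Ioo 0 R, v t * w t = ∫ t in Ioi (0 : ℝ), v t * w t := by
      intro v w hv
      symm
      refine setIntegral_eq_of_subset_of_forall_sdiff_eq_zero measurableSet_Ioi
        Ioo_subset_Ioi_self fun x hx => ?_
      rw [hv x fun hx' => hx.2 (hR hx'), zero_mul]
    have hd0 : ∀ x ∉ tsupport θ, deriv θ x = 0 := fun x hx =>
      image_eq_zero_of_notMem_tsupport fun hx' => hx (tsupport_deriv_subset (𝕜 := ℝ) hx')
    rw [cut _ _ hd0, cut _ _ fun x hx => image_eq_zero_of_notMem_tsupport hx] at e2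
    simp only [mul_sub]
    rw [integral_sub, e1, e2, sub_self]
    · have := (hint hθ' hθc.deriv h1).const_inner (𝕜 := ℝ) b
      simpa only [inner_smul_right] using this
    · have hcomp : IntegrableOn (fun t => deriv θ t * ∫ s in (0 : ℝ)..t, ⟪b, f' s⟫) (tsupport θ) :=
        ((hθ'.continuousOn.mono (subset_univ _)).mul (hF.continuousOn.mono
          (hθs.trans Ioi_subset_Ici_self))).integrableOn_compact hθc
      refine IntegrableOn.of_forall_sdiff_eq_zero hcomp measurableSet_Ioi fun x hx => ?_
      rw [hd0 x hx.2, zero_mul]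
  rw [intervalIntegral.integral_same, sub_zero] at key
  linarith

end

/-! ### The mean path, the mild formulation and uniqueness -/

section

variable {n : ℕ} {Γ : Matrix (Fin n) (Fin n) ℝ} {c : ℝ}

/-! ### The mean path -/

/-- The data of a reference trajectory and its feedforward control. -/
structure IsReference (Γ : Matrix (Fin n) (Fin n) ℝ)
    (yref yref' u : ℝ → EuclideanSpace ℝ (Fin n)) : Prop where
  cont : ContinuousOn yref (Ici 0)
  mem : MemW1With ⊤ yref yref' (Ioi 0)
  control : ∀ t, u t = yref' t + act Γ (yref t)

/-- The shift of the mean value caused by the control, in scaled eigencoordinates. -/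
def EigenData.path (D : EigenData Γ c) (yref yref' : ℝ → EuclideanSpace ℝ (Fin n)) (t : ℝ)
    (i : Fin n) : ℝ :=
  Real.sqrt (D.lam i) * ((∫ s in (0 : ℝ)..t, ⟪D.b i, yref' s⟫) +
    (1 - Real.exp (-t * D.kap i)) * ⟪D.b i, yref 0⟫)

section Reference

variable {yref yref' u : ℝ → EuclideanSpace ℝ (Fin n)}

theorem IsReference.inner_eq (h : IsReference Γ yref yref' u) (b : EuclideanSpace ℝ (Fin n))
    {t : ℝ} (ht : 0 ≤ t) : ⟪b, yref t⟫ = ⟪b, yref 0⟫ + ∫ s in (0 : ℝ)..t, ⟪b, yref' s⟫ :=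
  inner_eq_integral_of_memW1With h.cont h.mem b ht

theorem IsReference.memLp_control (h : IsReference Γ yref yref' u) :
    MemLp u ⊤ (volume.restrict (Ioi 0)) := by
  have e : u = fun t => yref' t + LinearMap.toContinuousLinearMap (Matrix.toEuclideanLin Γ)
      (yref t) := funext fun t => h.control t
  rw [e]
  exact h.mem.2.1.add
    ((LinearMap.toContinuousLinearMap (Matrix.toEuclideanLin Γ)).comp_memLp' h.mem.1)

theorem IsReference.memLp_inner_deriv (h : IsReference Γ yref yref' u)
    (b : EuclideanSpace ℝ (Fin n)) :
    MemLp (fun t => ⟪b, yref' t⟫) ⊤ (volume.restrict (Ioi 0)) :=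
  (innerSL ℝ b).comp_memLp' h.mem.2.1

theorem EigenData.path_eq (D : EigenData Γ c) (h : IsReference Γ yref yref' u) {t : ℝ}
    (ht : 0 ≤ t) (i : Fin n) : D.path yref yref' t i = Real.sqrt (D.lam i) *
      (⟪D.b i, yref t⟫ - Real.exp (-t * D.kap i) * ⟪D.b i, yref 0⟫) := by
  rw [EigenData.path, h.inner_eq (D.b i) ht]; ring

/-- This is where the form of the feedforward control enters: in eigencoordinates `yref' + Γ yref`
is exactly what makes the explicit path solve the linear equation for the mean. -/
theorem EigenData.hasACDeriv_path (D : EigenData Γ c) (h : IsReference Γ yref yref' u)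
    (i : Fin n) : HasACDeriv (fun t => D.path yref yref' t i)
      (fun t => Real.sqrt (D.lam i) * ⟪D.b i, u t⟫ - D.kap i * D.path yref yref' t i) := by
  have h1 : HasACDeriv (fun t => ∫ s in (0 : ℝ)..t, ⟪D.b i, yref' s⟫) (fun t => ⟪D.b i, yref' t⟫) :=
    HasACDeriv.integral fun T hT =>
      intervalIntegrable_of_memLp_top (h.memLp_inner_deriv (D.b i)) le_rfl hT
  have h2 : HasACDeriv (fun t => (1 - Real.exp (-t * D.kap i)) * ⟪D.b i, yref 0⟫)
      (deriv fun t => (1 - Real.exp (-t * D.kap i)) * ⟪D.b i, yref 0⟫) :=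
    HasACDeriv.of_contDiff (by fun_prop)
  have hd : ∀ t, deriv (fun t => (1 - Real.exp (-t * D.kap i)) * ⟪D.b i, yref 0⟫) t =
      D.kap i * Real.exp (-t * D.kap i) * ⟪D.b i, yref 0⟫ := by
    intro t
    have h3 := (((((hasDerivAt_id t).neg).mul_const (D.kap i)).exp).const_sub 1).mul_const
      ⟪D.b i, yref 0⟫
    refine h3.deriv.trans ?_
    rw [Pi.neg_apply, id]
    ring
  refine ((h1.add h2).const_mul (Real.sqrt (D.lam i))).congr_deriv fun t ht => ?_
  rw [hd, D.path_eq h ht.le, h.control, inner_add_right, D.inner_act, EigenData.kap]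
  ring

/-- For `t ≤ 1` the bound on `yref'` gives linear growth; for `t ≥ 1` the integral is a difference
of two values of the bounded function `yref`. This is how `W^{1,∞}` enters. -/
theorem EigenData.exists_isPath (D : EigenData Γ c) (h : IsReference Γ yref yref' u) :
    ∃ M, D.IsPath M (D.path yref yref') := by
  obtain ⟨B₀, hB₀, h0⟩ := exists_bound_of_memLp_top h.mem.1
  obtain ⟨B₁, hB₁, h1⟩ := exists_bound_of_memLp_top h.mem.2.1
  have hy : ∀ t, 0 ≤ t → ‖yref t‖ ≤ B₀ := fun t ht => bound_of_continuousOn_of_ae h.cont h0 ht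
  have hin : ∀ (i : Fin n) (x : EuclideanSpace ℝ (Fin n)), |⟪D.b i, x⟫| ≤ ‖x‖ := fun i x => by
    have := abs_real_inner_le_norm (D.b i) x
    rwa [D.b.orthonormal.1 i, one_mul] at this
  have hint : ∀ (i : Fin n) (t : ℝ), 0 ≤ t → |∫ s in (0 : ℝ)..t, ⟪D.b i, yref' s⟫| ≤
      (B₁ + 2 * B₀) * min t 1 := by
    intro i t ht
    rcases le_total t 1 with ht1 | ht1
    · rw [min_eq_left ht1]
      have := intervalIntegral.norm_integral_le_of_norm_le_const_ae (a := 0) (b := t) (C := B₁)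
        (f := fun s => ⟪D.b i, yref' s⟫) (by
          filter_upwards [(ae_restrict_iff' measurableSet_Ioi).1 h1] with s hs hs'
          rw [uIoc_of_le ht] at hs'
          exact (hin i _).trans (hs hs'.1))
      rw [Real.norm_eq_abs, sub_zero, abs_of_nonneg ht] at this
      nlinarith
    · rw [min_eq_right ht1]
      have e := h.inner_eq (D.b i) ht
      have e1 := (hin i (yref t)).trans (hy t ht)
      have e2 := (hin i (yref 0)).trans (hy 0 le_rfl)
      rw [show (∫ s in (0 : ℝ)..t, ⟪D.b i, yref' s⟫) = ⟪D.b i, yref t⟫ - ⟪D.b i, yref 0⟫ by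
        linarith]
      have := abs_sub ⟪D.b i, yref t⟫ ⟪D.b i, yref 0⟫
      linarith
  have hexp : ∀ (i : Fin n) (t : ℝ), 0 ≤ t → |1 - Real.exp (-t * D.kap i)| ≤
      (D.kap i + 1) * min t 1 := by
    intro i t ht
    have hk := D.kap_pos i
    have e1 : Real.exp (-t * D.kap i) ≤ 1 := Real.exp_le_one_iff.2 (by nlinarith)
    have e2 := Real.add_one_le_exp (-t * D.kap i)
    have e3 := Real.exp_pos (-t * D.kap i)
    rw [abs_of_nonneg (by linarith)]
    rcases le_total t 1 with ht1 | ht1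
    · rw [min_eq_left ht1]; nlinarith
    · rw [min_eq_right ht1]; nlinarith
  have hK : ∀ i, 0 ≤ Real.sqrt (D.lam i) * ((B₁ + 2 * B₀) + (D.kap i + 1) * B₀) := fun i => by
    have := D.kap_pos i
    positivity
  refine ⟨∑ i, Real.sqrt (D.lam i) * ((B₁ + 2 * B₀) + (D.kap i + 1) * B₀),
    Finset.sum_nonneg fun i _ => hK i, fun t ht i => ?_, fun i => (D.hasACDeriv_path h i).continuousOn⟩
  have hmin : 0 ≤ min t 1 := le_min ht zero_le_one
  refine le_trans ?_ (mul_le_mul_of_nonneg_right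
    (Finset.single_le_sum (f := fun i => Real.sqrt (D.lam i) * ((B₁ + 2 * B₀) +
      (D.kap i + 1) * B₀)) (fun i _ => hK i) (Finset.mem_univ i)) hmin)
  rw [EigenData.path, abs_mul, abs_of_nonneg (Real.sqrt_nonneg _), mul_assoc]
  refine mul_le_mul_of_nonneg_left ?_ (Real.sqrt_nonneg _)
  refine (abs_add_le _ _).trans ?_
  rw [add_mul]
  refine add_le_add (hint i t ht) ?_
  rw [abs_mul, mul_right_comm]
  exact mul_le_mul (hexp i t ht) ((hin i _).trans (hy 0 le_rfl)) (abs_nonneg _)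
    (by have := D.kap_pos i; positivity)

/-- The `α`-th Hermite coordinate of `𝔅₁ (v · a)`. -/
def EigenData.force (D : EigenData Γ c) (a : EuclideanSpace ℝ (Fin n)) (q : (Fin n → ℕ) → ℝ)
    (α : Fin n → ℕ) : ℝ :=
  ∑ i, Real.sqrt (α i) * (Real.sqrt (D.lam i) * ⟪D.b i, a⟫) * q (lower α i)

/-- Each coordinate is a polynomial in the path with smooth coefficients, hence absolutely
continuous, although the path is differentiable only almost everywhere. -/
theorem EigenData.hasACDeriv_flow (D : EigenData Γ c) (h : IsReference Γ yref yref' u)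
    (q : (Fin n → ℕ) → ℝ) (α : Fin n → ℕ) :
    HasACDeriv (fun t => flow D.kap (D.path yref yref' t) t q α)
      (fun t => -wsum D.kap α * flow D.kap (D.path yref yref' t) t q α +
        D.force (u t) (flow D.kap (D.path yref yref' t) t q) α) where
  ac T hT := by
    simp only [flow_eq_sum, shiftKer]
    refine AbsolutelyContinuousOnInterval.sum' _ fun β _ => ?_
    have h1 : AbsolutelyContinuousOnInterval
        (fun t => ∏ i, ((α i).choose (β i) : ℝ) * D.path yref yref' t i ^ (α i - β i)) 0 T :=
      AbsolutelyContinuousOnInterval.prod' _ fun i _ =>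
        (AbsolutelyContinuousOnInterval.pow' ((D.hasACDeriv_path h i).ac T hT) _).const_mul _
    have h2 : AbsolutelyContinuousOnInterval
        (fun t => Real.exp (-t * wsum D.kap β) * (sqf β / sqf α * q β)) 0 T :=
      (ContDiff.contDiffOn (by fun_prop)).absolutelyContinuousOnInterval
    convert! h1.mul h2 using 2 with t
    simp only [Pi.mul_apply]
    ring
  deriv := by
    filter_upwards [ae_all_iff.2 fun i => (D.hasACDeriv_path h i).deriv] with t ht ht0
    refine (hasDerivAt_flow (fun i => ht i ht0) D.kap q α).congr_deriv ?_
    simp only [EigenData.force, sub_add_cancel]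

/-- Variation of constants, by integrating the derivative of `e^{-(t-s)μ} f(s)`. -/
theorem HasACDeriv.eq_duhamel {f g : ℝ → ℝ} {μ : ℝ}
    (h : HasACDeriv f fun t => -μ * f t + g t) {t : ℝ} (ht : 0 ≤ t) :
    f t = Real.exp (-t * μ) * f 0 + ∫ s in (0 : ℝ)..t, Real.exp (-(t - s) * μ) * g s := by
  have h1 : HasACDeriv (fun s => Real.exp (-(t - s) * μ))
      (_root_.deriv fun s => Real.exp (-(t - s) * μ)) := HasACDeriv.of_contDiff (by fun_prop)
  have hd : ∀ s, _root_.deriv (fun s => Real.exp (-(t - s) * μ)) s = μ * Real.exp (-(t - s) * μ) := by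
    intro s
    have h3 := ((((hasDerivAt_id s).const_sub t).neg).mul_const μ).exp
    refine h3.deriv.trans ?_
    simp only [id, Pi.neg_apply, neg_neg, one_mul]
    ring
  have h2 := ((h1.mul h).congr_deriv (g' := fun s => Real.exp (-(t - s) * μ) * g s)
    fun s _ => by rw [hd]; ring).integral_eq ht
  rw [h2]
  simp

/-! ### The mild formulation in Hermite coordinates -/

/-- The Hermite coordinates of an element of `𝔥₋₁`. -/
def EigenData.coordExt (D : EigenData Γ c) (α : Fin n → ℕ) : FrakHm1 Γ c →L[ℝ] ℝ :=
  (1 + wsum D.kap α) • (innerSL ℝ (D.nv α)).comp (resolventExt (fpOp Γ c) 1)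

theorem EigenData.coordExt_apply (D : EigenData Γ c) (α : Fin n → ℕ) (y : FrakHm1 Γ c) :
    D.coordExt α y = (1 + wsum D.kap α) * ⟪D.nv α, resolventExt (fpOp Γ c) 1 y⟫ := rfl

theorem EigenData.one_add_wsum_kap_pos (D : EigenData Γ c) (α : Fin n → ℕ) :
    0 < 1 + wsum D.kap α := by linarith [D.wsum_kap_nonneg α]

theorem EigenData.coordExt_toExtrapolation (D : EigenData Γ c) (α : Fin n → ℕ) (x : FrakH Γ c) :
    D.coordExt α (toExtrapolation (fpOp Γ c) 1 x) = ⟪D.nv α, x⟫ := by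
  have h := D.isDiagonal.inner_resolventAt D.neg_wsum_kap one_pos α x
  rw [D.basis_apply, sub_neg_eq_add] at h
  rw [D.coordExt_apply, resolventExt_toExtrapolation, h,
    mul_inv_cancel_left₀ (D.one_add_wsum_kap_pos α).ne']

theorem EigenData.coordExt_semigroupExt (D : EigenData Γ c) {t : ℝ} (ht : 0 ≤ t)
    (α : Fin n → ℕ) (y : FrakHm1 Γ c) : D.coordExt α (semigroupExt (fpOp Γ c) 1 t y) =
      Real.exp (-t * wsum D.kap α) * D.coordExt α y := by
  rw [D.coordExt_apply, D.coordExt_apply,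
    D.isDiagonal.resolventExt_semigroupExt D.neg_wsum_kap one_pos ht, D.inner_semigroup ht]
  ring

theorem EigenData.coordExt_B1 (D : EigenData Γ c) (α : Fin n → ℕ) (v : FrakH Γ c)
    (a : EuclideanSpace ℝ (Fin n)) :
    D.coordExt α (B1 (mulVec v a)) = D.force a (fun β => ⟪D.nv β, v⟫) α := by
  rw [D.coordExt_apply, B1, D.inner_halfToM1, D.B1Half_mulVec_nvV,
    mul_inv_cancel_left₀ (D.one_add_wsum_kap_pos α).ne', EigenData.force]

theorem EigenData.ext_coordExt (D : EigenData Γ c) {y z : FrakHm1 Γ c}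
    (h : ∀ α, D.coordExt α y = D.coordExt α z) : y = z := by
  refine resolventExt_injective (fpOp Γ c) 1 (hilbert_ext D.basis fun α => ?_)
  have := h α
  rw [D.coordExt_apply, D.coordExt_apply] at this
  rw [D.basis_apply]
  exact mul_left_cancel₀ (D.one_add_wsum_kap_pos α).ne' this

theorem toExtrapolation_zero (Γ : Matrix (Fin n) (Fin n) ℝ) (c : ℝ) :
    toExtrapolation (fpOp Γ c) 1 0 = 0 := rfl

/-- The integrand of the mild formulation. -/
def mildIntegrand (Γ : Matrix (Fin n) (Fin n) ℝ) (c : ℝ) (u : ℝ → EuclideanSpace ℝ (Fin n))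
    (p : ℝ → FrakH Γ c) (t s : ℝ) : FrakHm1 Γ c :=
  semigroupExt (fpOp Γ c) 1 (t - s)
    (B1 (mulVec (p s) (id (u s))) + toExtrapolation (fpOp Γ c) 1 ((0 : ℝ → FrakH Γ c) s))

theorem EigenData.coordExt_mildIntegrand (D : EigenData Γ c) (p : ℝ → FrakH Γ c) {t s : ℝ}
    (hs : s ≤ t) (α : Fin n → ℕ) : D.coordExt α (mildIntegrand Γ c u p t s) =
      Real.exp (-(t - s) * wsum D.kap α) * D.force (u s) (fun β => ⟪D.nv β, p s⟫) α := by
  rw [mildIntegrand, D.coordExt_semigroupExt (by linarith), Pi.zero_apply, toExtrapolation_zero,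
    add_zero, D.coordExt_B1, id]

theorem norm_mulVec_le (v : FrakH Γ c) (a : EuclideanSpace ℝ (Fin n)) :
    ‖mulVec v a‖ ≤ ‖v‖ * ‖a‖ := by
  have := (ContinuousLinearMap.toSpanSingleton ℝ a).norm_compLp_le v
  rwa [ContinuousLinearMap.norm_toSpanSingleton, mul_comm] at this

/-- Through the isometry with `𝔥`, measurability is checked coordinate by coordinate. For the size,
the semigroup shrinks every coordinate, so the norm is at most that of the image of `p(s) u(s)`
under a fixed bounded operator. -/
theorem EigenData.intervalIntegrable_mildIntegrand (D : EigenData Γ c)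
    (hu : MemLp u ⊤ (volume.restrict (Ioi 0))) {p : ℝ → FrakH Γ c} {t : ℝ} (ht : 0 ≤ t)
    (hp : ContinuousOn p (Icc 0 t)) :
    IntervalIntegrable (mildIntegrand Γ c u p t) volume 0 t := by
  set J := D.isDiagonal.extrapolationEquiv D.neg_wsum_kap one_pos with hJ
  have hcoord : ∀ s ≤ t, ∀ α, ⟪D.basis α, J (mildIntegrand Γ c u p t s)⟫ =
      (1 + wsum D.kap α)⁻¹ *
        (Real.exp (-(t - s) * wsum D.kap α) * D.force (u s) (fun β => ⟪D.nv β, p s⟫) α) := by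
    intro s hs α
    rw [← D.coordExt_mildIntegrand p hs, D.coordExt_apply,
      inv_mul_cancel_left₀ (D.one_add_wsum_kap_pos α).ne', D.basis_apply]
    rfl
  rw [intervalIntegrable_iff, uIoc_of_le ht]
  have hu' : MemLp u ⊤ (volume.restrict (Ioc 0 t)) :=
    hu.mono_measure (Measure.restrict_mono Ioc_subset_Ioi_self le_rfl)
  have hpm : AEStronglyMeasurable p (volume.restrict (Ioc 0 t)) :=
    (hp.mono Ioc_subset_Icc_self).aestronglyMeasurable measurableSet_Ioc
  have hmeas : AEStronglyMeasurable (fun s => J (mildIntegrand Γ c u p t s))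
      (volume.restrict (Ioc 0 t)) := by
    refine aestronglyMeasurable_of_coord D.basis fun α => ?_
    have h1 : AEStronglyMeasurable (fun s => (1 + wsum D.kap α)⁻¹ *
        (Real.exp (-(t - s) * wsum D.kap α) * D.force (u s) (fun β => ⟪D.nv β, p s⟫) α))
        (volume.restrict (Ioc 0 t)) := by
      unfold EigenData.force
      refine AEStronglyMeasurable.mul aestronglyMeasurable_const (AEStronglyMeasurable.mul
        (by fun_prop) (Finset.aestronglyMeasurable_fun_sum _ fun i _ => ?_))
      have h2 : AEStronglyMeasurable (fun s => ⟪D.b i, u s⟫) (volume.restrict (Ioc 0 t)) :=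
        aestronglyMeasurable_const.inner hu'.1
      have h3 : AEStronglyMeasurable (fun s => ⟪D.nv (lower α i), p s⟫)
          (volume.restrict (Ioc 0 t)) := aestronglyMeasurable_const.inner hpm
      exact (aestronglyMeasurable_const.mul (aestronglyMeasurable_const.mul h2)).mul h3
    refine h1.congr ?_
    filter_upwards [ae_restrict_mem measurableSet_Ioc] with s hs
    rw [hcoord s hs.2]
  obtain ⟨B, hB, hBu⟩ := exists_bound_of_memLp_top hu'
  obtain ⟨P, hP⟩ := isCompact_Icc.exists_bound_of_continuousOn hp
  set G : FrakHn Γ c →L[ℝ] FrakH Γ c :=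
    ((resolventExt (fpOp Γ c) 1).comp (halfToM1 Γ c)).comp (B1HalfL Γ c) with hG
  have hbound : ∀ᵐ s ∂(volume.restrict (Ioc 0 t)),
      ‖J (mildIntegrand Γ c u p t s)‖ ≤ 1 * (‖G‖ * (P * B)) := by
    filter_upwards [hBu, ae_restrict_mem measurableSet_Ioc] with s hus hs
    have hle : ‖J (mildIntegrand Γ c u p t s)‖ ≤ 1 * ‖G (mulVec (p s) (u s))‖ := by
      refine norm_le_of_coord_le D.basis zero_le_one fun α => ?_
      have hg : ⟪D.basis α, G (mulVec (p s) (u s))⟫ = (1 + wsum D.kap α)⁻¹ *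
          D.force (u s) (fun β => ⟪D.nv β, p s⟫) α := by
        rw [D.basis_apply, hG]
        simp only [ContinuousLinearMap.comp_apply, B1HalfL_apply]
        rw [D.inner_halfToM1, D.B1Half_mulVec_nvV, EigenData.force]
      rw [hcoord s hs.2, hg, one_mul, abs_mul, abs_mul, abs_mul]
      refine mul_le_mul_of_nonneg_left ?_ (abs_nonneg _)
      refine mul_le_of_le_one_left (abs_nonneg _) ?_
      rw [abs_of_pos (Real.exp_pos _), Real.exp_le_one_iff]
      have := D.wsum_kap_nonneg α
      nlinarith [hs.2]
    refine hle.trans (mul_le_mul_of_nonneg_left ((G.le_opNorm _).trans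
      (mul_le_mul_of_nonneg_left ?_ (norm_nonneg _))) zero_le_one)
    refine (norm_mulVec_le _ _).trans ?_
    have := hP s (Ioc_subset_Icc_self hs)
    exact mul_le_mul this hus (norm_nonneg _) ((norm_nonneg _).trans this)
  have hint : IntegrableOn (fun s => J (mildIntegrand Γ c u p t s)) (Ioc 0 t) :=
    ⟨hmeas, HasFiniteIntegral.restrict_of_bounded (C := 1 * (‖G‖ * (P * B))) (by simp) hbound⟩
  have := (J.symm : FrakH Γ c →L[ℝ] FrakHm1 Γ c).integrable_comp hint
  simpa [IntegrableOn] using this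

/-- The functionals `coordExt α` separate the points of the extrapolation space and commute with the
Bochner integral, so the mild equation is equivalent to its scalar Duhamel formulas. -/
theorem EigenData.isMildSolutionOn_iff (D : EigenData Γ c)
    (hu : MemLp u ⊤ (volume.restrict (Ioi 0))) (p₀ : FrakH Γ c) {p : ℝ → FrakH Γ c} {t₁ : ℝ} :
    IsMildSolutionOn Γ c id u 0 p₀ p t₁ ↔ ContinuousOn p (Icc 0 t₁) ∧ ∀ t ∈ Icc 0 t₁, ∀ α,
      ⟪D.nv α, p t⟫ = Real.exp (-t * wsum D.kap α) * ⟪D.nv α, p₀⟫ +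
        ∫ s in (0 : ℝ)..t, Real.exp (-(t - s) * wsum D.kap α) *
          D.force (u s) (fun β => ⟪D.nv β, p s⟫) α := by
  have key : ContinuousOn p (Icc 0 t₁) → ∀ t ∈ Icc 0 t₁, ∀ α,
      D.coordExt α (toExtrapolation (fpOp Γ c) 1 (semigroup (fpOp Γ c) t p₀) +
        ∫ s in (0 : ℝ)..t, mildIntegrand Γ c u p t s) =
      Real.exp (-t * wsum D.kap α) * ⟪D.nv α, p₀⟫ +
        ∫ s in (0 : ℝ)..t, Real.exp (-(t - s) * wsum D.kap α) *
          D.force (u s) (fun β => ⟪D.nv β, p s⟫) α := by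
    intro hp t ht α
    have hi := D.intervalIntegrable_mildIntegrand hu ht.1 (hp.mono (Icc_subset_Icc_right ht.2))
    rw [map_add, D.coordExt_toExtrapolation, D.inner_semigroup ht.1,
      ← ContinuousLinearMap.intervalIntegral_comp_comm _ hi]
    congr 1
    refine intervalIntegral.integral_congr fun s hs => ?_
    rw [uIcc_of_le ht.1] at hs
    exact D.coordExt_mildIntegrand p hs.2 α
  constructor
  · rintro ⟨hp, h⟩
    refine ⟨hp, fun t ht α => ?_⟩
    rw [← key hp t ht α, ← D.coordExt_toExtrapolation]
    exact congrArg (D.coordExt α) (h t ht).2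
  · rintro ⟨hp, h⟩
    refine ⟨hp, fun t ht => ⟨D.intervalIntegrable_mildIntegrand hu ht.1
      (hp.mono (Icc_subset_Icc_right ht.2)), D.ext_coordExt fun α => ?_⟩⟩
    rw [D.coordExt_toExtrapolation, h t ht α, ← key hp t ht α]
    rfl

/-- The force on the coordinate `α` uses only coordinates of degree `|α| - 1`, so the scalar
equations determine the coordinates degree by degree; in degree zero there is no force at all. -/
theorem EigenData.isMildSolution_unique (D : EigenData Γ c)
    (hu : MemLp u ⊤ (volume.restrict (Ioi 0))) {p₀ : FrakH Γ c} {p p₂ : ℝ → FrakH Γ c}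
    (h : IsMildSolution Γ c id u 0 p₀ p) (h₂ : IsMildSolution Γ c id u 0 p₀ p₂) :
    EqOn p₂ p (Ici 0) := by
  have e : ∀ {p : ℝ → FrakH Γ c}, IsMildSolution Γ c id u 0 p₀ p → ∀ t, 0 ≤ t → ∀ α,
      ⟪D.nv α, p t⟫ = Real.exp (-t * wsum D.kap α) * ⟪D.nv α, p₀⟫ +
        ∫ s in (0 : ℝ)..t, Real.exp (-(t - s) * wsum D.kap α) *
          D.force (u s) (fun β => ⟪D.nv β, p s⟫) α := fun h t ht =>
    ((D.isMildSolutionOn_iff hu p₀).1 (h (t + 1) (by linarith))).2 t ⟨ht, by linarith⟩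
  have main : ∀ (N : ℕ) (α : Fin n → ℕ), ∑ i, α i = N → ∀ t, 0 ≤ t →
      ⟪D.nv α, p₂ t⟫ = ⟪D.nv α, p t⟫ := by
    intro N
    induction N with
    | zero =>
      intro α hα t ht
      have h0 : ∀ i, α i = 0 := fun i => Finset.sum_eq_zero_iff.1 hα i (Finset.mem_univ i)
      rw [e h t ht, e h₂ t ht]
      simp [EigenData.force, h0]
    | succ N ih =>
      intro α hα t ht
      rw [e h t ht, e h₂ t ht]
      congr 1
      refine intervalIntegral.integral_congr fun s hs => ?_
      rw [uIcc_of_le ht] at hs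
      simp only [EigenData.force]
      congr 1
      refine Finset.sum_congr rfl fun i _ => ?_
      by_cases hi : α i = 0
      · simp [hi]
      · rw [ih (lower α i) ?_ s hs.1]
        have hr : ∑ j, raise (lower α i) i j = N + 1 := by rw [raise_lower hi, hα]
        have hsum : ∀ β : Fin n → ℕ, ∑ j, raise β i j = ∑ j, β j + 1 := fun β => by
          rw [raise, Finset.sum_update_of_mem (Finset.mem_univ i),
            ← Finset.add_sum_erase _ _ (Finset.mem_univ i), Finset.sdiff_singleton_eq_erase]
          ring
        rw [hsum] at hr
        omega
  intro t ht
  exact hilbert_ext D.basis fun α => by simpa only [D.basis_apply] using main _ α rfl t ht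

theorem EigenData.isMildSolution_of_flow (D : EigenData Γ c) (h : IsReference Γ yref yref' u)
    {p₀ : FrakH Γ c} {p : ℝ → FrakH Γ c} (hc : ContinuousOn p (Ici 0))
    (hp : ∀ t, 0 ≤ t → ∀ α, ⟪D.nv α, p t⟫ =
      flow D.kap (D.path yref yref' t) t (fun β => ⟪D.nv β, p₀⟫) α) :
    IsMildSolution Γ c id u 0 p₀ p := by
  intro t₁ _
  refine (D.isMildSolutionOn_iff h.memLp_control p₀).2
    ⟨hc.mono Icc_subset_Ici_self, fun t ht α => ?_⟩
  rw [hp t ht.1, (D.hasACDeriv_flow h (fun β => ⟪D.nv β, p₀⟫) α).eq_duhamel ht.1]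
  have h0 : D.path yref yref' 0 = 0 := funext fun i => by simp [EigenData.path]
  rw [h0, flow_zero]
  congr 1
  refine intervalIntegral.integral_congr fun s hs => ?_
  rw [uIcc_of_le ht.1] at hs
  simp only [EigenData.force, hp s hs.1]

end Reference

end

/-! ### Regularity in time and the weak equation -/

section

variable {n : ℕ} {Γ : Matrix (Fin n) (Fin n) ℝ} {c : ℝ}

/-! ### Functions with values in a dual space -/

section Dual

variable {V H : Type*} [NormedAddCommGroup V] [NormedSpace ℝ V] [NormedAddCommGroup H]
  [NormedSpace ℝ H]

theorem memLp_dual_comp (L : H →L[ℝ] StrongDual ℝ V) {f : ℝ → H} {q : ℝ≥0∞} {μ : Measure ℝ}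
    (hf : MemLp f q μ) : MemLp (fun t => L (f t)) q μ :=
  L.comp_memLp' hf

/-- An identity between functionals need only be tested on a determining family of vectors, and
evaluation at a vector commutes with the integral. -/
theorem hasWeakDerivOn_dual {ι : Type*} {e : ι → V} {f f' : ℝ → StrongDual ℝ V} {J : Set ℝ}
    (hext : ∀ L L' : StrongDual ℝ V, (∀ α, L (e α) = L' (e α)) → L = L')
    (hf : MemLp f 1 (volume.restrict J)) (hf' : MemLp f' 1 (volume.restrict J))
    (h : ∀ θ : ℝ → ℝ, ContDiff ℝ ∞ θ → tsupport θ ⊆ J → ∀ α,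
      ∫ t in J, deriv θ t * f t (e α) = -∫ t in J, θ t * f' t (e α)) :
    HasWeakDerivOn f f' J := by
  have i1 : IntegrableOn f J := memLp_one_iff_integrable.1 hf
  have i2 : IntegrableOn f' J := memLp_one_iff_integrable.1 hf'
  refine ⟨i1.locallyIntegrableOn, i2.locallyIntegrableOn, fun θ hθ hθc hθs => ?_⟩
  have smul_int : ∀ {ψ : ℝ → ℝ} {v : ℝ → StrongDual ℝ V}, Continuous ψ → HasCompactSupport ψ →
      IntegrableOn v J → IntegrableOn (fun t => ψ t • v t) J := by
    intro ψ v hψ hψc hv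
    obtain ⟨K, hK⟩ := hψc.exists_bound_of_continuous hψ
    exact Integrable.bdd_smul hv K hψ.aestronglyMeasurable (Eventually.of_forall hK)
  have hθ' : Continuous (deriv θ) := hθ.continuous_deriv (by simp)
  refine hext _ _ fun α => ?_
  rw [_root_.neg_apply, ContinuousLinearMap.integral_apply (smul_int hθ' hθc.deriv i1),
    ContinuousLinearMap.integral_apply (smul_int hθ.continuous hθc i2)]
  exact h θ hθ hθs α

end Dual

/-! ### Regularity of the translated flow -/

/-- The `q`-th power is `t^{-q/2}`, integrable at zero precisely for `q < 2`. -/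
theorem memLp_rpow_neg_half {q : ℝ≥0∞} (hq1 : 1 ≤ q) (hq : q < 2) {t₁ : ℝ} (ht₁ : 0 < t₁) :
    MemLp (fun t : ℝ => t ^ (-(1 / 2) : ℝ)) q (volume.restrict (Ioo 0 t₁)) := by
  have hq0 : q ≠ 0 := (zero_lt_one.trans_le hq1).ne'
  have hqt : q ≠ ⊤ := (hq.trans (by simp)).ne
  have hm : AEStronglyMeasurable (fun t : ℝ => t ^ (-(1 / 2) : ℝ)) (volume.restrict (Ioo 0 t₁)) :=
    (by fun_prop : Measurable fun t : ℝ => t ^ (-(1 / 2) : ℝ)).aestronglyMeasurable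
  rw [← integrable_norm_rpow_iff hm hq0 hqt]
  have h2 : q.toReal < 2 := by simpa using (ENNReal.toReal_lt_toReal hqt (by simp)).2 hq
  have h1 : IntegrableOn (fun t : ℝ => t ^ (-(1 / 2) * q.toReal : ℝ)) (Ioo 0 t₁) :=
    (intervalIntegral.integrableOn_Ioo_rpow_iff ht₁).2 (by linarith)
  refine h1.congr ?_
  filter_upwards [ae_restrict_mem measurableSet_Ioo] with t ht
  rw [Real.norm_of_nonneg (Real.rpow_nonneg ht.1.le _), ← Real.rpow_mul ht.1.le]

/-- The weighted gradient as a continuous linear map. -/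
def gradVL (Γ : Matrix (Fin n) (Fin n) ℝ) (c : ℝ) : FrakV Γ c →L[ℝ] FrakHn Γ c :=
  (WithLp.sndL 2 ℝ (FrakH Γ c) (FrakHn Γ c)).comp (FrakV Γ c).subtypeL

theorem gradVL_apply (z : FrakV Γ c) : gradVL Γ c z = gradV z := rfl

/-- The right-hand side of the equation in `𝔥_{-1/2}`. -/
def weakRhs (u : ℝ → EuclideanSpace ℝ (Fin n)) (p : ℝ → FrakH Γ c) (P : ℝ → FrakV Γ c) (t : ℝ) :
    FrakHmHalf Γ c :=
  B1HalfL Γ c ((-c) • gradVL Γ c (P t) + mulVecL Γ c (p t) (u t))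

theorem weakRhs_apply (u : ℝ → EuclideanSpace ℝ (Fin n)) (p : ℝ → FrakH Γ c)
    (P : ℝ → FrakV Γ c) (t : ℝ) (v : FrakV Γ c) :
    weakRhs u p P t v = -c * form (P t) v + B1Half (mulVec (p t) (u t)) v := by
  rw [weakRhs, map_add, map_smul, _root_.add_apply, _root_.smul_apply, B1HalfL_apply,
    B1HalfL_apply, gradVL_apply, mulVecL_apply, B1Half_apply (gradV (P t)), smul_eq_mul]
  rfl

/-- The `𝔙`-coordinates of `P t` are multiples of the `𝔥`-coordinates of the continuous function `p
t`, so a pointwise choice of lifts to `𝔙` is still measurable. -/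
theorem EigenData.aestronglyMeasurable_frakV (D : EigenData Γ c) {P : ℝ → FrakV Γ c}
    {p : ℝ → FrakH Γ c} {t₁ : ℝ} (hp : ContinuousOn p (Ici 0))
    (hP : ∀ t ∈ Ioo 0 t₁, valV (P t) = p t) :
    AEStronglyMeasurable P (volume.restrict (Ioo 0 t₁)) := by
  refine aestronglyMeasurable_of_coord D.basisV fun α => ?_
  have h1 : AEStronglyMeasurable (fun t => Real.sqrt (1 + wsum D.lam α) * ⟪D.nv α, p t⟫)
      (volume.restrict (Ioo 0 t₁)) := by
    refine ContinuousOn.aestronglyMeasurable ?_ measurableSet_Ioo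
    have : ContinuousOn p (Ioo 0 t₁) := hp.mono fun x hx => hx.1.le
    fun_prop
  refine h1.congr ?_
  filter_upwards [ae_restrict_mem measurableSet_Ioo] with t ht
  rw [D.basisV_apply, D.inner_wv, hP t ht]

/-- A trajectory of the translated flow. -/
structure EigenData.IsFlow (D : EigenData Γ c) (yref yref' u : ℝ → EuclideanSpace ℝ (Fin n))
    (p₀ : FrakH Γ c) (p : ℝ → FrakH Γ c) : Prop where
  ref : IsReference Γ yref yref' u
  cont : ContinuousOn p (Ici 0)
  bounded : ∃ C, ∀ t, ‖p t‖ ≤ C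
  coord : ∀ t, 0 ≤ t → ∀ α, ⟪D.nv α, p t⟫ =
    flow D.kap (D.path yref yref' t) t (fun β => ⟪D.nv β, p₀⟫) α

variable {yref yref' u : ℝ → EuclideanSpace ℝ (Fin n)} {D : EigenData Γ c} {p₀ : FrakH Γ c}
  {p : ℝ → FrakH Γ c}

theorem EigenData.exists_isFlow (D : EigenData Γ c) (h : IsReference Γ yref yref' u)
    (p₀ : FrakH Γ c) : ∃ p, D.IsFlow yref yref' u p₀ p := by
  obtain ⟨M, hM⟩ := D.exists_isPath h
  obtain ⟨p, hp, hb⟩ := D.exists_flow hM p₀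
  exact ⟨p, h, D.continuousOn_flow_frakH hM p₀ hp, ⟨_, fun t => Real.le_sqrt_of_sq_le (hb t)⟩, hp⟩

theorem EigenData.IsFlow.memLp_top (h : D.IsFlow yref yref' u p₀ p) :
    MemLp p ⊤ (volume.restrict (Ioi 0)) := by
  obtain ⟨C, hC⟩ := h.bounded
  exact memLp_top_of_bound ((h.cont.mono Ioi_subset_Ici_self).aestronglyMeasurable
    measurableSet_Ioi) C (Eventually.of_forall hC)

theorem EigenData.IsFlow.zero (h : D.IsFlow yref yref' u p₀ p) : p 0 = p₀ := by
  refine hilbert_ext D.basis fun α => ?_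
  have h0 : D.path yref yref' 0 = 0 := funext fun i => by simp [EigenData.path]
  rw [D.basis_apply, h.coord 0 le_rfl, h0, flow_zero]

theorem EigenData.IsFlow.memLp_weakRhs (h : D.IsFlow yref yref' u p₀ p) {P : ℝ → FrakV Γ c}
    {t₁ : ℝ} {q : ℝ≥0∞} (hPm : MemLp P q (volume.restrict (Ioo 0 t₁))) :
    MemLp (weakRhs u p P) q (volume.restrict (Ioo 0 t₁)) := by
  have hsub : volume.restrict (Ioo 0 t₁) ≤ volume.restrict (Ioi (0 : ℝ)) :=
    Measure.restrict_mono Ioo_subset_Ioi_self le_rfl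
  have hfin : IsFiniteMeasure (volume.restrict (Ioo 0 t₁)) := ⟨by simp⟩
  have hu := h.ref.memLp_control.mono_measure hsub
  have hp := h.memLp_top.mono_measure hsub
  obtain ⟨B, hB, hBu⟩ := exists_bound_of_memLp_top hu
  obtain ⟨C, hC⟩ := h.bounded
  have h2 : MemLp (fun t => mulVecL Γ c (p t) (u t)) ⊤ (volume.restrict (Ioo 0 t₁)) := by
    refine memLp_top_of_bound ((mulVecL Γ c).aestronglyMeasurable_comp₂ hp.1 hu.1) (C * B) ?_
    filter_upwards [hBu] with t ht
    exact (norm_mulVec_le _ _).trans (mul_le_mul (hC t) ht (norm_nonneg _)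
      ((norm_nonneg _).trans (hC t)))
  have h1 : MemLp (fun t => (-c) • gradVL Γ c (P t)) q (volume.restrict (Ioo 0 t₁)) :=
    ((gradVL Γ c).comp_memLp' hPm).const_smul (-c)
  exact memLp_dual_comp (V := FrakV Γ c) (B1HalfL Γ c) (h1.add (h2.mono_exponent le_top))

/-- Tested on the Hermite functions, the claim is integration by parts for the absolutely continuous
coordinates of the flow. -/
theorem EigenData.IsFlow.hasWeakDerivOn (h : D.IsFlow yref yref' u p₀ p) {P : ℝ → FrakV Γ c}
    {t₁ : ℝ} (ht₁ : 0 < t₁) (hP : ∀ t ∈ Ioo 0 t₁, valV (P t) = p t)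
    (hPm : MemLp P 1 (volume.restrict (Ioo 0 t₁))) :
    HasWeakDerivOn (fun t => toHmHalf (p t)) (weakRhs u p P) (Ioo 0 t₁) := by
  have hfin : IsFiniteMeasure (volume.restrict (Ioo 0 t₁)) := ⟨by simp⟩
  have hpm : MemLp p 1 (volume.restrict (Ioo 0 t₁)) :=
    (h.memLp_top.mono_measure (Measure.restrict_mono Ioo_subset_Ioi_self le_rfl)).mono_exponent
      le_top
  refine hasWeakDerivOn_dual (V := FrakV Γ c) (e := D.nvV) (fun L L' => D.clm_ext_nvV)
    (memLp_dual_comp (V := FrakV Γ c) (toHmHalfL Γ c) hpm) (h.memLp_weakRhs hPm)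
    fun θ hθ hθs α => ?_
  have key := (D.hasACDeriv_flow h.ref (fun β => ⟪D.nv β, p₀⟫) α).integral_deriv_mul hθ ht₁.le hθs
  refine Eq.trans (setIntegral_congr_fun measurableSet_Ioo fun t ht => ?_) (key.trans (congrArg
    Neg.neg (setIntegral_congr_fun measurableSet_Ioo fun t ht => ?_)))
  · change deriv θ t * ⟪p t, valV (D.nvV α)⟫ = _
    rw [D.valV_nvV, real_inner_comm, h.coord t ht.1.le]
  · change _ = θ t * weakRhs u p P t (D.nvV α)
    rw [weakRhs_apply, D.form_nvV, hP t ht, D.B1Half_mulVec_nvV, D.wsum_kap]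
    simp only [EigenData.force, h.coord t ht.1.le]
    ring

theorem EigenData.IsFlow.memRegularity (h : D.IsFlow yref yref' u p₀ p) {P : ℝ → FrakV Γ c}
    {t₁ : ℝ} (ht₁ : 0 < t₁) (hP : ∀ t ∈ Ioo 0 t₁, valV (P t) = p t) {q : ℝ≥0∞} (hq : 1 ≤ q)
    (hPm : MemLp P q (volume.restrict (Ioo 0 t₁))) : MemRegularity q p t₁ := by
  have hfin : IsFiniteMeasure (volume.restrict (Ioo 0 t₁)) := ⟨by simp⟩
  have hpm : MemLp p q (volume.restrict (Ioo 0 t₁)) :=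
    (h.memLp_top.mono_measure (Measure.restrict_mono Ioo_subset_Ioi_self le_rfl)).mono_exponent
      le_top
  refine ⟨⟨P, hPm, ?_⟩, weakRhs u p P, memLp_dual_comp (V := FrakV Γ c) (toHmHalfL Γ c) hpm, h.memLp_weakRhs hPm,
    h.hasWeakDerivOn ht₁ hP (hPm.mono_exponent hq)⟩
  filter_upwards [ae_restrict_mem measurableSet_Ioo] with t ht
  exact hP t ht

theorem EigenData.IsFlow.exists_frakV_of_bound (h : D.IsFlow yref yref' u p₀ p) {t : ℝ}
    (ht : 0 ≤ t) {K : ℝ} (hK : ∀ A, ∑ α ∈ Finset.Iic A, (1 + wsum D.lam α) *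
      flow D.kap (D.path yref yref' t) t (fun β => ⟪D.nv β, p₀⟫) α ^ 2 ≤ K) :
    ∃ z : FrakV Γ c, valV z = p t ∧ ‖z‖ ^ 2 ≤ K := by
  obtain ⟨hs, hle⟩ := summable_of_box_le
    (fun α => mul_nonneg (D.one_add_wsum_pos α).le (sq_nonneg _)) hK
  obtain ⟨z, hz, hn⟩ := D.exists_frakV hs
  refine ⟨z, hilbert_ext D.basis fun α => ?_, hn.le.trans hle⟩
  rw [D.basis_apply, hz, h.coord t ht]

theorem EigenData.IsFlow.exists_memLp_frakV (h : D.IsFlow yref yref' u p₀ p) :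
    ∃ P : ℝ → FrakV Γ c, (∀ t, 0 < t → valV (P t) = p t) ∧ ∀ t₁, 0 < t₁ → ∀ q : ℝ≥0∞, 1 ≤ q →
      q < 2 → MemLp P q (volume.restrict (Ioo 0 t₁)) := by
  obtain ⟨M, hM⟩ := D.exists_isPath h.ref
  obtain ⟨K, hK0, hK⟩ := D.exists_bound_smoothing M
  have hex : ∀ t : ℝ, ∃ z : FrakV Γ c,
      0 < t → valV z = p t ∧ ‖z‖ ^ 2 ≤ K * (1 + 1 / t) * ‖p₀‖ ^ 2 := by
    intro t
    by_cases ht : 0 < t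
    · obtain ⟨z, hz⟩ := h.exists_frakV_of_bound ht.le (hK _ hM p₀ t ht)
      exact ⟨z, fun _ => hz⟩
    · exact ⟨0, fun ht' => absurd ht' ht⟩
  choose P hP using hex
  refine ⟨P, fun t ht => (hP t ht).1, fun t₁ ht₁ q hq1 hq => ?_⟩
  have hfin : IsFiniteMeasure (volume.restrict (Ioo 0 t₁)) := ⟨by simp⟩
  have hdom : MemLp (fun t : ℝ => Real.sqrt K * ‖p₀‖ * (1 + t ^ (-(1 / 2) : ℝ))) q
      (volume.restrict (Ioo 0 t₁)) :=
    ((memLp_const (1 : ℝ)).add (memLp_rpow_neg_half hq1 hq ht₁)).const_mul _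
  refine hdom.mono (D.aestronglyMeasurable_frakV h.cont fun t ht => (hP t ht.1).1) ?_
  filter_upwards [ae_restrict_mem measurableSet_Ioo] with t ht
  have hr : 0 ≤ t ^ (-(1 / 2) : ℝ) := Real.rpow_nonneg ht.1.le _
  have hr2 : (t ^ (-(1 / 2) : ℝ)) ^ 2 = 1 / t := by
    rw [← Real.rpow_natCast, ← Real.rpow_mul ht.1.le]
    norm_num [Real.rpow_neg_one]
  rw [Real.norm_of_nonneg (by positivity)]
  refine le_of_sq_le_sq ((hP t ht.1).2.trans ?_) (by positivity)
  rw [mul_pow, mul_pow, Real.sq_sqrt hK0]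
  have : 1 + 1 / t ≤ (1 + t ^ (-(1 / 2) : ℝ)) ^ 2 := by
    rw [add_sq, hr2]; linarith
  have := mul_le_mul_of_nonneg_left this (mul_nonneg hK0 (sq_nonneg ‖p₀‖))
  linarith

theorem EigenData.IsFlow.memRegularity_of_lt_two (h : D.IsFlow yref yref' u p₀ p) {t₁ : ℝ}
    (ht₁ : 0 < t₁) {q : ℝ≥0∞} (hq1 : 1 ≤ q) (hq : q < 2) : MemRegularity q p t₁ := by
  obtain ⟨P, hP, hPm⟩ := h.exists_memLp_frakV
  exact h.memRegularity ht₁ (fun t ht => hP t ht.1) hq1 (hPm t₁ ht₁ q hq1 hq)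

theorem EigenData.IsFlow.satisfiesWeakEquation (h : D.IsFlow yref yref' u p₀ p) {t₁ : ℝ}
    (ht₁ : 0 < t₁) : SatisfiesWeakEquation id u 0 p t₁ := by
  obtain ⟨P, hP, hPm⟩ := h.exists_memLp_frakV
  refine ⟨weakRhs u p P, h.hasWeakDerivOn ht₁ (fun t ht => hP t ht.1)
    (hPm t₁ ht₁ 1 le_rfl (by norm_num)), ?_⟩
  filter_upwards [ae_restrict_mem measurableSet_Ioo] with t ht
  refine ⟨P t, hP t ht.1, fun v => ?_⟩
  rw [weakRhs_apply, _root_.add_apply, toHmHalf_apply]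
  simp

theorem EigenData.IsFlow.memRegularity_of_frakV {z : FrakV Γ c}
    (h : D.IsFlow yref yref' u (valV z) p) {t₁ : ℝ} (ht₁ : 0 < t₁) {q : ℝ≥0∞} (hq1 : 1 ≤ q) :
    MemRegularity q p t₁ := by
  obtain ⟨M, hM⟩ := D.exists_isPath h.ref
  obtain ⟨K, hK⟩ := D.exists_bound_frakV hM z
  have hex : ∀ t : ℝ, ∃ z : FrakV Γ c, 0 < t → valV z = p t ∧ ‖z‖ ^ 2 ≤ K := by
    intro t
    by_cases ht : 0 < t
    · obtain ⟨z, hz⟩ := h.exists_frakV_of_bound ht.le (hK t ht.le)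
      exact ⟨z, fun _ => hz⟩
    · exact ⟨0, fun ht' => absurd ht' ht⟩
  choose P hP using hex
  have hfin : IsFiniteMeasure (volume.restrict (Ioo 0 t₁)) := ⟨by simp⟩
  refine h.memRegularity ht₁ (P := P) (fun t ht => (hP t ht.1).1) hq1 (MemLp.mono_exponent
    (memLp_top_of_bound (D.aestronglyMeasurable_frakV h.cont fun t ht => (hP t ht.1).1)
      (Real.sqrt K) ?_) le_top)
  filter_upwards [ae_restrict_mem measurableSet_Ioo] with t ht
  exact Real.le_sqrt_of_sq_le (hP t ht.1).2

end

/-! ### Mass, mean and covariance -/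

section

variable {n : ℕ} {Γ : Matrix (Fin n) (Fin n) ℝ} {c : ℝ}

/-! ### Moments in Hermite coordinates -/

theorem sqf_mul_annih (i : Fin n) (q : (Fin n → ℕ) → ℝ) (α : Fin n → ℕ) :
    sqf α * annih i q α = sqf (raise α i) * q (raise α i) := by
  rw [annih, sqf_raise]; ring

theorem annih_zero_eq (i : Fin n) (q : (Fin n → ℕ) → ℝ) :
    annih i q 0 = sqf (raise 0 i) * q (raise 0 i) := by
  rw [← sqf_mul_annih, sqf_zero, one_mul]

theorem annih_annih_zero_eq (i j : Fin n) (q : (Fin n → ℕ) → ℝ) :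
    annih j (annih i q) 0 = sqf (raise (raise 0 j) i) * q (raise (raise 0 j) i) := by
  rw [annih_zero_eq, sqf_mul_annih]

/-- Only `β = 0` lies below `0`, with rate zero and kernel one. This is the conservation of mass. -/
theorem flow_index_zero (κ m : Fin n → ℝ) (t : ℝ) (q : (Fin n → ℕ) → ℝ) :
    flow κ m t q 0 = q 0 := by
  have h : Finset.Iic (0 : Fin n → ℕ) = {0} := by
    ext α; simp
  rw [flow_eq_sum, h, Finset.sum_singleton]
  simp [shiftKer, wsum]

theorem annih_flow_zero (κ m : Fin n → ℝ) (t : ℝ) (q : (Fin n → ℕ) → ℝ) (i : Fin n) :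
    annih i (flow κ m t q) 0 = Real.exp (-t * κ i) * annih i q 0 + m i * q 0 := by
  rw [annih_flow, flow_index_zero, flow_index_zero]

/-- The coordinates of degree two by applying the commutation rule twice; every flow left over is
evaluated at index zero, where it is constant in time. -/
theorem annih_annih_flow_zero (κ m : Fin n → ℝ) (t : ℝ) (q : (Fin n → ℕ) → ℝ) (i j : Fin n) :
    annih j (annih i (flow κ m t q)) 0 =
      Real.exp (-t * κ i) * (Real.exp (-t * κ j) * annih j (annih i q) 0 + m j * annih i q 0) +
      m i * (Real.exp (-t * κ j) * annih j q 0 + m j * q 0) := by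
  have h : annih j (annih i (flow κ m t q)) 0 =
      Real.exp (-t * κ i) * annih j (flow κ m t (annih i q)) 0 +
        m i * annih j (flow κ m t q) 0 := by
    rw [annih, annih_flow, annih, annih]; ring
  rw [h, annih_flow_zero, annih_flow_zero]

/-- The Hermite coordinates of `z ∈ 𝔥`. -/
def EigenData.coord (D : EigenData Γ c) (z : FrakH Γ c) (α : Fin n → ℕ) : ℝ := ⟪D.nv α, z⟫

theorem EigenData.integral_herm_mul (D : EigenData Γ c) (z : FrakH Γ c) (α : Fin n → ℕ) :
    ∫ x, D.herm α x * z x = Real.sqrt (gaussMass Γ c) * (sqf α * D.coord z α) := by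
  rw [← D.inner_vec (D.growth_herm α) z]
  change ⟪D.hv α, z⟫ = _
  rw [D.hv_eq, real_inner_smul_left, EigenData.coord]
  ring

theorem EigenData.mass_eq (D : EigenData Γ c) (z : FrakH Γ c) :
    mass z = Real.sqrt (gaussMass Γ c) * D.coord z 0 := by
  have h := D.integral_herm_mul z 0
  simp only [D.herm_zero, one_mul, sqf_zero] at h
  exact h

theorem EigenData.herm_raise_zero (D : EigenData Γ c) (i : Fin n)
    (x : EuclideanSpace ℝ (Fin n)) : D.herm (raise 0 i) x = D.y i x := by
  rw [D.herm_raise, D.herm_zero]; simp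

theorem EigenData.herm_raise_raise_zero (D : EigenData Γ c) (i j : Fin n)
    (x : EuclideanSpace ℝ (Fin n)) : D.herm (raise (raise 0 j) i) x =
      D.y i x * D.y j x - if i = j then 1 else 0 := by
  rw [D.herm_raise, D.herm_raise_zero]
  split_ifs with h
  · subst h
    rw [lower_raise, D.herm_zero, raise_same]; simp
  · rw [raise_of_ne _ h]; simp

theorem EigenData.integral_y_mul (D : EigenData Γ c) (z : FrakH Γ c) (i : Fin n) :
    ∫ x, D.y i x * z x = Real.sqrt (gaussMass Γ c) * annih i (D.coord z) 0 := by
  rw [annih_zero_eq, ← D.integral_herm_mul]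
  simp only [D.herm_raise_zero]

/-- `y_i y_j` differs from a Hermite product by one exactly when `i = j`; this is the source of the
identity matrix in the covariance formula. -/
theorem EigenData.integral_y_mul_y_mul (D : EigenData Γ c) (z : FrakH Γ c) (i j : Fin n) :
    ∫ x, D.y i x * D.y j x * z x = Real.sqrt (gaussMass Γ c) * annih j (annih i (D.coord z)) 0 +
      (if i = j then 1 else 0) * mass z := by
  have h := D.integral_herm_mul z (raise (raise 0 j) i)
  simp only [D.herm_raise_raise_zero, sub_mul] at h
  rw [integral_sub (D.integrable_growth_mul ((D.growth_y i).mul (D.growth_y j)) z)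
    (D.integrable_growth_mul (Growth.const _) z), integral_const_mul] at h
  rw [annih_annih_zero_eq, ← h, mass]
  ring

theorem growth_apply (k : Fin n) : Growth fun x : EuclideanSpace ℝ (Fin n) => x k := by
  have := Growth.inner (EuclideanSpace.single k (1 : ℝ) : EuclideanSpace ℝ (Fin n))
  simpa [EuclideanSpace.inner_single_left] using this

theorem EigenData.inner_mean (D : EigenData Γ c) (z : FrakH Γ c) (b : EuclideanSpace ℝ (Fin n)) :
    ⟪b, mean z⟫ = ∫ x, ⟪b, x⟫ * z x := by
  have e : ∀ x : EuclideanSpace ℝ (Fin n), ⟪b, x⟫ = ∑ k, b k * x k := fun x => by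
    simp [PiLp.inner_apply, mul_comm]
  simp only [e, Finset.sum_mul]
  rw [integral_finsetSum _ fun k _ => D.integrable_growth_mul ((growth_apply k).const_mul (b k)) z]
  refine Finset.sum_congr rfl fun k _ => ?_
  simp only [mean, mul_assoc, integral_const_mul]

theorem EigenData.sqrt_lam_mul_inner_mean (D : EigenData Γ c) (z : FrakH Γ c) (i : Fin n) :
    Real.sqrt (D.lam i) * ⟪D.b i, mean z⟫ =
      Real.sqrt (gaussMass Γ c) * annih i (D.coord z) 0 := by
  rw [D.inner_mean, ← integral_const_mul, ← D.integral_y_mul]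
  simp only [EigenData.y, mul_assoc]

/-! ### Covariance in scaled eigencoordinates -/

/-- The matrix with columns the eigenvectors. -/
def EigenData.colMatrix (D : EigenData Γ c) : Matrix (Fin n) (Fin n) ℝ :=
  Matrix.of fun k i => D.b i k

/-- The covariance in the coordinates `y i`. -/
def EigenData.scaledCov (D : EigenData Γ c) (z : FrakH Γ c) : Matrix (Fin n) (Fin n) ℝ :=
  Matrix.of fun i j => ∫ x, (D.y i x - Real.sqrt (D.lam i) * ⟪D.b i, mean z⟫) *
    (D.y j x - Real.sqrt (D.lam j) * ⟪D.b j, mean z⟫) * z x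

theorem EigenData.cov_eq (D : EigenData Γ c) (z : FrakH Γ c) :
    cov z = D.colMatrix * Matrix.diagonal (fun i => (Real.sqrt (D.lam i))⁻¹) * D.scaledCov z *
      Matrix.diagonal (fun i => (Real.sqrt (D.lam i))⁻¹) * D.colMatrix.transpose := by
  have hx : ∀ (x : EuclideanSpace ℝ (Fin n)) (k : Fin n), x k - mean z k =
      ∑ i, D.b i k * (Real.sqrt (D.lam i))⁻¹ *
        (D.y i x - Real.sqrt (D.lam i) * ⟪D.b i, mean z⟫) := by
    intro x k
    have h := congrArg (fun v : EuclideanSpace ℝ (Fin n) => v k) (D.b.sum_repr' (x - mean z))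
    simp only [WithLp.ofLp_sum, Finset.sum_apply, PiLp.smul_apply, PiLp.sub_apply, smul_eq_mul]
      at h
    rw [← h]
    refine Finset.sum_congr rfl fun i _ => ?_
    have := (D.sqrt_lam_pos i).ne'
    rw [inner_sub_right, EigenData.y]
    field_simp
  have hg : ∀ i, Growth fun x => D.y i x - Real.sqrt (D.lam i) * ⟪D.b i, mean z⟫ := fun i =>
    (D.growth_y i).sub (Growth.const _)
  have he : ∀ k j, (D.colMatrix * Matrix.diagonal (fun i => (Real.sqrt (D.lam i))⁻¹) *
      D.scaledCov z) k j =
        ∑ i, D.colMatrix k i * (Real.sqrt (D.lam i))⁻¹ * D.scaledCov z i j := fun k j => by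
    rw [Matrix.mul_apply]; simp only [Matrix.mul_diagonal]
  ext k l
  rw [Matrix.mul_apply]
  simp only [Matrix.mul_diagonal, he, Matrix.transpose_apply, Finset.sum_mul]
  rw [Finset.sum_comm]
  simp only [cov, Matrix.of_apply, hx]
  simp only [Finset.sum_mul_sum]
  simp only [Finset.sum_mul]
  rw [integral_finsetSum]
  · refine Finset.sum_congr rfl fun i _ => ?_
    rw [integral_finsetSum]
    · refine Finset.sum_congr rfl fun j _ => ?_
      simp only [EigenData.scaledCov, EigenData.colMatrix, Matrix.of_apply]
      rw [← integral_const_mul, ← integral_mul_const, ← integral_mul_const]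
      congr 1
      funext x
      ring
    · intro j _
      exact D.integrable_growth_mul (((hg i).const_mul _).mul ((hg j).const_mul _)) z
  · intro i _
    refine integrable_finsetSum _ fun j _ => ?_
    exact D.integrable_growth_mul (((hg i).const_mul _).mul ((hg j).const_mul _)) z

theorem EigenData.scaledCov_apply (D : EigenData Γ c) {z : FrakH Γ c} (hz : mass z = 1)
    (i j : Fin n) : D.scaledCov z i j =
      Real.sqrt (gaussMass Γ c) * annih j (annih i (D.coord z)) 0 + (if i = j then 1 else 0) -
      (Real.sqrt (gaussMass Γ c) * annih i (D.coord z) 0) *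
        (Real.sqrt (gaussMass Γ c) * annih j (D.coord z) 0) := by
  set μ : Fin n → ℝ := fun i => Real.sqrt (gaussMass Γ c) * annih i (D.coord z) 0 with hμ
  have e : ∀ x, (D.y i x - μ i) * (D.y j x - μ j) * z x = D.y i x * D.y j x * z x -
      μ j * (D.y i x * z x) - μ i * (D.y j x * z x) + μ i * μ j * (1 * z x) := fun x => by ring
  have hi := D.integrable_growth_mul (D.growth_y i) z
  have hj := D.integrable_growth_mul (D.growth_y j) z
  have hij := D.integrable_growth_mul ((D.growth_y i).mul (D.growth_y j)) z
  have h1 := D.integrable_growth_mul (Growth.const 1) z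
  simp only [EigenData.scaledCov, Matrix.of_apply, D.sqrt_lam_mul_inner_mean]
  change ∫ x, (D.y i x - μ i) * (D.y j x - μ j) * z x = _
  simp only [e]
  have split : ∫ x, (D.y i x * D.y j x * z x - μ j * (D.y i x * z x) - μ i * (D.y j x * z x) +
      μ i * μ j * (1 * z x)) = (∫ x, D.y i x * D.y j x * z x) - μ j * (∫ x, D.y i x * z x) -
      μ i * (∫ x, D.y j x * z x) + μ i * μ j * ∫ x, 1 * z x := by
    rw [← integral_const_mul, ← integral_const_mul, ← integral_const_mul,
      ← integral_sub hij (hi.const_mul _), ← integral_sub _ (hj.const_mul _),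
      ← integral_add _ (h1.const_mul _)]
    · exact (hij.sub (hi.const_mul _)).sub (hj.const_mul _)
    · exact hij.sub (hi.const_mul _)
  rw [split, D.integral_y_mul, D.integral_y_mul, D.integral_y_mul_y_mul, hz]
  have : ∫ x, 1 * z x = 1 := by simpa [mass] using hz
  rw [this]
  simp only [hμ]
  ring

section Flow

variable {yref yref' u : ℝ → EuclideanSpace ℝ (Fin n)} {D : EigenData Γ c} {p₀ : FrakH Γ c}
  {p : ℝ → FrakH Γ c}

theorem EigenData.IsFlow.coord_eq (h : D.IsFlow yref yref' u p₀ p) {t : ℝ} (ht : 0 ≤ t) :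
    D.coord (p t) = flow D.kap (D.path yref yref' t) t (D.coord p₀) :=
  funext fun α => h.coord t ht α

theorem EigenData.IsFlow.mass_eq (h : D.IsFlow yref yref' u p₀ p) {t : ℝ} (ht : 0 ≤ t) :
    mass (p t) = mass p₀ := by
  rw [D.mass_eq, D.mass_eq, h.coord_eq ht, flow_index_zero]

theorem EigenData.IsFlow.inner_mean_eq (h : D.IsFlow yref yref' u p₀ p) {t : ℝ} (ht : 0 ≤ t)
    (i : Fin n) : ⟪D.b i, mean (p t)⟫ = mass p₀ * ⟪D.b i, yref t⟫ +
      Real.exp (-t * D.kap i) * (⟪D.b i, mean p₀⟫ - mass p₀ * ⟪D.b i, yref 0⟫) := by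
  have h1 := D.sqrt_lam_mul_inner_mean (p t) i
  have h2 := D.sqrt_lam_mul_inner_mean p₀ i
  rw [h.coord_eq ht, annih_flow_zero, D.path_eq h.ref ht] at h1
  refine mul_left_cancel₀ (D.sqrt_lam_pos i).ne' ?_
  rw [D.mass_eq p₀]
  linear_combination h1 - Real.exp (-t * D.kap i) * h2

/-- Centring removes the translation: all terms containing the path cancel because the total mass is
one. Only the uncontrolled relaxation to the identity remains. -/
theorem EigenData.IsFlow.scaledCov_eq (h : D.IsFlow yref yref' u p₀ p) (hp₀ : mass p₀ = 1)
    {t : ℝ} (ht : 0 ≤ t) (i j : Fin n) : D.scaledCov (p t) i j = (if i = j then 1 else 0) +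
      Real.exp (-t * D.kap i) * (D.scaledCov p₀ i j - if i = j then 1 else 0) *
        Real.exp (-t * D.kap j) := by
  have hm := D.mass_eq p₀
  rw [hp₀] at hm
  rw [D.scaledCov_apply ((h.mass_eq ht).trans hp₀), D.scaledCov_apply hp₀, h.coord_eq ht,
    annih_annih_flow_zero, annih_flow_zero, annih_flow_zero]
  set G := Real.sqrt (gaussMass Γ c)
  set q0 := D.coord p₀ 0
  set mi := D.path yref yref' t i
  set mj := D.path yref yref' t j
  set Ei := Real.exp (-t * D.kap i)
  set Ej := Real.exp (-t * D.kap j)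
  set ai := annih i (D.coord p₀) 0
  set aj := annih j (D.coord p₀) 0
  linear_combination (mi * mj * G * q0 + Ei * G * ai * mj + Ej * G * aj * mi) * hm

/-! ### Matrices in the eigenbasis -/

theorem EigenData.colMatrix_orthogonal (D : EigenData Γ c) :
    D.colMatrix.transpose * D.colMatrix = 1 := by
  ext i j
  rw [Matrix.mul_apply, Matrix.one_apply, ← D.inner_basis_b i j]
  simp [EigenData.colMatrix, PiLp.inner_apply, mul_comm]

theorem EigenData.mul_colMatrix (D : EigenData Γ c) :
    Γ * D.colMatrix = D.colMatrix * Matrix.diagonal (fun i => c * D.lam i) := by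
  ext k i
  have h := congrArg (fun v : EuclideanSpace ℝ (Fin n) => v k) (D.act_b i)
  rw [Matrix.mul_diagonal, Matrix.mul_apply]
  simp only [act, Matrix.toLpLin_apply, Matrix.mulVec, dotProduct, PiLp.smul_apply,
    smul_eq_mul] at h
  simp only [EigenData.colMatrix, Matrix.of_apply]
  rw [h, mul_comm]

theorem EigenData.isUnit_colMatrix (D : EigenData Γ c) : IsUnit D.colMatrix :=
  IsUnit.of_mul_eq_one_right _ D.colMatrix_orthogonal

theorem EigenData.eq_conj (D : EigenData Γ c) :
    Γ = D.colMatrix * Matrix.diagonal (fun i => c * D.lam i) * D.colMatrix⁻¹ := by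
  rw [← D.mul_colMatrix, Matrix.mul_assoc,
    Matrix.mul_nonsing_inv _ ((Matrix.isUnit_iff_isUnit_det _).1 D.isUnit_colMatrix),
    Matrix.mul_one]

theorem EigenData.exp_smul (D : EigenData Γ c) (t : ℝ) : NormedSpace.exp (-t • Γ) =
    D.colMatrix * Matrix.diagonal (fun i => Real.exp (-t * D.kap i)) * D.colMatrix⁻¹ := by
  have h : -t • Γ = D.colMatrix * Matrix.diagonal (fun i => -t * D.kap i) * D.colMatrix⁻¹ := by
    conv_lhs => rw [D.eq_conj]
    rw [← Matrix.smul_mul, ← Matrix.mul_smul, ← Matrix.diagonal_smul]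
    rfl
  rw [h, Matrix.exp_conj _ _ D.isUnit_colMatrix, Matrix.exp_diagonal, Pi.exp_def]
  simp only [Real.exp_eq_exp_ℝ]

theorem EigenData.act_exp_b (D : EigenData Γ c) (t : ℝ) (i : Fin n) :
    act (NormedSpace.exp (-t • Γ)) (D.b i) = Real.exp (-t * D.kap i) • D.b i := by
  have h : NormedSpace.exp (-t • Γ) * D.colMatrix =
      D.colMatrix * Matrix.diagonal (fun i => Real.exp (-t * D.kap i)) := by
    rw [D.exp_smul, Matrix.mul_assoc,
      Matrix.nonsing_inv_mul _ ((Matrix.isUnit_iff_isUnit_det _).1 D.isUnit_colMatrix),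
      Matrix.mul_one]
  ext k
  have hk := congrFun (congrFun h k) i
  rw [Matrix.mul_diagonal, Matrix.mul_apply] at hk
  simp only [act, Matrix.toLpLin_apply, Matrix.mulVec, dotProduct, PiLp.smul_apply, smul_eq_mul]
  simp only [EigenData.colMatrix, Matrix.of_apply] at hk
  rw [hk, mul_comm]

theorem EigenData.inner_act_exp (D : EigenData Γ c) (t : ℝ) (i : Fin n)
    (x : EuclideanSpace ℝ (Fin n)) : ⟪D.b i, act (NormedSpace.exp (-t • Γ)) x⟫ =
      Real.exp (-t * D.kap i) * ⟪D.b i, x⟫ := by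
  have h : act (NormedSpace.exp (-t • Γ)) x =
      ∑ j, ⟪D.b j, x⟫ • (Real.exp (-t * D.kap j) • D.b j) := by
    conv_lhs => rw [← D.b.sum_repr' x]
    unfold act
    rw [map_sum]
    refine Finset.sum_congr rfl fun j _ => ?_
    rw [map_smul]
    exact congrArg _ (D.act_exp_b t j)
  rw [h, inner_sum, Finset.sum_eq_single i]
  · rw [inner_smul_right, inner_smul_right, D.inner_basis_b, if_pos rfl]; ring
  · intro j _ hj
    rw [inner_smul_right, inner_smul_right, D.inner_basis_b, if_neg hj.symm]; ring
  · simp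

/-- Compared in the eigenbasis, where `e^{-Γt}` acts by the scalars `e^{-tκ_i}`. -/
theorem EigenData.IsFlow.mean_eq (h : D.IsFlow yref yref' u p₀ p) {t : ℝ} (ht : 0 ≤ t) :
    mean (p t) = mass p₀ • yref t +
      act (NormedSpace.exp (-t • Γ)) (mean (p 0) - mass p₀ • yref 0) := by
  refine hilbert_ext D.b.toHilbertBasis fun i => ?_
  rw [OrthonormalBasis.coe_toHilbertBasis, h.inner_mean_eq ht, inner_add_right, D.inner_act_exp,
    inner_smul_right, inner_sub_right, inner_smul_right, h.zero]

/-! ### The covariance matrix along the flow -/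

/-- The matrix in the middle is `2 (scaledCov p₀ - 1)`. With it the inner bracket is twice the
scaled covariance at time `t`, and the two factors `√2` from `R⁻¹` together with this `2` cancel the
`1/4`. -/
theorem EigenData.IsFlow.cov_eq (h : D.IsFlow yref yref' u p₀ p) (hp₀ : mass p₀ = 1) {t : ℝ}
    (ht : 0 ≤ t) : cov (p t) = (1 / 4 : ℝ) •
      (D.colMatrix * (Matrix.diagonal fun k => Real.sqrt (D.lam k / 2))⁻¹ *
        (NormedSpace.exp (-(c * t) • Matrix.diagonal D.lam) * ((2 : ℝ) • (D.scaledCov p₀ - 1)) *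
          NormedSpace.exp (-(c * t) • Matrix.diagonal D.lam) + (2 : ℝ) • 1) *
        (Matrix.diagonal fun k => Real.sqrt (D.lam k / 2))⁻¹ * D.colMatrix.transpose) := by
  have hinv : (Matrix.diagonal fun k => Real.sqrt (D.lam k / 2))⁻¹ =
      Real.sqrt 2 • Matrix.diagonal fun k => (Real.sqrt (D.lam k))⁻¹ := by
    refine Matrix.inv_eq_left_inv ?_
    rw [← Matrix.diagonal_smul, Matrix.diagonal_mul_diagonal, ← Matrix.diagonal_one]
    congr 1
    funext k
    have h1 := (D.sqrt_lam_pos k).ne'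
    have h2 : Real.sqrt 2 ≠ 0 := by positivity
    rw [Real.sqrt_div (D.lam_nonneg k), Pi.smul_apply, smul_eq_mul]
    field_simp
  have hexp : NormedSpace.exp (-(c * t) • Matrix.diagonal D.lam) =
      Matrix.diagonal fun k => Real.exp (-t * D.kap k) := by
    rw [← Matrix.diagonal_smul, Matrix.exp_diagonal, Pi.exp_def]
    congr 1
    funext k
    rw [← Real.exp_eq_exp_ℝ, Pi.smul_apply, smul_eq_mul, EigenData.kap]
    congr 1
    ring
  have hmid : Matrix.diagonal (fun k => Real.exp (-t * D.kap k)) *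
      ((2 : ℝ) • (D.scaledCov p₀ - 1)) * Matrix.diagonal (fun k => Real.exp (-t * D.kap k)) +
        (2 : ℝ) • 1 = (2 : ℝ) • D.scaledCov (p t) := by
    ext i j
    rw [Matrix.add_apply, Matrix.mul_diagonal, Matrix.diagonal_mul, Matrix.smul_apply,
      Matrix.smul_apply, Matrix.smul_apply, Matrix.sub_apply, Matrix.one_apply,
      h.scaledCov_eq hp₀ ht]
    simp only [smul_eq_mul]
    ring
  rw [hinv, hexp, hmid, D.cov_eq]
  simp only [Matrix.mul_smul, Matrix.smul_mul, smul_smul]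
  rw [show (1 / 4 : ℝ) * (Real.sqrt 2 * (2 * Real.sqrt 2)) = 1 by
    have := Real.mul_self_sqrt (show (0 : ℝ) ≤ 2 by norm_num)
    linear_combination (1 / 2 : ℝ) * this, one_smul]

theorem EigenData.smul_inv_eq (D : EigenData Γ c) : c • Γ⁻¹ =
    D.colMatrix * Matrix.diagonal (fun i => (Real.sqrt (D.lam i))⁻¹) * 1 *
      Matrix.diagonal (fun i => (Real.sqrt (D.lam i))⁻¹) * D.colMatrix.transpose := by
  have h1 : Γ⁻¹ = D.colMatrix * Matrix.diagonal (fun i => (c * D.lam i)⁻¹) *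
      D.colMatrix.transpose := by
    refine Matrix.inv_eq_right_inv ?_
    rw [← Matrix.mul_assoc, ← Matrix.mul_assoc, D.mul_colMatrix, Matrix.mul_assoc D.colMatrix,
      Matrix.diagonal_mul_diagonal]
    have : (fun i => c * D.lam i * (c * D.lam i)⁻¹) = fun _ => 1 := funext fun i =>
      mul_inv_cancel₀ (mul_pos D.c_pos (D.lam_pos i)).ne'
    rw [this, Matrix.diagonal_one, Matrix.mul_one, mul_eq_one_comm]
    exact D.colMatrix_orthogonal
  rw [h1, Matrix.mul_one, Matrix.mul_assoc D.colMatrix (Matrix.diagonal _) (Matrix.diagonal _),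
    Matrix.diagonal_mul_diagonal, ← Matrix.smul_mul, ← Matrix.mul_smul, ← Matrix.diagonal_smul]
  congr 3
  funext i
  have h2 := D.c_pos.ne'
  have h3 := D.lam_pos i
  rw [← mul_inv, Real.mul_self_sqrt h3.le, Pi.smul_apply, smul_eq_mul]
  field_simp

theorem EigenData.IsFlow.tendsto_cov (h : D.IsFlow yref yref' u p₀ p) (hp₀ : mass p₀ = 1) :
    Tendsto (fun t => cov (p t)) atTop (𝓝 (c • Γ⁻¹)) := by
  have hlim : Tendsto (fun t => D.scaledCov (p t)) atTop (𝓝 1) := by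
    refine tendsto_pi_nhds.2 fun i => tendsto_pi_nhds.2 fun j => ?_
    have hE : ∀ i, Tendsto (fun t : ℝ => Real.exp (-t * D.kap i)) atTop (𝓝 0) := fun i => by
      refine Real.tendsto_exp_atBot.comp ?_
      exact tendsto_neg_atTop_atBot.atBot_mul_const (D.kap_pos i)
    have h2 : Tendsto (fun t => (if i = j then (1 : ℝ) else 0) +
        Real.exp (-t * D.kap i) * (D.scaledCov p₀ i j - if i = j then 1 else 0) *
          Real.exp (-t * D.kap j)) atTop (𝓝 (if i = j then 1 else 0)) := by
      have := (((hE i).mul_const (D.scaledCov p₀ i j - if i = j then 1 else 0)).mul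
        (hE j)).const_add (if i = j then (1 : ℝ) else 0)
      simpa using this
    rw [Matrix.one_apply]
    refine h2.congr' ?_
    filter_upwards [eventually_ge_atTop 0] with t ht
    rw [h.scaledCov_eq hp₀ ht]
  simp only [D.cov_eq, D.smul_inv_eq]
  exact ((tendsto_const_nhds.mul hlim).mul tendsto_const_nhds).mul tendsto_const_nhds

end Flow

/-- An arbitrary diagonalisation is itself a set of eigendata: its columns are orthonormal, and
positivity of `lam` is positive definiteness evaluated on them. -/
theorem EigenData.exists_of_colMatrix (hΓ : Γ.PosDef) (hc : 0 < c)
    {V : Matrix (Fin n) (Fin n) ℝ} {lam : Fin n → ℝ} (hV : V.transpose * V = 1)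
    (hΓV : Γ * V = V * Matrix.diagonal (fun k => c * lam k)) :
    ∃ D : EigenData Γ c, D.colMatrix = V ∧ D.lam = lam := by
  set v : Fin n → EuclideanSpace ℝ (Fin n) := fun i => WithLp.toLp 2 fun k => V k i with hv
  have hinner : ∀ i j, ⟪v i, v j⟫ = if i = j then (1 : ℝ) else 0 := by
    intro i j
    have h := congrFun (congrFun hV i) j
    rw [Matrix.mul_apply, Matrix.one_apply] at h
    rw [← h]
    simp [hv, PiLp.inner_apply, mul_comm]
  have hon : Orthonormal ℝ v := orthonormal_iff_ite.2 hinner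
  set b : OrthonormalBasis (Fin n) ℝ (EuclideanSpace ℝ (Fin n)) :=
    OrthonormalBasis.mk hon (by
      rw [hon.linearIndependent.span_eq_top_of_card_eq_finrank' (by simp)]) with hb
  have hbv : ∀ i, b i = v i := fun i => by rw [hb, OrthonormalBasis.coe_mk]
  have hact : ∀ i, act Γ (v i) = (c * lam i) • v i := by
    intro i
    ext k
    have h := congrFun (congrFun hΓV k) i
    rw [Matrix.mul_diagonal, Matrix.mul_apply] at h
    simp only [act, hv, Matrix.toLpLin_apply, Matrix.mulVec, dotProduct, PiLp.smul_apply,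
      smul_eq_mul]
    rw [h, mul_comm]
  have hpos : ∀ i, 0 < lam i := by
    intro i
    have hne : v i ≠ 0 := hon.ne_zero i
    have h1 := hΓ.dotProduct_mulVec_pos (x := (v i).ofLp) (by simpa using hne)
    have h2 : star (v i).ofLp ⬝ᵥ Γ.mulVec (v i).ofLp = ⟪v i, act Γ (v i)⟫ := by
      simp [act, PiLp.inner_apply, Matrix.toLpLin_apply, dotProduct, mul_comm]
    rw [h2, hact, inner_smul_right, hinner, if_pos rfl, mul_one] at h1
    exact pos_of_mul_pos_right h1 hc.le
  refine ⟨⟨b, lam, hpos, fun i => by rw [hbv, hact], hc⟩, ?_, rfl⟩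
  ext k i
  simp [EigenData.colMatrix, hbv, hv]

end

/-! ### The Laplace transform of the solution and positivity -/

section

variable {n : ℕ} {Γ : Matrix (Fin n) (Fin n) ℝ} {c : ℝ}

/-! ### The Laplace transform of the flow -/

/-- Pairs `β ≤ α` correspond to pairs `(β, α - β)`. -/
def boxEquiv (n : ℕ) :
    (Σ α : Fin n → ℕ, ↥(Finset.Iic α)) ≃ (Fin n → ℕ) × (Fin n → ℕ) where
  toFun x := (x.2.1, x.1 - x.2.1)
  invFun y := ⟨y.1 + y.2, y.1, Finset.mem_Iic.2 (le_add_of_nonneg_right zero_le)⟩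
  left_inv := by
    rintro ⟨α, β, hβ⟩
    have h : β + (α - β) = α := add_tsub_cancel_of_le (Finset.mem_Iic.1 hβ)
    refine Sigma.ext h ?_
    rw [Subtype.heq_iff_coe_eq]
    intro γ
    simp only [h]
  right_inv := by
    rintro ⟨β, γ⟩
    simp

/-- A multi-index Cauchy product. Absolute convergence allows summing the product family over pairs
`(β, α - β)`, grouped by `α`. -/
theorem hasSum_boxConvolution {f g : (Fin n → ℕ) → ℝ} {a b : ℝ} (hf : HasSum f a)
    (hg : HasSum g b) : HasSum (fun α => ∑ β ∈ Finset.Iic α, f β * g (α - β)) (a * b) := by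
  have h1 : HasSum (fun x : (Fin n → ℕ) × (Fin n → ℕ) => f x.1 * g x.2) (a * b) :=
    hf.mul hg (summable_mul_of_summable_norm hf.summable.norm hg.summable.norm)
  have h2 := (boxEquiv n).hasSum_iff.2 h1
  refine h2.sigma fun α => ?_
  exact Finset.hasSum (Finset.Iic α) fun β => f β * g (α - β)

theorem choose_mul_pow_div_factorial (d m E : ℝ) {k l : ℕ} (h : l ≤ k) :
    d ^ k * ((k.choose l : ℝ) * m ^ (k - l)) * E ^ l / k.factorial =
      (d * E) ^ l / l.factorial * ((d * m) ^ (k - l) / (k - l).factorial) := by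
  obtain ⟨j, rfl⟩ := Nat.exists_eq_add_of_le h
  have h1 : ((l + j).choose l : ℝ) * l.factorial * j.factorial = (l + j).factorial := by
    have := Nat.choose_mul_factorial_mul_factorial h
    rw [Nat.add_sub_cancel_left] at this
    exact_mod_cast this
  have h2 : (l.factorial : ℝ) ≠ 0 := by positivity
  have h3 : (j.factorial : ℝ) ≠ 0 := by positivity
  have h4 : ((l + j).factorial : ℝ) ≠ 0 := by positivity
  rw [Nat.add_sub_cancel_left, div_mul_div_comm, div_eq_div_iff h4 (mul_ne_zero h2 h3), ← h1]
  ring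

/-- Weighted by `d^α / √α!`, the binomial transform becomes a convolution: the decay rescales `d`,
and the translation contributes an exponential series. -/
theorem prod_pow_div_sqf_mul_flow (κ m d : Fin n → ℝ) (t : ℝ) (q : (Fin n → ℕ) → ℝ)
    (α : Fin n → ℕ) : (∏ i, d i ^ α i) / sqf α * flow κ m t q α =
      ∑ β ∈ Finset.Iic α, (∏ i, (d i * Real.exp (-t * κ i)) ^ β i) / sqf β * q β *
        ∏ i, (d i * m i) ^ (α - β) i / ((α - β) i).factorial := by
  rw [flow_eq_sum, Finset.mul_sum]
  refine Finset.sum_congr rfl fun β hβ => ?_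
  have hle : β ≤ α := Finset.mem_Iic.1 hβ
  have hα := (sqf_pos α).ne'
  have hβ0 := (sqf_pos β).ne'
  have key : (∏ i, d i ^ α i) * (shiftKer m α β * Real.exp (-t * wsum κ β)) / sqf α ^ 2 =
      (∏ i, (d i * Real.exp (-t * κ i)) ^ β i) / sqf β ^ 2 *
        ∏ i, (d i * m i) ^ (α - β) i / ((α - β) i).factorial := by
    rw [shiftKer_mul_exp, sqf_sq, sqf_sq, ← Finset.prod_mul_distrib, ← Finset.prod_div_distrib,
      ← Finset.prod_div_distrib, ← Finset.prod_mul_distrib]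
    refine Finset.prod_congr rfl fun i _ => ?_
    rw [Pi.sub_apply, ← choose_mul_pow_div_factorial _ _ _ (hle i), ← Real.exp_nat_mul]
    rw [show -t * (κ i * β i) = (β i : ℝ) * (-t * κ i) by ring]
    ring
  calc (∏ i, d i ^ α i) / sqf α *
        (shiftKer m α β * Real.exp (-t * wsum κ β) * sqf β / sqf α * q β)
      = (∏ i, d i ^ α i) * (shiftKer m α β * Real.exp (-t * wsum κ β)) / sqf α ^ 2 *
          (sqf β * q β) := by field_simp
    _ = _ := by rw [key]; field_simp

theorem EigenData.inner_nv_ev (D : EigenData Γ c) (α : Fin n → ℕ)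
    (ξ : EuclideanSpace ℝ (Fin n)) : ⟪D.nv α, D.ev ξ⟫ =
      Real.sqrt (gaussMass Γ c) * Real.exp (1 / 2 * ∑ i, D.dualCoord ξ i ^ 2) *
        ((∏ i, D.dualCoord ξ i ^ α i) / sqf α) := by
  have h1 := (sqf_pos α).ne'
  have h2 := D.sqrt_gaussMass_pos.ne'
  rw [EigenData.nv, inner_smul_left, D.inner_hv_ev, conj_trivial]
  conv_lhs => rw [← Real.mul_self_sqrt D.gaussMass_pos.le]
  rw [Real.sqrt_mul_self (Real.sqrt_nonneg _)]
  field_simp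

theorem EigenData.hasSum_inner_ev (D : EigenData Γ c) (ξ : EuclideanSpace ℝ (Fin n))
    (z : FrakH Γ c) : HasSum (fun α => (∏ i, D.dualCoord ξ i ^ α i) / sqf α * D.coord z α)
      (⟪D.ev ξ, z⟫ /
        (Real.sqrt (gaussMass Γ c) * Real.exp (1 / 2 * ∑ i, D.dualCoord ξ i ^ 2))) := by
  have hne : Real.sqrt (gaussMass Γ c) * Real.exp (1 / 2 * ∑ i, D.dualCoord ξ i ^ 2) ≠ 0 :=
    mul_ne_zero D.sqrt_gaussMass_pos.ne' (Real.exp_pos _).ne'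
  refine ((D.basis.hasSum_inner_mul_inner (D.ev ξ) z).div_const _).congr_fun fun α => ?_
  rw [D.basis_apply, real_inner_comm, D.inner_nv_ev, EigenData.coord, mul_assoc,
    mul_div_cancel_left₀ _ hne]

/-- The vector with eigencoordinates `a i * ⟪b i, x⟫`. -/
def EigenData.diagMap (D : EigenData Γ c) (a : Fin n → ℝ) (x : EuclideanSpace ℝ (Fin n)) :
    EuclideanSpace ℝ (Fin n) :=
  ∑ i, (a i * ⟪D.b i, x⟫) • D.b i

theorem EigenData.inner_diagMap (D : EigenData Γ c) (a : Fin n → ℝ)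
    (x : EuclideanSpace ℝ (Fin n)) (i : Fin n) :
    ⟪D.b i, D.diagMap a x⟫ = a i * ⟪D.b i, x⟫ := by
  simp [EigenData.diagMap, inner_sum, inner_smul_right, D.inner_basis_b]

theorem EigenData.dualCoord_diagMap (D : EigenData Γ c) (a : Fin n → ℝ)
    (ξ : EuclideanSpace ℝ (Fin n)) (i : Fin n) :
    D.dualCoord (D.diagMap a ξ) i = D.dualCoord ξ i * a i := by
  rw [EigenData.dualCoord, D.inner_diagMap, EigenData.dualCoord]; ring

theorem EigenData.inner_eq_sum (D : EigenData Γ c) (x y : EuclideanSpace ℝ (Fin n)) :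
    ⟪x, y⟫ = ∑ i, ⟪D.b i, x⟫ * ⟪D.b i, y⟫ := by
  rw [← D.b.sum_inner_mul_inner x y]
  simp only [real_inner_comm]

theorem EigenData.inner_diagMap_right (D : EigenData Γ c) (a : Fin n → ℝ)
    (ξ x : EuclideanSpace ℝ (Fin n)) : ⟪ξ, D.diagMap a x⟫ = ⟪D.diagMap a ξ, x⟫ := by
  rw [D.inner_eq_sum, D.inner_eq_sum]
  refine Finset.sum_congr rfl fun i _ => ?_
  rw [D.inner_diagMap, D.inner_diagMap]; ring

theorem EigenData.continuous_diagMap (D : EigenData Γ c) (a : Fin n → ℝ) :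
    Continuous (D.diagMap a) := by
  unfold EigenData.diagMap
  fun_prop

section Flow

variable {yref yref' u : ℝ → EuclideanSpace ℝ (Fin n)} {D : EigenData Γ c} {p₀ : FrakH Γ c}
  {p : ℝ → FrakH Γ c}

/-- The Laplace transform is a Gaussian factor times the generating function of the Hermite
coordinates, which the flow turns into a product. The quotient of the two Gaussian factors leaves
the variance `1 - e^{-2tκ_i}` in the `i`-th scaled coordinate. -/
theorem EigenData.IsFlow.inner_ev (h : D.IsFlow yref yref' u p₀ p) {t : ℝ} (ht : 0 ≤ t)
    (ξ : EuclideanSpace ℝ (Fin n)) : ⟪D.ev ξ, p t⟫ =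
      Real.exp (1 / 2 * ∑ i, (D.dualCoord ξ i * Real.sqrt (1 - Real.exp (-t * D.kap i) ^ 2)) ^ 2) *
      Real.exp (∑ i, D.dualCoord ξ i * D.path yref yref' t i) *
      ⟪D.ev (D.diagMap (fun i => Real.exp (-t * D.kap i)) ξ), p₀⟫ := by
  set ξ' := D.diagMap (fun i => Real.exp (-t * D.kap i)) ξ with hξ'
  have h1 := D.hasSum_inner_ev ξ (p t)
  have h2 := hasSum_boxConvolution (D.hasSum_inner_ev ξ' p₀)
    (hasSum_multiExp fun i => D.dualCoord ξ i * D.path yref yref' t i)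
  rw [h.coord_eq ht] at h1
  simp only [prod_pow_div_sqf_mul_flow] at h1
  simp only [hξ', D.dualCoord_diagMap] at h2
  have h3 := h1.unique h2
  have hG := D.sqrt_gaussMass_pos.ne'
  have e1 := (Real.exp_pos (1 / 2 * ∑ i, D.dualCoord ξ i ^ 2)).ne'
  have e2 := (Real.exp_pos
    (1 / 2 * ∑ i, (D.dualCoord ξ i * Real.exp (-t * D.kap i)) ^ 2)).ne'
  have e3 : Real.exp (1 / 2 * ∑ i, D.dualCoord ξ i ^ 2) =
      Real.exp (1 / 2 * ∑ i, (D.dualCoord ξ i *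
        Real.sqrt (1 - Real.exp (-t * D.kap i) ^ 2)) ^ 2) *
      Real.exp (1 / 2 * ∑ i, (D.dualCoord ξ i * Real.exp (-t * D.kap i)) ^ 2) := by
    rw [← Real.exp_add, ← mul_add, ← Finset.sum_add_distrib]
    congr 2
    refine Finset.sum_congr rfl fun i _ => ?_
    have : Real.exp (-t * D.kap i) ^ 2 ≤ 1 := by
      refine pow_le_one₀ (Real.exp_pos _).le (Real.exp_le_one_iff.2 ?_)
      have := D.kap_pos i
      nlinarith
    rw [mul_pow, Real.sq_sqrt (by linarith)]
    ring
  rw [div_eq_iff (mul_ne_zero hG e1), e3, ← hξ'] at h3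
  rw [h3]
  field_simp

/-! ### Positivity -/

theorem withDensity_ofReal_integral {E : Type*} [MeasurableSpace E] {μ : Measure E} {g : E → ℝ}
    (hg : Measurable g) (hg0 : ∀ᵐ x ∂μ, 0 ≤ g x) (f : E → ℝ) :
    (∫ x, f x ∂(μ.withDensity fun x => ENNReal.ofReal (g x)) = ∫ x, f x * g x ∂μ) ∧
    (Integrable f (μ.withDensity fun x => ENNReal.ofReal (g x)) ↔
      Integrable (fun x => f x * g x) μ) := by
  have hlt : ∀ᵐ x ∂μ, ENNReal.ofReal (g x) < ⊤ := ae_of_all _ fun x => ENNReal.ofReal_lt_top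
  have he : (fun x => (ENNReal.ofReal (g x)).toReal • f x) =ᵐ[μ] fun x => f x * g x := by
    filter_upwards [hg0] with x hx
    rw [ENNReal.toReal_ofReal hx, smul_eq_mul, mul_comm]
  constructor
  · rw [integral_withDensity_eq_integral_toReal_smul hg.ennreal_ofReal hlt]
    exact integral_congr_ae he
  · rw [integrable_withDensity_iff_integrable_smul' hg.ennreal_ofReal hlt]
    exact integrable_congr he

/-- The three factors of `inner_ev` are the Laplace transforms of contracted initial data, a
deterministic shift and independent Gaussian noise. The push-forward of the product measure under
their sum is a positive measure with the transform of `p t`. -/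
theorem EigenData.IsFlow.nonneg (h : D.IsFlow yref yref' u p₀ p) (hp₀ : ∀ᵐ x, 0 ≤ p₀ x) {t : ℝ}
    (ht : 0 ≤ t) : ∀ᵐ x, 0 ≤ p t x := by
  set E : Fin n → ℝ := fun i => Real.exp (-t * D.kap i) with hE
  set S : Fin n → ℝ := fun i => Real.sqrt (1 - Real.exp (-t * D.kap i) ^ 2) with hS
  set v : EuclideanSpace ℝ (Fin n) :=
    ∑ i, (D.path yref yref' t i / Real.sqrt (D.lam i)) • D.b i with hv
  have hzm : Measurable fun x => p₀ x := (Lp.stronglyMeasurable p₀).measurable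
  have hgm : Measurable fun x => (gaussMass Γ c)⁻¹ * Real.exp (-phi Γ c x) :=
    (continuous_const.mul (Real.continuous_exp.comp continuous_phi.neg)).measurable
  have hg0 : ∀ᵐ x : EuclideanSpace ℝ (Fin n), 0 ≤ (gaussMass Γ c)⁻¹ * Real.exp (-phi Γ c x) :=
    ae_of_all _ fun x => mul_nonneg (inv_nonneg.2 D.gaussMass_pos.le) (Real.exp_pos _).le
  set μ₁ : Measure (EuclideanSpace ℝ (Fin n)) :=
    volume.withDensity fun x => ENNReal.ofReal (p₀ x) with hμ₁
  set μ₂ : Measure (EuclideanSpace ℝ (Fin n)) :=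
    volume.withDensity fun x => ENNReal.ofReal ((gaussMass Γ c)⁻¹ * Real.exp (-phi Γ c x)) with hμ₂
  have hf₁ : IsFiniteMeasure μ₁ := isFiniteMeasure_withDensity_ofReal (by
    simpa using (D.integrable_growth_mul (Growth.const 1) p₀).2)
  have hf₂ : IsFiniteMeasure μ₂ :=
    isFiniteMeasure_withDensity_ofReal (D.integrable_gauss.const_mul _).2
  have hi₁ : ∀ η, Integrable (fun x => Real.exp ⟪η, x⟫) μ₁ := fun η =>
    (withDensity_ofReal_integral hzm hp₀ _).2.2 (D.integrable_growth_mul (Growth.exp_inner η) p₀)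
  have hi₂ : ∀ η, Integrable (fun x => Real.exp ⟪η, x⟫) μ₂ := fun η => by
    refine (withDensity_ofReal_integral hgm hg0 _).2.2 ?_
    refine ((D.integrable_growth (Growth.exp_inner η)).const_mul (gaussMass Γ c)⁻¹).congr
      (ae_of_all _ fun x => ?_)
    ring
  have hI₁ : ∀ η, ∫ x, Real.exp ⟪η, x⟫ ∂μ₁ = ⟪D.ev η, p₀⟫ := fun η => by
    rw [(withDensity_ofReal_integral hzm hp₀ _).1, EigenData.ev, D.inner_vec]
  have hI₂ : ∀ η, ∫ x, Real.exp ⟪η, x⟫ ∂μ₂ = Real.exp (1 / 2 * ∑ i, D.dualCoord η i ^ 2) :=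
    fun η => by
    rw [(withDensity_ofReal_integral hgm hg0 _).1]
    have e : ∀ x, Real.exp ⟪η, x⟫ * ((gaussMass Γ c)⁻¹ * Real.exp (-phi Γ c x)) =
        (gaussMass Γ c)⁻¹ * (Real.exp ⟪η, x⟫ * Real.exp (-phi Γ c x)) := fun x => by ring
    simp only [e]
    rw [integral_const_mul, D.integral_exp_gauss, inv_mul_cancel_left₀ D.gaussMass_pos.ne']
  -- The diagonal maps are self-adjoint, so in the transform they move from the points to the dual
  -- variable `ξ`.
  set T : EuclideanSpace ℝ (Fin n) × EuclideanSpace ℝ (Fin n) → EuclideanSpace ℝ (Fin n) :=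
    fun x => D.diagMap E x.1 + v + D.diagMap S x.2 with hT
  have hTm : Measurable T := by
    have h1 := D.continuous_diagMap E
    have h2 := D.continuous_diagMap S
    exact (by fun_prop : Continuous T).measurable
  have hTe : ∀ ξ x, Real.exp ⟪ξ, T x⟫ = Real.exp ⟪ξ, v⟫ *
      (Real.exp ⟪D.diagMap E ξ, x.1⟫ * Real.exp ⟪D.diagMap S ξ, x.2⟫) := fun ξ x => by
    rw [← Real.exp_add, ← Real.exp_add, hT, inner_add_right, inner_add_right,
      D.inner_diagMap_right, D.inner_diagMap_right]
    congr 1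
    ring
  have hexpm : ∀ ξ : EuclideanSpace ℝ (Fin n), Measurable fun x => Real.exp ⟪ξ, x⟫ := fun ξ =>
    (by fun_prop : Continuous fun x : EuclideanSpace ℝ (Fin n) => Real.exp ⟪ξ, x⟫).measurable
  have hξv : ∀ ξ, ⟪ξ, v⟫ = ∑ i, D.dualCoord ξ i * D.path yref yref' t i := fun ξ => by
    rw [hv, inner_sum]
    refine Finset.sum_congr rfl fun i _ => ?_
    rw [inner_smul_right, real_inner_comm, EigenData.dualCoord]
    ring
  refine D.ae_nonneg_of_laplace_eq (p t) ((μ₁.prod μ₂).map T) (fun ξ => ?_) fun ξ => ?_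
  · rw [integrable_map_measure (hexpm ξ).aestronglyMeasurable hTm.aemeasurable]
    refine Integrable.congr (((hi₁ (D.diagMap E ξ)).mul_prod (hi₂ (D.diagMap S ξ))).const_mul
      (Real.exp ⟪ξ, v⟫)) (ae_of_all _ fun x => ?_)
    exact (hTe ξ x).symm
  · rw [integral_map hTm.aemeasurable (hexpm ξ).aestronglyMeasurable]
    simp only [hTe]
    rw [integral_const_mul, integral_prod_mul (fun x => Real.exp ⟪D.diagMap E ξ, x⟫)
      (fun x => Real.exp ⟪D.diagMap S ξ, x⟫), hI₁, hI₂, h.inner_ev ht ξ, hξv]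
    simp only [D.dualCoord_diagMap, hS]
    ring

end Flow

end

end FokkerPlanck

end

/-! ### Assembly of the theorem -/

theorem proposition4p1 (n : ℕ) (hn : 0 < n) (Γ : Matrix (Fin n) (Fin n) ℝ) (hΓ : Γ.PosDef)
    (c : ℝ) (hc : 0 < c) (p₀ : FrakH Γ c)
    -- `yref ∈ W^{1,∞}(ℝ_{≥0}; ℝⁿ)` (its continuous representative) with weak derivative `yref'`
    (yref yref' : ℝ → EuclideanSpace ℝ (Fin n)) (hcont : ContinuousOn yref (Ici 0))
    (hyref : MemW1With ⊤ yref yref' (Ioi 0))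
    -- the feedforward control
    (u : ℝ → EuclideanSpace ℝ (Fin n)) (hu : ∀ t, u t = yref' t + act Γ (yref t)) :
    ∃ p : ℝ → FrakH Γ c,
      IsMildSolution Γ c id u 0 p₀ p ∧
      -- uniqueness
      (∀ p₂ : ℝ → FrakH Γ c, IsMildSolution Γ c id u 0 p₀ p₂ → EqOn p₂ p (Ici 0)) ∧
      -- regularity and boundedness
      (∀ t₁ : ℝ, 0 < t₁ → ∀ q : ENNReal, 1 ≤ q → q < 2 → MemRegularity q p t₁) ∧
      MemLp p ⊤ (volume.restrict (Ioi 0)) ∧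
      -- the output
      (∀ t : ℝ, 0 ≤ t → mean (p t) = mass p₀ • yref t +
        act (NormedSpace.exp (-t • Γ)) (mean (p 0) - mass p₀ • yref 0)) ∧
      -- the equation in the weak sense
      (∀ t₁ : ℝ, 0 < t₁ → SatisfiesWeakEquation id u 0 p t₁) ∧
      -- higher regularity for regular initial values
      ((∃ z : FrakV Γ c, valV z = p₀) →
        ∀ t₁ : ℝ, 0 < t₁ → ∀ q : ENNReal, 1 ≤ q → q < ⊤ → MemRegularity q p t₁) ∧
      -- conservation of mass
      (∀ t : ℝ, 0 ≤ t → mass (p t) = mass p₀) ∧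
      -- preservation of positivity
      ((∀ᵐ x, 0 ≤ p₀ x) → ∀ t : ℝ, 0 ≤ t → ∀ᵐ x, 0 ≤ p t x) ∧
      -- the covariance matrix, for every orthonormal basis of eigenvectors of `Γ` (the columns
      -- of `V`), with eigenvalues `c * lam k`
      (mass p₀ = 1 →
        (∀ (V : Matrix (Fin n) (Fin n) ℝ) (lam : Fin n → ℝ), V.transpose * V = 1 →
          Γ * V = V * Matrix.diagonal (fun k => c * lam k) →
          ∃ K : Matrix (Fin n) (Fin n) ℝ, ∀ t : ℝ, 0 ≤ t →
            cov (p t) = (1 / 4 : ℝ) •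
              (V * (Matrix.diagonal fun k => Real.sqrt (lam k / 2))⁻¹ *
                (NormedSpace.exp (-(c * t) • Matrix.diagonal lam) * K *
                  NormedSpace.exp (-(c * t) • Matrix.diagonal lam) + (2 : ℝ) • 1) *
                (Matrix.diagonal fun k => Real.sqrt (lam k / 2))⁻¹ * V.transpose)) ∧
        Tendsto (fun t => cov (p t)) atTop (𝓝 (c • Γ⁻¹))) := by
  obtain ⟨D⟩ := exists_eigenData hΓ hc
  have href : IsReference Γ yref yref' u := ⟨hcont, hyref, hu⟩
  obtain ⟨p, h⟩ := D.exists_isFlow href p₀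
  have hmild : IsMildSolution Γ c id u 0 p₀ p := D.isMildSolution_of_flow href h.cont h.coord
  refine ⟨p, hmild, fun p₂ h₂ => D.isMildSolution_unique href.memLp_control hmild h₂,
    fun t₁ ht₁ q hq1 hq => h.memRegularity_of_lt_two ht₁ hq1 hq, h.memLp_top,
    fun t ht => h.mean_eq ht, fun t₁ ht₁ => h.satisfiesWeakEquation ht₁, ?_,
    fun t ht => h.mass_eq ht, fun hp₀ t ht => h.nonneg hp₀ ht, fun hp₀ => ⟨?_, h.tendsto_cov hp₀⟩⟩
  · rintro ⟨z, rfl⟩ t₁ ht₁ q hq1 _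
    exact h.memRegularity_of_frakV ht₁ hq1
  · intro V lam hV hΓV
    -- The solution was built from one eigenbasis, while the covariance formula is claimed for all.
    -- The flow built from the given basis is also a mild solution, so by uniqueness it is the same
    -- function.
    obtain ⟨D', rfl, rfl⟩ := EigenData.exists_of_colMatrix hΓ hc hV hΓV
    obtain ⟨p', h'⟩ := D'.exists_isFlow href p₀
    have heq : EqOn p p' (Ici 0) := D'.isMildSolution_unique href.memLp_control
      (D'.isMildSolution_of_flow href h'.cont h'.coord) hmild
    refine ⟨(2 : ℝ) • (D'.scaledCov p₀ - 1), fun t ht => ?_⟩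
    rw [heq (mem_Ici.2 ht)]
    exact h'.cov_eq hp₀ ht
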